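/- Let $2^{<\omega}$ be the set of finite binary strings, write $\sigma\preceq\tau$ ($\sigma\prec\tau$) if $\sigma$ is an initial segment (a proper initial segment) of $\tau$, and let $[2^{<\omega}]^2$ be the set of pairs $\langle\sigma,\tau\rangle$ of strings with $\sigma\prec\tau$. A set $H\subseteq 2^{<\omega}$ is isomorphic to $2^{<\omega}$, written $H\cong 2^{<\omega}$, if there is a bijection $i:2^{<\omega}\to H$ such that $\sigma\preceq\tau$ if and only if $i(\sigma)\preceq i(\tau)$ for all $\sigma,\tau$. For $f:[2^{<\omega}]^2\to 2$, the set $H$ is $f$-homogeneous if there is a color $c<2$ such that $f(\sigma,\tau)=c$ for all $\sigma\prec\tau$ in $H$. The tree theorem for pairs $\mathsf{TT}^2_2$ states that for every $f:[2^{<\omega}]^2\to 2$ there is an $f$-homogeneous $H\cong 2^{<\omega}$. Strings are identified with natural numbers through a computable coding, $\leq_T$ is Turing reducibility and $\oplus$ is the join. **Theorem.** $\mathsf{TT}^2_2$ admits cone avoidance: for all sets $Z,C\subseteq\omega$ with $C\not\leq_T Z$ and every $Z$-computable coloring $f:[2^{<\omega}]^2\to 2$, there is an $f$-homogeneous set $H\subseteq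 2^{<\omega}$ such that $H\cong 2^{<\omega}$ and $C\not\leq_T H\oplus Z$. Moreover, $\mathsf{RCA}_0\nvdash\mathsf{TT}^2_2\to\mathsf{ACA}_0$; that is, there is an axiom $\varphi$ of $\mathsf{ACA}_0$ such that the sentence $\mathsf{TT}^2_2\to\varphi$ of second-order arithmetic has no formal derivation from the axioms of $\mathsf{RCA}_0$. Here $\mathsf{RCA}_0$ consists of the basic axioms of arithmetic, $\Sigma^0_1$ induction and $\Delta^0_1$ comprehension, and $\mathsf{ACA}_0$ of the basic axioms, the induction axiom for sets and arithmetical comprehension. In the formal sentence $\mathsf{TT}^2_2$, the condition $H\cong 2^{<\omega}$ is expressed arithmetically: $H$ is a set of strings with a unique root (an element with no proper initial segment in $H$), and every $\sigma\in H$ has exactly two immediate successors in $H$, that is, $\tau\in H$ with $\sigma\prec\tau$ and no $\xi\in H$ with $\sigma\prec\xi\prec\tau$. -/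

import Mathlib

namespace TreeTheorem

/-! ### Turing reducibility between sets of natural numbers, joins, codes of sets -/

/-- The characteristic function of a set of natural numbers. -/
noncomputable def charFun (A : Set ℕ) : ℕ →. ℕ :=
  open Classical in fun n => Part.some (if n ∈ A then 1 else 0)

/-- `A ≤_T B` for sets of natural numbers. -/
def SetReducible (A B : Set ℕ) : Prop :=
  TuringReducible (charFun A) (charFun B)

/-- The join `A ⊕ B = {2n : n ∈ A} ∪ {2n + 1 : n ∈ B}`. -/
def join (A B : Set ℕ) : Set ℕ :=
  {m | (∃ n ∈ A, m = 2 * n) ∨ (∃ n ∈ B, m = 2 * n + 1)}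

/-- A set of finite binary strings, regarded as a set of natural numbers through the standard
(computable) encoding of strings. -/
def codes (H : Set (List Bool)) : Set ℕ :=
  Encodable.encode '' H

/-! ### Colorings of pairs of comparable strings -/

/-- `σ ≺ τ`: the string `σ` is a proper initial segment of `τ`. -/
def StrictPrefix (σ τ : List Bool) : Prop := σ <+: τ ∧ σ ≠ τ

/-- A `2`-coloring of `[2^{<ω}]²`, the set of pairs `⟨σ, τ⟩` with `σ ≺ τ`. -/
abbrev Coloring : Type := {p : List Bool × List Bool // StrictPrefix p.1 p.2} → Bool

/-- The coloring `f` as a partial function on pairs of strings, with domain `[2^{<ω}]²`. -/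
def Coloring.toPartial (f : Coloring) : List Bool × List Bool →. Bool :=
  fun p => ⟨StrictPrefix p.1 p.2, fun h => f ⟨p, h⟩⟩

/-- `f` is `Z`-computable. (Its domain `[2^{<ω}]²` is a computable set.) -/
def Coloring.ComputableFrom (f : Coloring) (Z : Set ℕ) : Prop :=
  RecursiveIn {charFun Z} f.toPartial

/-- `H` is homogeneous for `f`: all pairs `σ ≺ τ` from `H` receive the same color. -/
def Coloring.Homogeneous (f : Coloring) (H : Set (List Bool)) : Prop :=
  ∃ c : Bool, ∀ σ ∈ H, ∀ τ ∈ H, ∀ h : StrictPrefix σ τ, f ⟨(σ, τ), h⟩ = c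

/-- `H ≅ 2^{<ω}`: there is a bijection `i : 2^{<ω} → H` with `σ ≼ τ` iff `i σ ≼ i τ`. -/
def IsoFullTree (H : Set (List Bool)) : Prop :=
  ∃ i : List Bool → List Bool, Set.BijOn i Set.univ H ∧ ∀ σ τ, σ <+: τ ↔ i σ <+: i τ

/-! ### The language of second-order arithmetic

Number variables and set variables are de Bruijn indices, counted separately for the two sorts. -/

/-- Numerical terms. -/
inductive Term : Type
  | var (n : ℕ) : Term
  | zero : Term
  | one : Term
  | add (s t : Term) : Term
  | mul (s t : Term) : Term

/-- Formulas; `mem t X` is `t ∈ X` for the `X`-th set variable. -/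
inductive Formula : Type
  | eq (s t : Term) : Formula
  | lt (s t : Term) : Formula
  | mem (t : Term) (X : ℕ) : Formula
  | bot : Formula
  | imp (φ ψ : Formula) : Formula
  | allN (φ : Formula) : Formula
  | allS (φ : Formula) : Formula

namespace Term

/-- Simultaneous substitution for the number variables of a term. -/
def subst (σ : ℕ → Term) : Term → Term
  | var n => σ n
  | zero => zero
  | one => one
  | add s t => add (s.subst σ) (t.subst σ)
  | mul s t => mul (s.subst σ) (t.subst σ)

/-- Shift all number variables by one (to pass below a number quantifier). -/
def up (t : Term) : Term := t.subst fun n => var (n + 1)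

/-- The substitution `σ`, passed below a number quantifier. -/
def liftSubst (σ : ℕ → Term) : ℕ → Term
  | 0 => var 0
  | n + 1 => (σ n).up

/-- The numeral `2`. -/
def two : Term := add one one

/-- The pairing function `(s, t) = (s + t)² + s`. -/
def pair (s t : Term) : Term := add (mul (add s t) (add s t)) s

end Term

namespace Formula

open Term

/-- A renaming of set variables, passed below a set quantifier. -/
def liftRen (ρ : ℕ → ℕ) : ℕ → ℕ
  | 0 => 0
  | n + 1 => ρ n + 1

/-- Simultaneous substitution of terms for the free number variables and renaming of the free
set variables. -/
def subst (σ : ℕ → Term) (ρ : ℕ → ℕ) : Formula → Formula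
  | eq s t => eq (s.subst σ) (t.subst σ)
  | lt s t => lt (s.subst σ) (t.subst σ)
  | mem t X => mem (t.subst σ) (ρ X)
  | bot => bot
  | imp φ ψ => imp (φ.subst σ ρ) (ψ.subst σ ρ)
  | allN φ => allN (φ.subst (liftSubst σ) ρ)
  | allS φ => allS (φ.subst σ (liftRen ρ))

/-- Replace number variable `0` by `t`, removing the quantifier position it stood for. -/
def instN (t : Term) (φ : Formula) : Formula :=
  φ.subst (fun n => match n with | 0 => t | k + 1 => var k) id

/-- Replace set variable `0` by the set variable `X`, removing the position it stood for. -/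
def instS (X : ℕ) (φ : Formula) : Formula :=
  φ.subst var (fun n => match n with | 0 => X | k + 1 => k)

/-- Replace number variable `0` by its successor. -/
def succN (φ : Formula) : Formula :=
  φ.subst (fun n => match n with | 0 => add (var 0) one | k + 1 => var (k + 1)) id

/-- Shift the number variables: number variable `0` does not occur in `φ.upN`. -/
def upN (φ : Formula) : Formula := φ.subst (fun n => var (n + 1)) id

/-- Shift the set variables: set variable `0` does not occur in `φ.upS`. -/
def upS (φ : Formula) : Formula := φ.subst var fun n => n + 1

/-- Negation. -/
def neg (φ : Formula) : Formula := imp φ bot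

/-- Conjunction. -/
def and (φ ψ : Formula) : Formula := neg (imp φ (neg ψ))

/-- Disjunction. -/
def or (φ ψ : Formula) : Formula := imp (neg φ) ψ

/-- Biconditional. -/
def iff (φ ψ : Formula) : Formula := and (imp φ ψ) (imp ψ φ)

/-- Existential number quantifier. -/
def exN (φ : Formula) : Formula := neg (allN (neg φ))

/-- Existential set quantifier. -/
def exS (φ : Formula) : Formula := neg (allS (neg φ))

/-- Bounded quantifier `∀ n < t, φ`, where `n` does not occur in `t`. -/
def ballN (t : Term) (φ : Formula) : Formula := allN (imp (lt (var 0) t.up) φ)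

/-- Bounded quantifier `∃ n < t, φ`, where `n` does not occur in `t`. -/
def bexN (t : Term) (φ : Formula) : Formula := neg (ballN t (neg φ))

/-- Formulas all of whose quantifiers are bounded number quantifiers. -/
inductive IsBounded : Formula → Prop
  | eq (s t : Term) : IsBounded (eq s t)
  | lt (s t : Term) : IsBounded (lt s t)
  | mem (t : Term) (X : ℕ) : IsBounded (mem t X)
  | bot : IsBounded bot
  | imp {φ ψ : Formula} : IsBounded φ → IsBounded ψ → IsBounded (imp φ ψ)
  | ballN (t : Term) {φ : Formula} : IsBounded φ → IsBounded (ballN t φ)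

/-- `Σ⁰₁` formulas. -/
def IsSigma01 (φ : Formula) : Prop := ∃ θ, IsBounded θ ∧ φ = exN θ

/-- `Π⁰₁` formulas. -/
def IsPi01 (φ : Formula) : Prop := ∃ θ, IsBounded θ ∧ φ = allN θ

/-- Arithmetical formulas: no set quantifiers (free set variables are allowed). -/
def IsArithmetical : Formula → Prop
  | eq _ _ => True
  | lt _ _ => True
  | mem _ _ => True
  | bot => True
  | imp φ ψ => φ.IsArithmetical ∧ ψ.IsArithmetical
  | allN φ => φ.IsArithmetical
  | allS _ => False

end Formula

open Term Formula

/-! ### Provability -/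

/-- `Provable T φ`: `φ` has a formal derivation from the axioms `T` in two-sorted classical
predicate logic with equality on numbers (a Hilbert calculus with modus ponens and generalization).
Because of unrestricted generalization, an axiom with free variables has the force of its universal
closure. -/
inductive Provable (T : Formula → Prop) : Formula → Prop
  | ax {φ} : T φ → Provable T φ
  | mp {φ ψ} : Provable T (imp φ ψ) → Provable T φ → Provable T ψ
  | genN {φ} : Provable T φ → Provable T (allN φ)
  | genS {φ} : Provable T φ → Provable T (allS φ)
  | weaken (φ ψ) : Provable T (imp φ (imp ψ φ))
  | distrib (φ ψ χ) : Provable T (imp (imp φ (imp ψ χ)) (imp (imp φ ψ) (imp φ χ)))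
  | dne (φ) : Provable T (imp (neg (neg φ)) φ)
  | elimN (φ) (t : Term) : Provable T (imp (allN φ) (φ.instN t))
  | elimS (φ) (X : ℕ) : Provable T (imp (allS φ) (φ.instS X))
  | distribN (φ ψ) : Provable T (imp (allN (imp φ.upN ψ)) (imp φ (allN ψ)))
  | distribS (φ ψ) : Provable T (imp (allS (imp φ.upS ψ)) (imp φ (allS ψ)))
  | eqRefl (t : Term) : Provable T (eq t t)
  | eqSubst (φ : Formula) (s t : Term) : Provable T (imp (eq s t) (imp (φ.instN s) (φ.instN t)))

/-! ### The axiom systems `RCA₀` and `ACA₀` -/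

/-- The basic axioms of second-order arithmetic. -/
inductive BasicAxiom : Formula → Prop
  | succ_ne_zero : BasicAxiom (neg (eq (add (var 0) one) zero))
  | succ_inj : BasicAxiom
      (imp (eq (add (var 0) one) (add (var 1) one)) (eq (var 0) (var 1)))
  | add_zero : BasicAxiom (eq (add (var 0) zero) (var 0))
  | add_succ : BasicAxiom
      (eq (add (var 0) (add (var 1) one)) (add (add (var 0) (var 1)) one))
  | mul_zero : BasicAxiom (eq (mul (var 0) zero) zero)
  | mul_succ : BasicAxiom
      (eq (mul (var 0) (add (var 1) one)) (add (mul (var 0) (var 1)) (var 0)))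
  | not_lt_zero : BasicAxiom (neg (lt (var 0) zero))
  | lt_succ : BasicAxiom
      (iff (lt (var 0) (add (var 1) one)) (or (lt (var 0) (var 1)) (eq (var 0) (var 1))))

/-- The induction axiom `φ(0) ∧ ∀ n (φ(n) → φ(n+1)) → ∀ n φ(n)` for the formula `φ`, with number
variable `0` in the role of `n`. -/
def inductionFor (φ : Formula) : Formula :=
  imp (and (φ.instN zero) (allN (imp φ φ.succN))) (allN φ)

/-- `∃ X ∀ n (n ∈ X ↔ φ(n))`, where `X` does not occur in `φ` and number variable `0` of `φ` is in
the role of `n`. -/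
def comprehensionFor (φ : Formula) : Formula :=
  exS (allN (iff (mem (var 0) 0) φ.upS))

/-- The axioms of `RCA₀`: basic axioms, `Σ⁰₁` induction, `Δ⁰₁` comprehension. -/
inductive RCA0 : Formula → Prop
  | basic {φ} : BasicAxiom φ → RCA0 φ
  | induction {φ} : IsSigma01 φ → RCA0 (inductionFor φ)
  | comprehension {φ ψ} : IsSigma01 φ → IsPi01 ψ →
      RCA0 (imp (allN (iff φ ψ)) (comprehensionFor φ))

/-- The axioms of `ACA₀`: basic axioms, the induction axiom for sets, arithmetical comprehension. -/
inductive ACA0 : Formula → Prop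
  | basic {φ} : BasicAxiom φ → ACA0 φ
  | induction : ACA0 (allS (inductionFor (mem (var 0) 0)))
  | comprehension {φ} : IsArithmetical φ → ACA0 (comprehensionFor φ)

/-! ### The tree theorem for pairs as a sentence of second-order arithmetic

The string `b₀ b₁ … bₖ₋₁` is coded by the positive number with binary expansion
`1 b₀ b₁ … bₖ₋₁`. This is a bijection between `2^{<ω}` and the positive numbers. -/

/-- `t` is a power of two: `t ≠ 0`, and every divisor of `t` is `1` or even. -/
def isPowTwo (t : Term) : Formula :=
  and (neg (eq t zero))
    (ballN (add t one) (ballN (add t.up one)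
      (imp (eq (mul (var 1) (var 0)) t.up.up)
        (or (eq (var 1) one) (bexN (add (var 1) one) (eq (var 2) (add (var 0) (var 0))))))))

/-- `s` codes an initial segment of the string coded by `t`:
`s ≠ 0` and `t = s * p + r` for some power of two `p` and some `r < p`. -/
def isPrefix (s t : Term) : Formula :=
  and (neg (eq s zero))
    (bexN (add t one) (and (isPowTwo (var 0))
      (bexN (var 0) (eq t.up.up (add (mul s.up.up (var 1)) (var 0))))))

/-- `s` codes a proper initial segment of the string coded by `t`. -/
def isStrictPrefix (s t : Term) : Formula :=
  and (isPrefix s t) (neg (eq s t))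

/-- The set variable `F` is (the graph of) a function `[2^{<ω}]² → {0, 1}`: its elements are of the
form `((x, y), c)` with `x ≺ y` and `c < 2`, and for all `x ≺ y` there is exactly one `c`
with `((x, y), c) ∈ F`. -/
def isColoring (F : ℕ) : Formula :=
  and
    (allN (imp (mem (var 0) F)
      (exN (exN (exN (and (isStrictPrefix (var 2) (var 1)) (and (lt (var 0) two)
        (eq (var 3) (pair (pair (var 2) (var 1)) (var 0))))))))))
    (allN (allN (imp (isStrictPrefix (var 1) (var 0))
      (exN (and (mem (pair (pair (var 2) (var 1)) (var 0)) F)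
        (allN (imp (mem (pair (pair (var 3) (var 2)) (var 0)) F) (eq (var 0) (var 1)))))))))

/-- `t` is a root of `H`: it belongs to `H` and has no proper initial segment in `H`. -/
def isRoot (t : Term) (H : ℕ) : Formula :=
  and (mem t H) (allN (imp (mem (var 0) H) (neg (isStrictPrefix (var 0) t.up))))

/-- `t` is an (immediate) successor of `s` in `H`. -/
def isSuccessor (s t : Term) (H : ℕ) : Formula :=
  and (mem t H) (and (isStrictPrefix s t)
    (allN (imp (mem (var 0) H)
      (neg (and (isStrictPrefix s.up (var 0)) (isStrictPrefix (var 0) t.up))))))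

/-- `H` is isomorphic to `2^{<ω}`, in the arithmetical form: `H` is a set of (codes of) strings
with a unique root, and every element of `H` has exactly two successors in `H`. -/
def isFullTree (H : ℕ) : Formula :=
  and (allN (imp (mem (var 0) H) (neg (eq (var 0) zero))))
    (and
      (exN (and (isRoot (var 0) H) (allN (imp (isRoot (var 0) H) (eq (var 0) (var 1))))))
      (allN (imp (mem (var 0) H)
        (exN (exN (and (neg (eq (var 1) (var 0)))
          (and (isSuccessor (var 2) (var 1) H) (and (isSuccessor (var 2) (var 0) H)
            (allN (imp (isSuccessor (var 3) (var 0) H)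
              (or (eq (var 0) (var 2)) (eq (var 0) (var 1)))))))))))))

/-- `H` is homogeneous for the coloring `F`: for some `c < 2`, every pair `x ≺ y` from `H`
has color `c`. -/
def isHomogeneous (F H : ℕ) : Formula :=
  exN (and (lt (var 0) two)
    (allN (allN (imp (and (mem (var 1) H) (and (mem (var 0) H) (isStrictPrefix (var 1) (var 0))))
      (mem (pair (pair (var 1) (var 0)) (var 2)) F)))))

/-- `TT²₂`: for every coloring `F : [2^{<ω}]² → 2` there is an `F`-homogeneous `H ≅ 2^{<ω}`. -/
def TT22 : Formula :=
  allS (imp (isColoring 0) (exS (and (isFullTree 0) (isHomogeneous 1 0))))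

end TreeTheorem

/-! Cone avoidance is proved by Mathias forcing with perfect reservoirs and a disjunction between
the two colors. A condition for color i has a finite homogeneous stem F, a nonempty perfect set X of
strings, and an oracle W that enumerates X and does not compute C; every pair from F to X has color
i. A generic sequence produces a perfect homogeneous G with C not computable from G ⊕ Z
(`exists_generic`), and G ⊕ Z computes a copy of the full tree inside G (`exists_isoFullTree`).

Suppose genericity fails for both colors. Then there is a condition p for color true and an operator
V₁ that no extension of p meets. Choose a finite antichain A in the reservoir of p covering the
stem. In the cone above each a in A choose likewise a blocked condition for color false, with its
own operator, all of them over one oracle W (`exists_blocked_family`). Cover the stem of each of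
these by an antichain R a in its reservoir, and grow a W-computable infinitely branching tree above
every root in the union of the R a.

Consider the colored subtrees of this forest that contain all roots and in which every node has two
children among a fixed finite number. They form a Π⁰₁ class relative to W. Ask whether every member
contains, in the nodes of the matching color, a finite homogeneous extension of one of the stems on
which the corresponding operator gives the value b at n. By compactness the question is Σ₁ over W
(`RE.covers`), so its answers cannot agree with C everywhere (`Forest.dichotomy`).

If the answer is yes for a wrong value, apply it to a subtree carrying the true colors: by
pigeonhole on color patterns there is a branching subtree with a perfect reservoir above its leaves
towards which each node has one fixed color (`exists_true_subtree`). The extension found there is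
compatible with that reservoir and meets an operator by a wrong computation. If the answer is no for
the right value, the basis theorem `exists_path_avoiding` gives a colored subtree that preserves
avoidance and contains no such extension. Thin it to one color above each root. Either every R a has
a true root, and the true roots give a reservoir for p; or some R a has only false roots, and they
give one for the condition above a. In every case a blocked condition is met, a contradiction.

For unprovability, iterating cone avoidance yields a Turing ideal that is an ω-model of RCA₀ and
TT²₂, contains a decidable set, and omits the undecidable projection of that set. Arithmetical
comprehension fails in it, and soundness finishes the proof. -/

namespace TreeTheorem

open Encodable Primrec

/-! ### Relative enumerability -/

/-- The characteristic string of `A` below `k`. -/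
noncomputable def res (A : Set ℕ) (k : ℕ) : List Bool :=
  open Classical in (List.range k).map fun i => decide (i ∈ A)

@[simp] theorem res_length (A : Set ℕ) (k : ℕ) : (res A k).length = k := by simp [res]

theorem res_take (A : Set ℕ) (k j : ℕ) : (res A k).take j = res A (min j k) := by
  simp [res, ← List.map_take, List.take_range]

theorem res_getElem? (A : Set ℕ) (k i : ℕ) (b : Bool) :
    (res A k)[i]? = some b ↔ i < k ∧ (b = true ↔ i ∈ A) := by
  classical
  by_cases h : i < k
  · by_cases hA : i ∈ A <;> cases b <;> simp [res, h, hA]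
  · simp [res, h]

theorem res_getElem?_eq {A : Set ℕ} {k i : ℕ} (h : i < k) :
    (res A k)[i]? = some (open Classical in decide (i ∈ A)) := by
  simp [res, h]

theorem res_congr {A B : Set ℕ} {k : ℕ} (h : ∀ i < k, i ∈ A ↔ i ∈ B) : res A k = res B k := by
  simp only [res]
  refine List.map_congr_left fun i hi => ?_
  simp [h i (List.mem_range.1 hi)]

theorem eq_res_of_getElem? {A : Set ℕ} {s : List Bool}
    (h : ∀ i b, s[i]? = some b → (b = true ↔ i ∈ A)) : s = res A s.length := by
  refine List.ext_getElem? fun i => ?_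
  rcases hs : s[i]? with _ | b
  · rw [eq_comm, List.getElem?_eq_none_iff, res_length]
    exact List.getElem?_eq_none_iff.1 hs
  · rw [eq_comm, res_getElem?]
    exact ⟨(List.getElem?_eq_some_iff.1 hs).1, h i b hs⟩

variable {α β γ : Type*} [Primcodable α] [Primcodable β] [Primcodable γ]

/-- `p` is recursively enumerable in `W`. -/
def RE (W : Set ℕ) (p : α → Prop) : Prop :=
  ∃ R : α → List Bool → Prop, PrimrecRel R ∧ ∀ a, p a ↔ ∃ k, R a (res W k)

theorem primrecPred_exists_mem {p : α → β → Prop} {L : α → List β} (hp : PrimrecRel p)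
    (hL : Primrec L) : PrimrecPred fun a => ∃ b ∈ L a, p a b :=
  (PrimrecRel.exists_mem_list hp.swap).comp hL .id

theorem primrecPred_forall_mem {p : α → β → Prop} {L : α → List β} (hp : PrimrecRel p)
    (hL : Primrec L) : PrimrecPred fun a => ∀ b ∈ L a, p a b :=
  (PrimrecRel.forall_mem_list hp.swap).comp hL .id

theorem primrecPred_const (p : Prop) : PrimrecPred fun _ : α => p := by
  classical
  exact ⟨fun _ => Classical.dec _, Primrec.const (decide p)⟩

theorem RE.of_iff {W : Set ℕ} {p q : α → Prop} (hp : RE W p) (h : ∀ a, q a ↔ p a) : RE W q := by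
  obtain ⟨R, hR, h'⟩ := hp
  exact ⟨R, hR, fun a => (h a).trans (h' a)⟩

theorem RE.of_exists {W : Set ℕ} {p : α → Prop} {R : α → List Bool → Prop} (hR : PrimrecRel R)
    (h : ∀ a, p a ↔ ∃ k, R a (res W k)) : RE W p := ⟨R, hR, h⟩

/-- A normal form in which validity is preserved when the oracle string is lengthened. -/
theorem RE.exists_mono {W : Set ℕ} {p : α → Prop} (hp : RE W p) :
    ∃ R : α → List Bool → Prop, PrimrecRel R ∧ (∀ a, p a ↔ ∃ k, R a (res W k)) ∧
      ∀ a s t, s <+: t → R a s → R a t := by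
  obtain ⟨R, hR, h⟩ := hp
  refine ⟨fun a s => ∃ j ∈ List.range (s.length + 1), R a (s.take j), ?_, fun a => ?_, ?_⟩
  · refine primrecPred_exists_mem (p := fun (x : α × List Bool) j => R x.1 (x.2.take j)) ?_ ?_
    · exact hR.comp (fst.comp fst) (list_take.comp snd (snd.comp fst))
    · exact list_range.comp (succ.comp (list_length.comp snd))
  · rw [h]
    constructor
    · rintro ⟨k, hk⟩
      exact ⟨k, k, by simp, by simpa [res_take] using hk⟩
    · rintro ⟨k, j, -, hj⟩
      exact ⟨_, by simpa only [res_take] using hj⟩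
  · rintro a s t ⟨u, rfl⟩ ⟨j, hj, h⟩
    simp only [List.mem_range] at hj
    refine ⟨j, by simp; omega, ?_⟩
    rwa [List.take_append_of_le_length (by omega)]

theorem res_prefix (A : Set ℕ) {j k : ℕ} (h : j ≤ k) : res A j <+: res A k := by
  have := res_take A k j
  rw [min_eq_left h] at this
  rw [← this]
  exact List.take_prefix _ _

theorem RE.of_primrec {p : α → Prop} (hp : PrimrecPred p) (W : Set ℕ) : RE W p :=
  ⟨fun a _ => p a, hp.comp fst, fun a => by simp⟩

theorem RE.comp {W : Set ℕ} {p : β → Prop} {g : α → β} (hp : RE W p) (hg : Primrec g) :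
    RE W fun a => p (g a) := by
  obtain ⟨R, hR, h⟩ := hp
  exact ⟨fun a s => R (g a) s, hR.comp (hg.comp fst) snd, fun a => h _⟩

theorem RE.and {W : Set ℕ} {p q : α → Prop} (hp : RE W p) (hq : RE W q) :
    RE W fun a => p a ∧ q a := by
  obtain ⟨R, hR, h, hm⟩ := hp.exists_mono
  obtain ⟨S, hS, h', hm'⟩ := hq.exists_mono
  refine ⟨fun a s => R a s ∧ S a s, PrimrecPred.and hR hS, fun a => ?_⟩
  simp only [h, h']
  constructor
  · rintro ⟨⟨j, hj⟩, ⟨k, hk⟩⟩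
    exact ⟨max j k, hm _ _ _ (res_prefix _ (le_max_left _ _)) hj,
      hm' _ _ _ (res_prefix _ (le_max_right _ _)) hk⟩
  · rintro ⟨k, hj, hk⟩
    exact ⟨⟨k, hj⟩, ⟨k, hk⟩⟩

theorem RE.or {W : Set ℕ} {p q : α → Prop} (hp : RE W p) (hq : RE W q) :
    RE W fun a => p a ∨ q a := by
  obtain ⟨R, hR, h⟩ := hp
  obtain ⟨S, hS, h'⟩ := hq
  refine ⟨fun a s => R a s ∨ S a s, PrimrecPred.or hR hS, fun a => ?_⟩
  simp only [h, h', exists_or]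

theorem RE.const (W : Set ℕ) (p : Prop) : RE W fun _ : α => p :=
  RE.of_primrec (primrecPred_const p) W

/-- Enumerable relations are closed under projection. -/
theorem RE.ex {W : Set ℕ} {p : α → β → Prop} (hp : RE W fun x : α × β => p x.1 x.2) :
    RE W fun a => ∃ b, p a b := by
  obtain ⟨R, hR, h, hm⟩ := hp.exists_mono
  -- The length of the oracle string bounds both the oracle use and the code of the witness, so the
  -- search is primitive recursive.
  refine ⟨fun a s => ∃ b ∈ (List.range s.length).filterMap (decode (α := β)), R (a, b) s,
    ?_, fun a => ?_⟩
  · refine primrecPred_exists_mem (p := fun (x : α × List Bool) b => R (x.1, b) x.2) ?_ ?_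
    · exact hR.comp (Primrec.pair (fst.comp fst) snd) (snd.comp fst)
    · exact listFilterMap (list_range.comp (list_length.comp snd)) (Primrec.decode.comp snd)
  · constructor
    · rintro ⟨b, hb⟩
      obtain ⟨k, hk⟩ := (h (a, b)).1 hb
      refine ⟨max k (encode b + 1), b, ?_, hm _ _ _ (res_prefix _ (le_max_left _ _)) hk⟩
      simp only [List.mem_filterMap, List.mem_range, res_length]
      exact ⟨encode b, by omega, encodek b⟩
    · rintro ⟨k, b, -, hb⟩
      exact ⟨b, (h (a, b)).2 ⟨k, hb⟩⟩

/-- Finitely many oracle uses have a maximum, and in the monotone normal form all verifications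
survive at that length. -/
theorem RE.all_mem {W : Set ℕ} {p : α → β → Prop} {L : α → List β}
    (hp : RE W fun x : α × β => p x.1 x.2) (hL : Primrec L) :
    RE W fun a => ∀ b ∈ L a, p a b := by
  obtain ⟨R, hR, h, hm⟩ := hp.exists_mono
  refine ⟨fun a s => ∀ b ∈ L a, R (a, b) s, ?_, fun a => ?_⟩
  · refine primrecPred_forall_mem (p := fun (x : α × List Bool) b => R (x.1, b) x.2) ?_ ?_
    · exact hR.comp (Primrec.pair (fst.comp fst) snd) (snd.comp fst)
    · exact hL.comp fst
  · constructor
    · intro H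
      suffices ∀ l : List β, (∀ b ∈ l, p a b) → ∃ k, ∀ b ∈ l, R (a, b) (res W k) from this _ H
      intro l
      induction l with
      | nil => simp
      | cons b l ih =>
        intro H
        obtain ⟨j, hj⟩ := ih fun c hc => H c (List.mem_cons_of_mem _ hc)
        obtain ⟨k, hk⟩ := (h (a, b)).1 (H b List.mem_cons_self)
        refine ⟨max j k, fun c hc => ?_⟩
        rcases List.mem_cons.1 hc with rfl | hc
        · exact hm _ _ _ (res_prefix _ (le_max_right _ _)) hk
        · exact hm _ _ _ (res_prefix _ (le_max_left _ _)) (hj c hc)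
    · rintro ⟨k, hk⟩ b hb
      exact (h (a, b)).2 ⟨k, hk b hb⟩

theorem RE.all_lt {W : Set ℕ} {p : α → ℕ → Prop} {m : α → ℕ}
    (hp : RE W fun x : α × ℕ => p x.1 x.2) (hm : Primrec m) :
    RE W fun a => ∀ n < m a, p a n :=
  (hp.all_mem (list_range.comp hm)).of_iff fun a => by simp

theorem RE.ex_finset {W : Set ℕ} {ι : Type*} (S : Finset ι) {p : ι → α → Prop}
    (hp : ∀ i ∈ S, RE W (p i)) : RE W fun a => ∃ i ∈ S, p i a := by
  classical
  induction S using Finset.induction_on with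
  | empty => exact (RE.const W False).of_iff fun a => by simp
  | insert i S _ ih =>
    refine ((hp i (by simp)).or (ih fun j hj => hp j (by simp [hj]))).of_iff fun a => by simp

theorem RE.mem (W : Set ℕ) : RE W fun n => n ∈ W := by
  refine ⟨fun n s => s[n]? = some true, ?_, fun n => ?_⟩
  · exact Primrec.eq.comp (list_getElem?.comp snd fst) (Primrec.const (some true))
  · simp only [res_getElem?, true_iff]
    exact ⟨fun h => ⟨n + 1, by omega, h⟩, fun ⟨k, _, h⟩ => h⟩

theorem RE.not_mem (W : Set ℕ) : RE W fun n => n ∉ W := by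
  refine ⟨fun n s => s[n]? = some false, ?_, fun n => ?_⟩
  · exact Primrec.eq.comp (list_getElem?.comp snd fst) (Primrec.const (some false))
  · simp only [res_getElem?, Bool.false_eq_true, false_iff]
    exact ⟨fun h => ⟨n + 1, by omega, h⟩, fun ⟨k, _, h⟩ => h⟩

/-- `A` is computable in `W`: both `A` and its complement are enumerable in `W`. -/
def Red (A W : Set ℕ) : Prop := RE W (fun n => n ∈ A) ∧ RE W (fun n => n ∉ A)

theorem Red.refl (W : Set ℕ) : Red W W := ⟨RE.mem W, RE.not_mem W⟩

/-- `s` is an initial segment of the characteristic function of `A`. -/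
theorem Red.re_eq_res {A W : Set ℕ} (h : Red A W) :
    RE W fun s : List Bool => s = res A s.length := by
  have h1 : RE W fun x : List Bool × ℕ =>
      (x.1[x.2]? = some true ∧ x.2 ∈ A) ∨ (x.1[x.2]? = some false ∧ x.2 ∉ A) :=
    (RE.and (RE.of_primrec (Primrec.eq.comp (list_getElem?.comp fst snd) (.const _)) W)
      (h.1.comp snd)).or
    (RE.and (RE.of_primrec (Primrec.eq.comp (list_getElem?.comp fst snd) (.const _)) W)
      (h.2.comp snd))
  refine (h1.all_lt (p := fun (s : List Bool) i =>
    (s[i]? = some true ∧ i ∈ A) ∨ (s[i]? = some false ∧ i ∉ A)) list_length).of_iff fun s => ?_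
  constructor
  · intro hs i hi
    rw [hs, res_getElem?, res_getElem?]
    simp [hi]
    tauto
  · intro hs
    refine eq_res_of_getElem? fun i b hb => ?_
    have := hs i (List.getElem?_eq_some_iff.1 hb).1
    cases b <;> simp_all

/-- The finite part of `A` that is consulted is guessed as a string and verified from `W`;
verification uses both halves of `Red A W`. -/
theorem RE.trans {A W : Set ℕ} {p : α → Prop} (hp : RE A p) (h : Red A W) : RE W p := by
  obtain ⟨R, hR, hp⟩ := hp
  have h1 : RE W fun x : α × List Bool => R x.1 x.2 ∧ x.2 = res A x.2.length :=
    RE.and (RE.of_primrec hR W) (h.re_eq_res.comp snd)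
  refine (RE.ex (p := fun a s => R a s ∧ s = res A s.length) h1).of_iff fun a => ?_
  rw [hp]
  constructor
  · rintro ⟨k, hk⟩
    exact ⟨_, hk, by simp⟩
  · rintro ⟨s, hs, h⟩
    exact ⟨s.length, h ▸ hs⟩

theorem Red.trans {A B D : Set ℕ} (h : Red A B) (h' : Red B D) : Red A D :=
  ⟨h.1.trans h', h.2.trans h'⟩

theorem mem_join_even {A B : Set ℕ} {n : ℕ} : 2 * n ∈ join A B ↔ n ∈ A := by
  constructor
  · rintro (⟨m, hm, h⟩ | ⟨m, hm, h⟩)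
    · rwa [show n = m by omega]
    · omega
  · exact fun h => Or.inl ⟨n, h, rfl⟩

theorem mem_join_odd {A B : Set ℕ} {n : ℕ} : 2 * n + 1 ∈ join A B ↔ n ∈ B := by
  constructor
  · rintro (⟨m, hm, h⟩ | ⟨m, hm, h⟩)
    · omega
    · rwa [show n = m by omega]
  · exact fun h => Or.inr ⟨n, h, rfl⟩

theorem mem_join {A B : Set ℕ} {n : ℕ} :
    n ∈ join A B ↔ (n % 2 = 0 ∧ n / 2 ∈ A) ∨ (n % 2 = 1 ∧ n / 2 ∈ B) := by
  rcases Nat.even_or_odd' n with ⟨k, rfl | rfl⟩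
  · rw [mem_join_even]
    simp
  · rw [mem_join_odd, show (2 * k + 1) / 2 = k by omega]
    simp

theorem red_join_left (A B : Set ℕ) : Red A (join A B) :=
  ⟨((RE.mem _).comp nat_double).of_iff fun _ => mem_join_even.symm,
    ((RE.not_mem _).comp nat_double).of_iff fun _ => not_congr mem_join_even.symm⟩

theorem red_join_right (A B : Set ℕ) : Red B (join A B) :=
  ⟨((RE.mem _).comp nat_double_succ).of_iff fun _ => mem_join_odd.symm,
    ((RE.not_mem _).comp nat_double_succ).of_iff fun _ => not_congr mem_join_odd.symm⟩

theorem primrec_mod_two : Primrec fun n : ℕ => n % 2 := nat_mod.comp .id (.const 2)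

theorem primrec_half : Primrec fun n : ℕ => n / 2 := nat_div.comp .id (.const 2)

theorem Red.join {A B W : Set ℕ} (hA : Red A W) (hB : Red B W) :
    Red (TreeTheorem.join A B) W := by
  have h0 : PrimrecPred fun n : ℕ => n % 2 = 0 := Primrec.eq.comp primrec_mod_two (.const 0)
  have h1 : PrimrecPred fun n : ℕ => n % 2 = 1 := Primrec.eq.comp primrec_mod_two (.const 1)
  refine ⟨(((RE.of_primrec h0 W).and (hA.1.comp primrec_half)).or
    ((RE.of_primrec h1 W).and (hB.1.comp primrec_half))).of_iff fun n => mem_join, ?_⟩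
  refine (((RE.of_primrec h0 W).and (hA.2.comp primrec_half)).or
    ((RE.of_primrec h1 W).and (hB.2.comp primrec_half))).of_iff fun n => ?_
  rw [mem_join]
  have := Nat.mod_two_eq_zero_or_one n
  rcases this with h | h <;> simp [h]

/-- Separating the two parts of a join: enumeration in `A ⊕ B` is given by an enumeration operator
with oracle `A` that is enumerable in `B`. -/
theorem RE.exists_operator {A B : Set ℕ} {p : α → Prop} (hp : RE (TreeTheorem.join A B) p) :
    ∃ V : α × List Bool → Prop, RE B V ∧ ∀ a, p a ↔ ∃ k, V (a, res A k) := by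
  obtain ⟨R, hR, h⟩ := hp
  -- Correctness of bit `i` of a guessed oracle string `u` for the join: even bits are checked
  -- against the string `s` for `A`, odd bits against `B` itself.
  let q : List Bool → List Bool → ℕ → Prop := fun s u i =>
    (i % 2 = 0 ∧ u[i]? = s[i / 2]? ∧ i / 2 < s.length) ∨ (i % 2 = 1 ∧
      ((u[i]? = some true ∧ i / 2 ∈ B) ∨ (u[i]? = some false ∧ i / 2 ∉ B)))
  have hq : RE B fun x : (List Bool × List Bool) × ℕ => q x.1.1 x.1.2 x.2 := by
    have hu : Primrec fun x : (List Bool × List Bool) × ℕ => x.1.2[x.2]? :=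
      list_getElem?.comp (snd.comp fst) snd
    have hh : Primrec fun x : (List Bool × List Bool) × ℕ => x.2 / 2 := primrec_half.comp snd
    have hs : Primrec fun x : (List Bool × List Bool) × ℕ => x.1.1[x.2 / 2]? :=
      list_getElem?.comp (fst.comp fst) hh
    refine RE.or (RE.of_primrec (PrimrecPred.and (Primrec.eq.comp (primrec_mod_two.comp snd)
      (.const 0)) (PrimrecPred.and (Primrec.eq.comp hu hs)
        (nat_lt.comp hh (list_length.comp (fst.comp fst))))) B) ?_
    refine RE.and (RE.of_primrec (Primrec.eq.comp (primrec_mod_two.comp snd) (.const 1)) B) ?_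
    exact ((RE.of_primrec (Primrec.eq.comp hu (.const (some true))) B).and
      ((RE.mem B).comp hh)).or ((RE.of_primrec (Primrec.eq.comp hu (.const (some false))) B).and
      ((RE.not_mem B).comp hh))
  let V : α × List Bool → Prop := fun x =>
    ∃ u : List Bool, R x.1 u ∧ ∀ i < u.length, q x.2 u i
  refine ⟨V, ?_, fun a => ?_⟩
  · refine RE.ex (p := fun (x : α × List Bool) (u : List Bool) =>
      R x.1 u ∧ ∀ i < u.length, q x.2 u i) (RE.and ?_ ?_)
    · exact RE.of_primrec (hR.comp (fst.comp fst) snd) B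
    · refine RE.all_lt (p := fun (x : (α × List Bool) × List Bool) i => q x.1.2 x.2 i) ?_
        (list_length.comp snd)
      exact hq.comp (g := fun x : ((α × List Bool) × List Bool) × ℕ =>
        ((x.1.1.2, x.1.2), x.2))
        (Primrec.pair (Primrec.pair (snd.comp (fst.comp fst)) (snd.comp fst)) snd)
  · rw [h]
    constructor
    · rintro ⟨k, hk⟩
      refine ⟨k, _, hk, fun i hi => ?_⟩
      rw [res_length] at hi
      rcases Nat.mod_two_eq_zero_or_one i with hi2 | hi2
      · left
        refine ⟨hi2, ?_, by simp; omega⟩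
        rw [res_getElem?_eq hi, res_getElem?_eq (show i / 2 < k by omega)]
        congr 2
        simp [mem_join, hi2]
      · right
        refine ⟨hi2, ?_⟩
        simp only [res_getElem?, mem_join, hi2]
        simp [hi]
        tauto
    · rintro ⟨k, u, hu, hq⟩
      refine ⟨u.length, ?_⟩
      rwa [← eq_res_of_getElem? (A := TreeTheorem.join A B)]
      intro i b hb
      have hi := (List.getElem?_eq_some_iff.1 hb).1
      rw [mem_join]
      rcases hq i hi with ⟨h2, h3, h4⟩ | ⟨h2, h3⟩
      · rw [hb, eq_comm, res_getElem?] at h3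
        simp [h2, h3.2]
      · simp only [h2]
        cases b <;> simp_all

end TreeTheorem

namespace TreeTheorem

open Encodable Primrec

variable {α β γ : Type*} [Primcodable α] [Primcodable β] [Primcodable γ]

/-! ### Recursion and uniformization -/

/-- Relations defined by primitive recursion from enumerable relations are enumerable. -/
theorem RE.iterate {W : Set ℕ} {r : α → ℕ → β → Prop} {step : α → ℕ → β → β → Prop}
    (h0 : RE W fun x : α × β => r x.1 0 x.2)
    (hs : RE W fun x : ((α × ℕ) × β) × β => step x.1.1.1 x.1.1.2 x.1.2 x.2)
    (h : ∀ a n y, r a (n + 1) y ↔ ∃ u, r a n u ∧ step a n u y) :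
    RE W fun x : (α × ℕ) × β => r x.1.1 x.1.2 x.2 := by
  have h1 : RE W fun z : ((α × ℕ) × β) × List β =>
      ∃ v : β, z.2[0]? = some v ∧ r z.1.1.1 0 v :=
    RE.ex (p := fun (z : ((α × ℕ) × β) × List β) (v : β) => z.2[0]? = some v ∧ r z.1.1.1 0 v)
      ((RE.of_primrec (Primrec.eq.comp (list_getElem?.comp (snd.comp fst) (.const 0))
        (option_some.comp snd)) W).and
        (h0.comp (Primrec.pair (fst.comp (fst.comp (fst.comp fst))) snd)))
  have h2 : RE W fun z : ((α × ℕ) × β) × List β => ∀ i < z.1.1.2, ∃ w : β × β,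
      z.2[i]? = some w.1 ∧ z.2[i + 1]? = some w.2 ∧ step z.1.1.1 i w.1 w.2 := by
    refine RE.all_lt (p := fun (z : ((α × ℕ) × β) × List β) i => ∃ w : β × β,
      z.2[i]? = some w.1 ∧ z.2[i + 1]? = some w.2 ∧ step z.1.1.1 i w.1 w.2) ?_
      (snd.comp (fst.comp fst))
    refine RE.ex (p := fun (z : (((α × ℕ) × β) × List β) × ℕ) (w : β × β) =>
      z.1.2[z.2]? = some w.1 ∧ z.1.2[z.2 + 1]? = some w.2 ∧ step z.1.1.1.1 z.2 w.1 w.2) ?_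
    have hL : Primrec fun z : ((((α × ℕ) × β) × List β) × ℕ) × β × β => z.1.1.2 :=
      snd.comp (fst.comp fst)
    have hi : Primrec fun z : ((((α × ℕ) × β) × List β) × ℕ) × β × β => z.1.2 := snd.comp fst
    refine (RE.of_primrec (Primrec.eq.comp (list_getElem?.comp hL hi)
      (option_some.comp (fst.comp snd))) W).and ((RE.of_primrec (Primrec.eq.comp
        (list_getElem?.comp hL (succ.comp hi)) (option_some.comp (snd.comp snd))) W).and
      (hs.comp (Primrec.pair (Primrec.pair (Primrec.pair
        (fst.comp (fst.comp (fst.comp (fst.comp fst)))) hi) (fst.comp snd)) (snd.comp snd))))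
  have h3 : RE W fun z : ((α × ℕ) × β) × List β => z.2[z.1.1.2]? = some z.1.2 :=
    RE.of_primrec (Primrec.eq.comp (list_getElem?.comp snd (snd.comp (fst.comp fst)))
      (option_some.comp (snd.comp fst))) W
  -- A value of the recursion is certified by the list `L` of all intermediate values.
  refine (RE.ex (p := fun (x : (α × ℕ) × β) (L : List β) =>
    (∃ v : β, L[0]? = some v ∧ r x.1.1 0 v) ∧
    (∀ i < x.1.2, ∃ w : β × β, L[i]? = some w.1 ∧ L[i + 1]? = some w.2 ∧
        step x.1.1 i w.1 w.2) ∧ L[x.1.2]? = some x.2)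
    (h1.and (h2.and h3))).of_iff fun x => ?_
  obtain ⟨⟨a, n⟩, y⟩ := x
  simp only
  constructor
  · suffices ∀ n y, r a n y → ∃ L : List β, L.length = n + 1 ∧
        (∃ v : β, L[0]? = some v ∧ r a 0 v) ∧
        (∀ i < n, ∃ w : β × β, L[i]? = some w.1 ∧ L[i + 1]? = some w.2 ∧
        step a i w.1 w.2) ∧ L[n]? = some y by
      intro hx
      obtain ⟨L, -, hL⟩ := this _ _ hx
      exact ⟨L, hL⟩
    intro n
    induction n with
    | zero => exact fun y hy => ⟨[y], by simp, ⟨y, by simp, hy⟩, by simp, by simp⟩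
    | succ n ih =>
      intro y hy
      obtain ⟨u, hu, hy⟩ := (h _ _ _).1 hy
      obtain ⟨L, hlen, ⟨v, hv, hvf⟩, hstep, hlast⟩ := ih u hu
      refine ⟨L ++ [y], by simp [hlen], ⟨v, ?_, hvf⟩, fun i hi => ?_, ?_⟩
      · rw [List.getElem?_append_left (by omega), hv]
      · rcases Nat.lt_succ_iff_lt_or_eq.1 hi with hi | rfl
        · obtain ⟨w, hw1, hw2, hw⟩ := hstep i hi
          refine ⟨w, ?_, ?_, hw⟩
          · rwa [List.getElem?_append_left (by omega)]
          · rwa [List.getElem?_append_left (by omega)]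
        · refine ⟨(u, y), ?_, ?_, hy⟩
          · rwa [List.getElem?_append_left (by omega)]
          · simp [← hlen]
      · simp [← hlen]
  · rintro ⟨L, ⟨v, hv, hvf⟩, hstep, hlast⟩
    suffices ∀ j ≤ n, ∀ y, L[j]? = some y → r a j y from this _ le_rfl _ hlast
    intro j
    induction j with
    | zero =>
      intro _ y hy
      rw [hv] at hy
      exact Option.some.inj hy ▸ hvf
    | succ j ih =>
      intro hn y hy
      obtain ⟨w, hw1, hw2, hw⟩ := hstep j hn
      refine (h _ _ _).2 ⟨w.1, ih (by omega) _ hw1, ?_⟩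
      rw [hw2] at hy
      exact Option.some.inj hy ▸ hw

/-- Relations defined by recursion on lists from enumerable relations are enumerable. -/
theorem RE.listRec {W : Set ℕ} {r : List α → β → Prop} {step : α → β → β → Prop}
    (h0 : RE W fun y : β => r [] y) (hs : RE W fun x : (α × β) × β => step x.1.1 x.1.2 x.2)
    (h : ∀ a l y, r (a :: l) y ↔ ∃ u, r l u ∧ step a u y) :
    RE W fun x : List α × β => r x.1 x.2 := by
  -- The list is consumed from its last entry, in the order of the recursion; when the entries run
  -- out, the value stays put.
  have hs' : RE W fun x : ((List α × ℕ) × β) × β =>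
      ((∃ a, x.1.1.1.reverse[x.1.1.2]? = some a ∧ step a x.1.2 x.2) ∨
        (x.1.1.1.length ≤ x.1.1.2 ∧ x.2 = x.1.2)) := by
    refine RE.or (RE.ex (p := fun (x : ((List α × ℕ) × β) × β) a =>
      x.1.1.1.reverse[x.1.1.2]? = some a ∧ step a x.1.2 x.2) ?_) (RE.of_primrec (PrimrecPred.and
        (nat_le.comp (list_length.comp (fst.comp (fst.comp fst))) (snd.comp (fst.comp fst)))
          (Primrec.eq.comp snd (snd.comp fst))) W)
    exact (RE.of_primrec (Primrec.eq.comp (list_getElem?.comp (list_reverse.comp (fst.comp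
      (fst.comp (fst.comp fst)))) (snd.comp (fst.comp (fst.comp fst))))
      (option_some.comp snd)) W).and (hs.comp (Primrec.pair (Primrec.pair snd
        (snd.comp (fst.comp fst))) (snd.comp fst)))
  have := RE.iterate (W := W) (r := fun (l : List α) n y => r (l.reverse.take n).reverse y)
    (step := fun l n u y => ((∃ a, l.reverse[n]? = some a ∧ step a u y) ∨
        (l.length ≤ n ∧ y = u))) ((h0.comp snd).of_iff fun x => by simp) hs' ?_
  · exact (this.comp (g := fun x : List α × β => ((x.1, x.1.length), x.2))
      (Primrec.pair (Primrec.pair fst (list_length.comp fst)) snd)).of_iff fun x => by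
        simp [List.take_of_length_le]
  · intro l n y
    by_cases hn : n < l.length
    · have hn' : n < l.reverse.length := by simpa using hn
      rw [List.take_succ_eq_append_getElem hn', List.reverse_append, List.reverse_singleton,
        List.singleton_append, h, List.getElem?_eq_getElem hn']
      simp [not_le.2 hn]
    · have h1 : ∀ m, l.length ≤ m → l.reverse.take m = l.reverse := fun m hm =>
        List.take_of_length_le (by simpa using hm)
      rw [h1 _ (by omega), h1 _ (by omega), List.getElem?_eq_none (by simp; omega)]
      simp [not_lt.1 hn]

/-- Enumerable relations have enumerable uniformizations. -/
theorem RE.uniformize {W : Set ℕ} {R : α → β → Prop} (hR : RE W fun x : α × β => R x.1 x.2) :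
    ∃ G : α → β → Prop, (RE W fun x : α × β => G x.1 x.2) ∧ (∀ a b, G a b → R a b) ∧
      (∀ a b c, G a b → G a c → b = c) ∧ ∀ a, (∃ b, R a b) → ∃ b, G a b := by
  classical
  obtain ⟨S, hS, h⟩ := hR
  -- The length of `s` codes a pair: a candidate `b` and the number of oracle bits allowed for its
  -- verification. The second component never exceeds the length, so `s` is long enough. `G` takes
  -- the candidate of the least successful pair.
  let N : α → List Bool → Prop := fun a s =>
    ∃ b ∈ (decode (α := β) s.length.unpair.1).toList, S (a, b) (s.take s.length.unpair.2)
  have hlen : Primrec fun x : α × List Bool => x.2.length.unpair := unpair.comp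
    (list_length.comp snd)
  have hN : PrimrecRel N := by
    refine primrecPred_exists_mem (p := fun (x : α × List Bool) b =>
      S (x.1, b) (x.2.take x.2.length.unpair.2)) ?_ ?_
    · exact hS.comp (Primrec.pair (fst.comp fst) snd) (list_take.comp
        (snd.comp (hlen.comp fst)) (snd.comp fst))
    · exact optionToList.comp (Primrec.decode.comp (fst.comp hlen))
  have hNres : ∀ a j, N a (res W j) ↔ ∃ b, decode (α := β) j.unpair.1 = some b ∧
      S (a, b) (res W j.unpair.2) := by
    intro a j
    simp [N, res_take, min_eq_left (Nat.unpair_right_le j)]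
  refine ⟨fun a b => ∃ j, decode (α := β) j.unpair.1 = some b ∧ N a (res W j) ∧
    ∀ m < j, ¬ N a (res W m), ?_, ?_, ?_, ?_⟩
  · refine RE.of_exists (R := fun (x : α × β) s => decode (α := β) s.length.unpair.1 = some x.2 ∧
      N x.1 s ∧ ∀ m ∈ List.range s.length, ¬ N x.1 (s.take m)) ?_ fun x => ?_
    · refine PrimrecPred.and (Primrec.eq.comp (Primrec.decode.comp (fst.comp (unpair.comp
        (list_length.comp snd)))) (option_some.comp (snd.comp fst))) (PrimrecPred.and
        (hN.comp (fst.comp fst) snd) ?_)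
      refine primrecPred_forall_mem (p := fun (x : (α × β) × List Bool) m =>
        ¬ N x.1.1 (x.2.take m)) ?_ (list_range.comp (list_length.comp snd))
      exact PrimrecPred.not (hN.comp (fst.comp (fst.comp fst))
        (list_take.comp snd (snd.comp fst)))
    · refine exists_congr fun j => ?_
      simp only [res_length, List.mem_range, res_take]
      refine and_congr_right fun _ => and_congr_right fun _ => forall₂_congr fun m hm => ?_
      rw [min_eq_left hm.le]
  · rintro a b ⟨j, hj, hN, -⟩
    obtain ⟨c, hc, hSc⟩ := (hNres a j).1 hN
    rw [hj] at hc
    exact (h (a, b)).2 ⟨_, (Option.some.inj hc) ▸ hSc⟩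
  · rintro a b c ⟨j, hj, hN, hmin⟩ ⟨k, hk, hN', hmin'⟩
    have : j = k := by
      rcases lt_trichotomy j k with h | h | h
      · exact absurd hN (hmin' _ h)
      · exact h
      · exact absurd hN' (hmin _ h)
    subst this
    rw [hj] at hk
    exact Option.some.inj hk
  · rintro a ⟨b, hb⟩
    obtain ⟨k, hk⟩ := (h (a, b)).1 hb
    have hex : ∃ j, N a (res W j) :=
      ⟨Nat.pair (encode b) k, (hNres _ _).2 ⟨b, by simp, by simpa using hk⟩⟩
    obtain ⟨c, hc, -⟩ := (hNres _ _).1 (Nat.find_spec hex)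
    exact ⟨c, _, hc, Nat.find_spec hex, fun m hm => Nat.find_min hex hm⟩

/-! ### Relative enumerability and Turing reducibility -/

/-- Induction on the generation of the partial recursive functions. Primitive recursion is
`RE.iterate`; minimization is a bounded universal quantifier over the statements that earlier values
exist and are nonzero. -/
theorem re_graph_of_recursiveIn {W : Set ℕ} {g : ℕ →. ℕ} (hg : Nat.RecursiveIn {charFun W} g) :
    RE W fun x : ℕ × ℕ => x.2 ∈ g x.1 := by
  induction hg with
  | zero =>
    exact (RE.of_primrec (Primrec.eq.comp snd (.const 0)) W).of_iff fun x => Part.mem_some_iff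
  | succ =>
    exact (RE.of_primrec (Primrec.eq.comp snd (succ.comp fst)) W).of_iff fun x =>
      Part.mem_some_iff
  | left =>
    exact (RE.of_primrec (Primrec.eq.comp snd (fst.comp (unpair.comp fst))) W).of_iff fun x =>
      Part.mem_some_iff
  | right =>
    exact (RE.of_primrec (Primrec.eq.comp snd (snd.comp (unpair.comp fst))) W).of_iff fun x =>
      Part.mem_some_iff
  | oracle g hg =>
    rw [Set.mem_singleton_iff.1 hg]
    refine ((((RE.mem W).comp fst).and (RE.of_primrec (Primrec.eq.comp snd (.const 1)) W)).or
      (((RE.not_mem W).comp fst).and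
        (RE.of_primrec (Primrec.eq.comp snd (.const 0)) W))).of_iff fun x => ?_
    simp only [charFun, Part.mem_some_iff]
    split_ifs with h <;> simp [h]
  | @pair f h _ _ ihf ihh =>
    refine (RE.ex (p := fun (x : ℕ × ℕ) (y : ℕ × ℕ) =>
        y.1 ∈ f x.1 ∧ y.2 ∈ h x.1 ∧ x.2 = Nat.pair y.1 y.2)
      ((ihf.comp (Primrec.pair (fst.comp fst) (fst.comp snd))).and
        ((ihh.comp (Primrec.pair (fst.comp fst) (snd.comp snd))).and
          (RE.of_primrec (Primrec.eq.comp (snd.comp fst)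
            (Primrec₂.natPair.comp (fst.comp snd) (snd.comp snd))) W)))).of_iff fun x => ?_
    simp [Seq.seq]
    tauto
  | @comp f h _ _ ihf ihh =>
    refine (RE.ex (p := fun (x : ℕ × ℕ) (y : ℕ) => y ∈ h x.1 ∧ x.2 ∈ f y)
      ((ihh.comp (Primrec.pair (fst.comp fst) snd)).and
        (ihf.comp (Primrec.pair snd (snd.comp fst))))).of_iff fun x => ?_
    exact Part.mem_bind_iff
  | @prec f h _ _ ihf ihh =>
    have := RE.iterate (W := W)
      (r := fun (a n : ℕ) (y : ℕ) => y ∈ (Nat.rec (f a) (fun y IH => IH.bind fun i =>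
        h (Nat.pair a (Nat.pair y i))) n : Part ℕ))
      (step := fun a n u y => y ∈ h (Nat.pair a (Nat.pair n u))) ihf
      (ihh.comp (Primrec.pair (Primrec₂.natPair.comp (fst.comp (fst.comp fst))
        (Primrec₂.natPair.comp (snd.comp (fst.comp fst)) (snd.comp fst))) snd))
      fun a n y => Part.mem_bind_iff
    exact this.comp (Primrec.pair (unpair.comp fst) snd)
  | @rfind f _ ih =>
    have h0 : RE W fun x : ℕ × ℕ => 0 ∈ f (Nat.pair x.1 x.2) :=
      ih.comp (Primrec.pair Primrec₂.natPair (.const 0))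
    have h1 : RE W fun x : (ℕ × ℕ) × ℕ => ∃ m : ℕ, m ∈ f (Nat.pair x.1.1 x.2) ∧ m ≠ 0 :=
      RE.ex (p := fun (x : (ℕ × ℕ) × ℕ) (m : ℕ) => m ∈ f (Nat.pair x.1.1 x.2) ∧ m ≠ 0)
        ((ih.comp (Primrec.pair (Primrec₂.natPair.comp (fst.comp (fst.comp fst))
          (snd.comp fst)) snd)).and
          (RE.of_primrec (PrimrecPred.not (Primrec.eq.comp snd (.const 0))) W))
    refine (h0.and (RE.all_lt (p := fun (x : ℕ × ℕ) i => ∃ m : ℕ, m ∈ f (Nat.pair x.1 i) ∧ m ≠ 0)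
      h1 snd)).of_iff fun x => ?_
    refine Nat.mem_rfind.trans ?_
    simp

/-- This graph form fixes the input type `ℕ × Bool` of the operators in the forcing arguments. -/
theorem RE.red_iff {A W : Set ℕ} : Red A W ↔ RE W fun x : ℕ × Bool => x.2 = true ↔ x.1 ∈ A := by
  constructor
  · intro h
    refine (((h.1.comp fst).and (RE.of_primrec (Primrec.eq.comp snd (.const true)) W)).or
      ((h.2.comp fst).and (RE.of_primrec (Primrec.eq.comp snd (.const false)) W))).of_iff
      fun x => ?_
    cases x.2 <;> simp
  · intro h
    exact ⟨(h.comp (Primrec.pair .id (.const true))).of_iff fun n => by simp,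
      (h.comp (Primrec.pair .id (.const false))).of_iff fun n => by simp⟩

theorem SetReducible.red {A W : Set ℕ} (h : SetReducible A W) : Red A W := by
  have := re_graph_of_recursiveIn h
  classical
  refine RE.red_iff.2 ((this.comp (g := fun x : ℕ × Bool => (x.1, cond x.2 1 0))
    (Primrec.pair fst ((dom_bool fun b => cond b 1 0).comp snd))).of_iff fun x => ?_)
  simp only [charFun]
  rcases x with ⟨n, _ | _⟩ <;> by_cases hn : n ∈ A <;> simp [hn]

/-- Search through the initial segments of the oracle until one witnesses membership or
nonmembership; the search ends because one of the two enumerations must succeed. -/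
theorem Red.setReducible {A W : Set ℕ} (h : Red A W) : SetReducible A W := by
  classical
  obtain ⟨R, ⟨dR, hR⟩, h1⟩ := h.1
  obtain ⟨S, ⟨dS, hS⟩, h0⟩ := h.2
  -- the initial segments of the oracle, computed by primitive recursion
  let r : ℕ → ℕ := fun k => encode (res W k)
  let app : ℕ → ℕ := fun x => encode (((decode x.unpair.1 : Option (List Bool)).getD []) ++
    [decide (x.unpair.2 = 1)])
  have happ : Nat.Primrec app := by
    refine Primrec.nat_iff.1 (Primrec.encode.comp (list_concat.comp (option_getD.comp
      (Primrec.decode.comp (fst.comp unpair)) (.const [])) ?_))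
    exact PrimrecPred.decide (Primrec.eq.comp (snd.comp unpair) (.const 1))
  have hr : Nat.RecursiveIn {charFun W} fun x => Part.some (r x.unpair.2) := by
    have h1 := Nat.RecursiveIn.prec (Nat.Primrec.recursiveIn (O := {charFun W})
      (Nat.Primrec.const (encode ([] : List Bool))))
      (Nat.RecursiveIn.comp (Nat.Primrec.recursiveIn happ) (Nat.RecursiveIn.pair
        (Nat.Primrec.recursiveIn (O := {charFun W})
          (Nat.Primrec.right.comp Nat.Primrec.right))
        (Nat.RecursiveIn.comp (.oracle (charFun W) rfl) (Nat.Primrec.recursiveIn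
          (Nat.Primrec.left.comp Nat.Primrec.right)))))
    refine h1.of_eq fun x => ?_
    simp only
    induction x.unpair.2 with
    | zero => rfl
    | succ n ih =>
      simp only [ih, r]
      have hc : ((Part.some n : Part ℕ) >>= charFun W) = Part.some (if n ∈ W then 1 else 0) :=
        Part.bind_some _ _
      simp [hc, app, Seq.seq, res, List.range_succ]
  -- `t` vanishes when the string settles the question either way, and `o` reads off the answer. The
  -- values at numbers that code no string are never used.
  let t : ℕ → ℕ := fun x => match (decode x.unpair.2 : Option (List Bool)) with
    | none => 1
    | some s => if R x.unpair.1 s ∨ S x.unpair.1 s then 0 else 1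
  let o : ℕ → ℕ := fun x => match (decode x.unpair.2 : Option (List Bool)) with
    | none => 1
    | some s => if R x.unpair.1 s then 1 else 0
  have ht : Nat.Primrec t := by
    refine Primrec.nat_iff.1 ((option_casesOn (f := fun _ => 1)
      (g := fun x s => if R x.unpair.1 s ∨ S x.unpair.1 s then 0 else 1)
      (Primrec.decode.comp (snd.comp unpair)) (.const 1) ?_).of_eq fun x => ?_)
    · refine Primrec.ite (PrimrecPred.or ?_ ?_) (.const 0) (.const 1)
      · exact PrimrecRel.comp (R := R) ⟨_, hR⟩ (fst.comp (unpair.comp fst)) snd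
      · exact PrimrecRel.comp (R := S) ⟨_, hS⟩ (fst.comp (unpair.comp fst)) snd
    · simp only [t]; cases (decode x.unpair.2 : Option (List Bool)) <;> rfl
  have ho : Nat.Primrec o := by
    refine Primrec.nat_iff.1 ((option_casesOn (f := fun _ => 1)
      (g := fun x s => if R x.unpair.1 s then 1 else 0)
      (Primrec.decode.comp (snd.comp unpair)) (.const 1) ?_).of_eq fun x => ?_)
    · refine Primrec.ite ?_ (.const 1) (.const 0)
      exact PrimrecRel.comp (R := R) ⟨_, hR⟩ (fst.comp (unpair.comp fst)) snd
    · simp only [o]; cases (decode x.unpair.2 : Option (List Bool)) <;> rfl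
  have hpr : Nat.RecursiveIn {charFun W} fun x =>
      Part.some (Nat.pair x.unpair.1 (r x.unpair.2)) :=
    (Nat.RecursiveIn.pair .left hr).of_eq fun x => by simp [Seq.seq]
  have hsearch := Nat.RecursiveIn.comp hpr (Nat.RecursiveIn.pair
    (Nat.Primrec.recursiveIn (O := {charFun W}) Nat.Primrec.id)
    (Nat.RecursiveIn.rfind (Nat.RecursiveIn.comp (Nat.Primrec.recursiveIn ht) hpr)))
  have hfin := Nat.RecursiveIn.comp (Nat.Primrec.recursiveIn ho) hsearch
  refine hfin.of_eq fun n => ?_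
  have hex : ∃ k, R n (res W k) ∨ S n (res W k) := by
    by_cases hn : n ∈ A
    · obtain ⟨k, hk⟩ := (h1 n).1 hn
      exact ⟨k, Or.inl hk⟩
    · obtain ⟨k, hk⟩ := (h0 n).1 hn
      exact ⟨k, Or.inr hk⟩
  have hfind : Nat.find hex ∈ Nat.rfind fun k =>
      (fun m => decide (m = 0)) <$> Part.some (t (Nat.pair n (r k))) := by
    refine Nat.mem_rfind.2 ⟨?_, fun {m} hm => ?_⟩
    · simp [t, r, Nat.find_spec hex]
    · have := Nat.find_min hex hm
      simp [t, r, this]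
  have hval : (if R n (res W (Nat.find hex)) then 1 else 0) = if n ∈ A then 1 else 0 := by
    rcases Nat.find_spec hex with h | h
    · rw [if_pos h, if_pos ((h1 n).2 ⟨_, h⟩)]
    · have hn := (h0 n).2 ⟨_, h⟩
      rw [if_neg hn, if_neg fun h' => hn ((h1 n).2 ⟨_, h'⟩)]
  have hfind' := Part.eq_some_iff.2 hfind
  simp only [charFun]
  simp [Seq.seq] at hfind' ⊢
  rw [hfind']
  simp [o, r]
  convert hval

theorem setReducible_iff_red {A W : Set ℕ} : SetReducible A W ↔ Red A W :=
  ⟨SetReducible.red, Red.setReducible⟩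

/-- A code of the primitive recursive relation `R` determines the enumerable relation, and there are
countably many codes. -/
theorem countable_re (W : Set ℕ) : {p : α → Prop | RE W p}.Countable := by
  refine (Set.countable_range fun c : Nat.Partrec.Code => fun a : α =>
    ∃ k, encode true ∈ c.eval (encode (a, res W k))).mono ?_
  rintro p ⟨R, ⟨dR, hR⟩, h⟩
  obtain ⟨c, hc⟩ := Nat.Partrec.Code.exists_code.1 hR.to_comp.partrec
  refine ⟨c, funext fun a => propext ?_⟩
  simp only [hc, h]
  refine exists_congr fun k => ?_
  by_cases hk : R a (res W k) <;> simp [hk]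

/-- An enumeration of the relations that are enumerable in `W`. -/
theorem exists_enum (α : Type*) [Primcodable α] (W : Set ℕ) :
    ∃ e : ℕ → α → Prop, (∀ n, RE W (e n)) ∧ ∀ p, RE W p → ∃ n, e n = p := by
  obtain ⟨e, he⟩ := (countable_re (α := α) W).exists_eq_range ⟨_, RE.const W True⟩
  refine ⟨e, fun n => ?_, fun p hp => ?_⟩
  · have : e n ∈ {p : α → Prop | RE W p} := he ▸ Set.mem_range_self n
    exact this
  · have : p ∈ Set.range e := he ▸ hp
    exact this

/-! ### Cone avoidance for closed sets -/

/-- The open set given by the strings in `U` is all of Cantor space. -/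
def Covers (U : List Bool → Prop) : Prop := ∀ P : Set ℕ, ∃ k, U (res P k)

/-- Compactness of Cantor space. An increasing family is allowed so that the bound serves both a
single open set (constant family) and the limit of a construction. -/
theorem Covers.exists_bound {U : ℕ → List Bool → Prop} (hU : Monotone U)
    (h : Covers fun s => ∃ m, U m s) : ∃ K, ∀ P : Set ℕ, ∃ j ≤ K, U K (res P j) := by
  classical
  let S : ℕ → Set (ℕ → Bool) := fun K => {x | ∃ j ≤ K, U K (res {i | x i = true} j)}
  have hopen : ∀ K, IsOpen (S K) := by
    intro K
    have : S K = ⋃ j ≤ K, (fun x : ℕ → Bool => fun i : Fin j => x i) ⁻¹'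
        {y | U K (List.ofFn y)} := by
      ext x
      simp only [S, Set.mem_ofPred_eq, Set.mem_iUnion, Set.mem_preimage, exists_prop]
      refine exists_congr fun j => and_congr_right fun _ => ?_
      rw [show res {i | x i = true} j = List.ofFn fun i : Fin j => x i from
        List.ext_getElem (by simp) fun i h1 h2 => by simp [res]]
    rw [this]
    exact isOpen_biUnion fun j _ => (isOpen_discrete _).preimage (by fun_prop)
  have hmono : Monotone S := fun K K' hK x ⟨j, hj, hx⟩ => ⟨j, hj.trans hK, hU hK _ hx⟩
  obtain ⟨K, hK⟩ := isCompact_univ.elim_directed_cover S hopen (fun x _ => by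
    obtain ⟨k, m, hk⟩ := h {i | x i = true}
    exact Set.mem_iUnion.2 ⟨max k m, k, le_max_left _ _, hU (le_max_right _ _) _ hk⟩)
    hmono.directed_le
  refine ⟨K, fun P => ?_⟩
  obtain ⟨j, hj, hP⟩ := hK (Set.mem_univ fun i => decide (i ∈ P))
  exact ⟨j, hj, by simpa using hP⟩

/-- The string of the last `k` binary digits of `m`, least significant digit first. -/
def bits (k m : ℕ) : List Bool := (List.range k).map fun i => decide (m / 2 ^ i % 2 = 1)

theorem primrec_two_pow : Primrec fun n : ℕ => 2 ^ n := by
  refine (nat_rec₁ (f := fun _ x => 2 * x) 1 (nat_double.comp snd)).of_eq fun n => ?_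
  induction n with
  | zero => rfl
  | succ n ih => simp only [ih, pow_succ]; ring

theorem primrec_bits : Primrec₂ bits := by
  refine list_map (list_range.comp fst) (PrimrecPred.decide (Primrec.eq.comp ?_ (.const 1)))
  exact primrec_mod_two.comp (nat_div.comp (snd.comp fst) (primrec_two_pow.comp snd))

theorem exists_bits (P : Set ℕ) (k : ℕ) : ∃ m < 2 ^ k, bits k m = res P k := by
  classical
  induction k with
  | zero => exact ⟨0, by simp, rfl⟩
  | succ k ih =>
    obtain ⟨m, hm, h⟩ := ih
    have key : ∀ b < 2, ∀ i < k, (m + b * 2 ^ k) / 2 ^ i % 2 = m / 2 ^ i % 2 := by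
      intro b _ i hi
      obtain ⟨j, rfl⟩ := Nat.exists_eq_add_of_lt hi
      rw [show b * 2 ^ (i + j + 1) = (2 * (b * 2 ^ j)) * 2 ^ i by ring,
        Nat.add_mul_div_right _ _ (by positivity)]
      omega
    have key2 : ∀ b, (m + b * 2 ^ k) / 2 ^ k = b := by
      intro b
      rw [Nat.add_mul_div_right _ _ (by positivity), Nat.div_eq_of_lt hm, zero_add]
    refine ⟨m + (if k ∈ P then 1 else 0) * 2 ^ k, ?_, ?_⟩
    · rw [pow_succ]; split_ifs <;> omega
    · simp only [bits, res, List.range_succ, List.map_append, List.map_cons, List.map_nil] at h ⊢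
      rw [key2]
      congr 1
      · rw [← h]
        refine List.map_congr_left fun i hi => ?_
        rw [key _ (by split_ifs <;> omega) i (List.mem_range.1 hi)]
      · split_ifs with hk <;> simp [hk]

theorem bits_eq_res (k m : ℕ) : ∃ P : Set ℕ, bits k m = res P k :=
  ⟨{i | m / 2 ^ i % 2 = 1}, by simp [bits, res]⟩

/-- By compactness a cover is complete at some finite level `K`, which is checked on the finitely
many strings `bits K m`. Hence covering is a Σ₁ property. -/
theorem RE.covers {W : Set ℕ} {U : α → List Bool → Prop}
    (hU : RE W fun x : α × List Bool => U x.1 x.2) : RE W fun a => Covers (U a) := by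
  have h1 : RE W fun x : ((α × ℕ) × ℕ) × ℕ =>
      x.2 ≤ x.1.1.2 ∧ U x.1.1.1 ((bits x.1.1.2 x.1.2).take x.2) :=
    (RE.of_primrec (nat_le.comp snd (snd.comp (fst.comp fst))) W).and
      (hU.comp (Primrec.pair (fst.comp (fst.comp fst)) (list_take.comp snd
        (primrec_bits.comp (snd.comp (fst.comp fst)) (snd.comp fst)))))
  have h2 : RE W fun x : (α × ℕ) × ℕ => ∃ j, j ≤ x.1.2 ∧ U x.1.1 ((bits x.1.2 x.2).take j) :=
    RE.ex (p := fun (x : (α × ℕ) × ℕ) j => j ≤ x.1.2 ∧ U x.1.1 ((bits x.1.2 x.2).take j)) h1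
  refine (RE.ex (p := fun a K => ∀ m < 2 ^ K, ∃ j, j ≤ K ∧ U a ((bits K m).take j))
    (RE.all_lt (p := fun (x : α × ℕ) m => ∃ j, j ≤ x.2 ∧ U x.1 ((bits x.2 m).take j)) h2
      (primrec_two_pow.comp snd))).of_iff fun a => ?_
  constructor
  · intro h
    obtain ⟨K, hK⟩ := Covers.exists_bound (U := fun _ => U a) monotone_const
      (fun P => by simpa using h P)
    refine ⟨K, fun m _ => ?_⟩
    obtain ⟨P, hP⟩ := bits_eq_res K m
    obtain ⟨j, hj, h⟩ := hK P
    refine ⟨j, hj, ?_⟩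
    rwa [hP, res_take, min_eq_left hj]
  · rintro ⟨K, hK⟩ P
    obtain ⟨m, hm, hP⟩ := exists_bits P K
    obtain ⟨j, hj, h⟩ := hK m hm
    rw [hP, res_take, min_eq_left hj] at h
    exact ⟨j, h⟩

/-- A consistent pair of Σ₁ questions that always has the right answer computes the set. -/
theorem red_of_re_value {W C : Set ℕ} {Q : ℕ × Bool → Prop} (hQ : RE W Q)
    (h : ∀ n b, Q (n, b) ↔ (b = true ↔ n ∈ C)) : Red C W :=
  RE.red_iff.2 (hQ.of_iff fun x => (h x.1 x.2).symm)

/-- The question whether every path outside `U` admits a `V`-computation of value `b` at `n` is Σ₁,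
so it disagrees with `C` somewhere. If it holds for a wrong `b`, then `U` itself already spoils `V`;
if it fails for the right `b`, enlarging `U` by the computations of that value forces their absence.
-/
theorem exists_extension_avoiding {W C : Set ℕ} (hC : ¬ Red C W) {U : List Bool → Prop}
    (hU : RE W U) (hcov : ¬ Covers U) {V : (ℕ × Bool) × List Bool → Prop} (hV : RE W V) :
    ∃ U' : List Bool → Prop, RE W U' ∧ ¬ Covers U' ∧ (∀ s, U s → U' s) ∧
      ∀ P : Set ℕ, (∀ k, ¬ U' (res P k)) →
        ¬ ∀ n b, (∃ k, V ((n, b), res P k)) ↔ (b = true ↔ n ∈ C) := by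
  classical
  have hUV : RE W fun y : (ℕ × Bool) × List Bool => U y.2 ∨ V y := (hU.comp snd).or hV
  have hQ : RE W fun x : ℕ × Bool => Covers fun s => U s ∨ V (x, s) :=
    RE.covers (U := fun (x : ℕ × Bool) s => U s ∨ V (x, s)) hUV
  by_contra hcon
  push Not at hcon
  refine hC (red_of_re_value hQ fun n b => ?_)
  constructor
  · intro h
    by_contra hb
    obtain ⟨P, hP, hPV⟩ := hcon U hU hcov fun s hs => hs
    obtain ⟨k, hk⟩ := h P
    exact hb ((hPV n b).1 ⟨k, hk.resolve_left (hP k)⟩)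
  · intro hb
    by_contra h
    obtain ⟨P, hP, hPV⟩ := hcon (fun s => U s ∨ V ((n, b), s))
      (hUV.comp (Primrec.pair (.const _) .id)) h fun s hs => Or.inl hs
    obtain ⟨k, hk⟩ := (hPV n b).2 hb
    exact hP k (Or.inr hk)

/-- The cone avoidance basis theorem for Π⁰₁ classes: treat all operators one after another; by
compactness the union of the increasing open sets still leaves a path. -/
theorem exists_path_avoiding {W C : Set ℕ} (hC : ¬ Red C W) {U : List Bool → Prop}
    (hU : RE W U) (hcov : ¬ Covers U) :
    ∃ P : Set ℕ, (∀ k, ¬ U (res P k)) ∧ ¬ Red C (join P W) := by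
  obtain ⟨e, he, hsurj⟩ := exists_enum ((ℕ × Bool) × List Bool) W
  choose! next h1 h2 h3 h4 using fun (U : List Bool → Prop) (h : RE W U ∧ ¬ Covers U) (n : ℕ) =>
    exists_extension_avoiding hC h.1 h.2 (he n)
  let u : ℕ → List Bool → Prop := fun m => Nat.rec U (fun n U => next U n) m
  have hu : ∀ m, RE W (u m) ∧ ¬ Covers (u m) := by
    intro m
    induction m with
    | zero => exact ⟨hU, hcov⟩
    | succ m ih => exact ⟨h1 _ ih _, h2 _ ih _⟩
  have hmono : Monotone u := monotone_nat_of_le_succ fun m => h3 _ (hu m) m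
  have : ¬ Covers fun s => ∃ m, u m s := by
    intro h
    obtain ⟨K, hK⟩ := Covers.exists_bound hmono h
    exact (hu K).2 fun P => let ⟨j, _, h⟩ := hK P; ⟨j, h⟩
  obtain ⟨P, hP⟩ := not_forall.1 this
  push Not at hP
  refine ⟨P, fun k => hP k 0, fun hred => ?_⟩
  obtain ⟨V, hV, h⟩ := (RE.red_iff.1 hred).exists_operator
  obtain ⟨n, rfl⟩ := hsurj V hV
  exact h4 _ (hu n) n P (fun k => hP k (n + 1)) fun m b => (h (m, b)).symm

end TreeTheorem

namespace TreeTheorem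

open Encodable Primrec

variable {α β γ : Type*} [Primcodable α] [Primcodable β] [Primcodable γ]

/-! ### Perfect sets of strings -/

/-- Neither string is an initial segment of the other. -/
def Incomp (σ τ : List Bool) : Prop := ¬ σ <+: τ ∧ ¬ τ <+: σ

theorem Incomp.symm {σ τ : List Bool} (h : Incomp σ τ) : Incomp τ σ := ⟨h.2, h.1⟩

theorem Incomp.mono {σ τ σ' τ' : List Bool} (h : Incomp σ τ) (hσ : σ <+: σ') (hτ : τ <+: τ') :
    Incomp σ' τ' := by
  constructor
  · intro h'
    rcases List.prefix_or_prefix_of_prefix (hσ.trans h') hτ with h1 | h1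
    exacts [h.1 h1, h.2 h1]
  · intro h'
    rcases List.prefix_or_prefix_of_prefix hσ (hτ.trans h') with h1 | h1
    exacts [h.1 h1, h.2 h1]

theorem StrictPrefix.length_lt {σ τ : List Bool} (h : StrictPrefix σ τ) :
    σ.length < τ.length :=
  lt_of_le_of_ne h.1.length_le fun h' => h.2 (h.1.eq_of_length h')

theorem primrecRel_prefix : PrimrecRel fun σ τ : List Bool => σ <+: τ :=
  PrimrecPred.of_eq (Primrec.eq.comp fst (list_take.comp (list_length.comp fst) snd)) fun _ =>
    List.prefix_iff_eq_take.symm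

theorem primrecRel_strictPrefix : PrimrecRel StrictPrefix :=
  PrimrecPred.and primrecRel_prefix (PrimrecPred.not (Primrec.eq.comp fst snd))

theorem primrecRel_incomp : PrimrecRel Incomp :=
  PrimrecPred.and (PrimrecPred.not primrecRel_prefix)
    (PrimrecPred.not (primrecRel_prefix.comp snd fst))

/-- Every element of `X` has two incomparable extensions in `X`. -/
def Perfect (X : Set (List Bool)) : Prop :=
  ∀ x ∈ X, ∃ y ∈ X, ∃ z ∈ X, x <+: y ∧ x <+: z ∧ Incomp y z

namespace Perfect

variable {X Y D : Set (List Bool)}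

theorem exists_strict (h : Perfect X) {x : List Bool} (hx : x ∈ X) :
    ∃ y ∈ X, x <+: y ∧ x.length < y.length := by
  obtain ⟨y, hy, z, hz, hxy, hxz, hyz⟩ := h x hx
  rcases hxy.length_le.lt_or_eq with h1 | h1
  · exact ⟨y, hy, hxy, h1⟩
  · rw [hxy.eq_of_length h1] at hxz
    exact absurd hxz hyz.1

theorem exists_long (h : Perfect X) {x : List Bool} (hx : x ∈ X) (L : ℕ) :
    ∃ y ∈ X, x <+: y ∧ L < y.length := by
  induction L with
  | zero =>
    obtain ⟨y, hy, hxy, hl⟩ := h.exists_strict hx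
    exact ⟨y, hy, hxy, by omega⟩
  | succ L ih =>
    obtain ⟨y, hy, hxy, hl⟩ := ih
    obtain ⟨z, hz, hyz, hl'⟩ := h.exists_strict hy
    exact ⟨z, hz, hxy.trans hyz, by omega⟩

/-- Two incomparable extensions remain incomparable when each is extended further into the dense
part. -/
theorem inter_dense (h : Perfect X) (hD : ∀ x ∈ X, x ∈ D → ∀ y ∈ X, x <+: y →
    ∃ z ∈ X, y <+: z ∧ z ∈ D) : Perfect (X ∩ D) := by
  rintro x ⟨hx, hxD⟩
  obtain ⟨y, hy, z, hz, hxy, hxz, hyz⟩ := h x hx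
  obtain ⟨y', hy', hyy', hyD⟩ := hD x hx hxD y hy hxy
  obtain ⟨z', hz', hzz', hzD⟩ := hD x hx hxD z hz hxz
  exact ⟨y', ⟨hy', hyD⟩, z', ⟨hz', hzD⟩, hxy.trans hyy', hxz.trans hzz', hyz.mono hyy' hzz'⟩

theorem inter_up (h : Perfect X) (hD : ∀ x ∈ X, x ∈ D → ∀ y ∈ X, x <+: y → y ∈ D) :
    Perfect (X ∩ D) :=
  h.inter_dense fun x hx hxD y hy hxy => ⟨y, hy, List.prefix_rfl, hD x hx hxD y hy hxy⟩

theorem iUnion {ι : Sort*} {X : ι → Set (List Bool)} (h : ∀ i, Perfect (X i)) :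
    Perfect (⋃ i, X i) := by
  intro x hx
  obtain ⟨i, hi⟩ := Set.mem_iUnion.1 hx
  obtain ⟨y, hy, z, hz, H⟩ := h i x hi
  exact ⟨y, Set.mem_iUnion.2 ⟨i, hy⟩, z, Set.mem_iUnion.2 ⟨i, hz⟩, H⟩

theorem biUnion {ι : Type*} {S : Set ι} {X : ι → Set (List Bool)} (h : ∀ i ∈ S, Perfect (X i)) :
    Perfect (⋃ i ∈ S, X i) :=
  iUnion fun i => iUnion fun hi => h i hi

theorem union (hX : Perfect X) (hY : Perfect Y) : Perfect (X ∪ Y) := by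
  rw [Set.union_eq_iUnion]
  exact iUnion fun b => by cases b <;> assumption

theorem cone (h : Perfect X) (σ : List Bool) : Perfect (X ∩ {τ | σ <+: τ}) :=
  h.inter_up fun _ _ hx _ _ hxy => List.IsPrefix.trans hx hxy

theorem long (h : Perfect X) (L : ℕ) : Perfect (X ∩ {τ | L < τ.length}) :=
  h.inter_up fun _ _ hx _ _ hxy => lt_of_lt_of_le hx hxy.length_le

end Perfect

/-- The coloring `f` has a graph enumerable in `W`. -/
def REColoring (W : Set ℕ) (f : List Bool → List Bool → Bool) : Prop :=
  RE W fun x : (List Bool × List Bool) × Bool => StrictPrefix x.1.1 x.1.2 ∧ f x.1.1 x.1.2 = x.2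

theorem RE.inter {W : Set ℕ} {X D : Set (List Bool)} (hX : RE W fun x => x ∈ X)
    (hD : RE W fun x => x ∈ D) : RE W fun x => x ∈ X ∩ D := hX.and hD

theorem RE.cone {W : Set ℕ} {X : Set (List Bool)} (hX : RE W fun x => x ∈ X) (σ : List Bool) :
    RE W fun x => x ∈ X ∩ {τ | σ <+: τ} :=
  hX.inter (RE.of_primrec (primrecRel_prefix.comp (.const σ) .id) W)

theorem RE.long {W : Set ℕ} {X : Set (List Bool)} (hX : RE W fun x => x ∈ X) (L : ℕ) :
    RE W fun x => x ∈ X ∩ {τ | L < τ.length} :=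
  hX.inter (RE.of_primrec (nat_lt.comp (.const L) list_length) W)

/-- Either the strings to which `s` has color true are dense in `X` and are kept, or some cone of
`X` contains none of them, so that there only false remains. -/
theorem exists_thin_one {W : Set ℕ} {f : List Bool → List Bool → Bool} (hf : REColoring W f)
    {X : Set (List Bool)} (hX : Perfect X) (hne : X.Nonempty) (hre : RE W fun x => x ∈ X)
    (s : List Bool) : ∃ Y ⊆ X, Perfect Y ∧ Y.Nonempty ∧ (RE W fun x => x ∈ Y) ∧
      ∃ c, ∀ τ ∈ Y, StrictPrefix s τ → f s τ = c := by
  by_cases h : ∀ x ∈ X, ∃ y ∈ X, x <+: y ∧ y ∈ {τ | StrictPrefix s τ ∧ f s τ = true}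
  · refine ⟨_, Set.inter_subset_left, hX.inter_dense fun x _ _ y hy _ => h y hy, ?_,
      hre.inter (hf.comp (g := fun τ => ((s, τ), true))
        (Primrec.pair (Primrec.pair (.const s) .id) (.const true))), true,
      fun τ hτ _ => hτ.2.2⟩
    obtain ⟨x, hx⟩ := hne
    obtain ⟨y, hy, -, hyD⟩ := h x hx
    exact ⟨y, hy, hyD⟩
  · push Not at h
    obtain ⟨x, hx, h⟩ := h
    refine ⟨X ∩ {τ | x <+: τ}, Set.inter_subset_left, hX.cone x, ⟨x, hx, List.prefix_rfl⟩,
      hre.cone x, false, fun τ hτ hs => ?_⟩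
    by_contra hf
    exact h τ hτ.1 hτ.2 ⟨hs, by simpa using hf⟩

theorem exists_thin {W : Set ℕ} {f : List Bool → List Bool → Bool} (hf : REColoring W f)
    {X : Set (List Bool)} (hX : Perfect X) (hne : X.Nonempty) (hre : RE W fun x => x ∈ X)
    (S : List (List Bool)) : ∃ Y ⊆ X, Perfect Y ∧ Y.Nonempty ∧ (RE W fun x => x ∈ Y) ∧
      ∃ c : List Bool → Bool, ∀ s ∈ S, ∀ τ ∈ Y, StrictPrefix s τ → f s τ = c s := by
  suffices ∃ Y ⊆ X, Perfect Y ∧ Y.Nonempty ∧ (RE W fun x => x ∈ Y) ∧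
      ∀ s ∈ S, ∃ c, ∀ τ ∈ Y, StrictPrefix s τ → f s τ = c by
    obtain ⟨Y, h1, h2, h3, h4, h5⟩ := this
    choose! c hc using h5
    exact ⟨Y, h1, h2, h3, h4, c, hc⟩
  induction S with
  | nil => exact ⟨X, le_rfl, hX, hne, hre, by simp⟩
  | cons s S ih =>
    obtain ⟨Y, h1, h2, h3, h4, h5⟩ := ih
    obtain ⟨Y', h1', h2', h3', h4', h5'⟩ := exists_thin_one hf h2 h3 h4 s
    refine ⟨Y', h1'.trans h1, h2', h3', h4', fun t ht => ?_⟩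
    rcases List.mem_cons.1 ht with rfl | ht
    · exact h5'
    · obtain ⟨c, hc⟩ := h5 t ht
      exact ⟨c, fun τ hτ => hc τ (h1' hτ)⟩

/-! ### Trees inside perfect sets -/

/-- Positions are lists with the newest step at the head, which is why the tree order is the suffix
order. Distinct children of a node are incomparable, so two positions that part stay apart. -/
theorem prefix_iff_of_branching {ι : Type*} {B : List ι → List Bool}
    (h1 : ∀ a l, StrictPrefix (B l) (B (a :: l)))
    (h2 : ∀ a b l, a ≠ b → Incomp (B (a :: l)) (B (b :: l))) (l m : List ι) :
    B l <+: B m ↔ l <:+ m := by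
  have mono : ∀ t l, B l <+: B (t ++ l) := by
    intro t l
    induction t with
    | nil => exact List.prefix_rfl
    | cons a t ih => exact ih.trans (h1 a _).1
  constructor
  · induction l with
    | nil => simp
    | cons a l ih =>
      intro h
      obtain ⟨t, rfl⟩ := ih ((h1 a l).1.trans h)
      rcases List.eq_nil_or_concat t with rfl | ⟨t, b, rfl⟩
      · have := h.length_le
        have := (h1 a l).length_lt
        simp_all
        omega
      · rw [List.concat_append] at h ⊢
        by_cases hab : a = b
        · subst hab
          exact List.suffix_append _ _
        · exact absurd h ((h2 a b l hab).mono List.prefix_rfl (mono _ _)).1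
  · rintro ⟨t, rfl⟩
    exact mono t l

/-- Uniformizing the enumerable relation between a string and its incomparable pairs of extensions
in `X` makes the choice of children effective, and recursion along the position does the rest. -/
theorem exists_binary_tree {W : Set ℕ} {X : Set (List Bool)} (hX : Perfect X)
    (hre : RE W fun x => x ∈ X) {x₀ : List Bool} (hx₀ : x₀ ∈ X) :
    ∃ i : List Bool → List Bool, (RE W fun x : List Bool × List Bool => x.2 = i x.1) ∧
      i [] = x₀ ∧ (∀ l, i l ∈ X) ∧ (∀ a l, StrictPrefix (i l) (i (a :: l))) ∧
      ∀ a b l, a ≠ b → Incomp (i (a :: l)) (i (b :: l)) := by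
  have hR : RE W fun x : List Bool × (List Bool × List Bool) =>
      x.2.1 ∈ X ∧ x.2.2 ∈ X ∧ x.1 <+: x.2.1 ∧ x.1 <+: x.2.2 ∧ Incomp x.2.1 x.2.2 :=
    (hre.comp (fst.comp snd)).and ((hre.comp (snd.comp snd)).and
      ((RE.of_primrec (primrecRel_prefix.comp fst (fst.comp snd)) W).and
      ((RE.of_primrec (primrecRel_prefix.comp fst (snd.comp snd)) W).and
      (RE.of_primrec (primrecRel_incomp.comp (fst.comp snd) (snd.comp snd)) W))))
  obtain ⟨G, hG, hGR, hGf, hGe⟩ := RE.uniformize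
    (R := fun (x : List Bool) (y : List Bool × List Bool) => y.1 ∈ X ∧ y.2 ∈ X ∧ x <+: y.1 ∧
      x <+: y.2 ∧ Incomp y.1 y.2) hR
  have hstep : ∀ x, ∃ y : List Bool × List Bool, x ∈ X → G x y := by
    intro x
    by_cases hx : x ∈ X
    · obtain ⟨y, hy, z, hz, H⟩ := hX x hx
      obtain ⟨w, hw⟩ := hGe x ⟨(y, z), hy, hz, H⟩
      exact ⟨w, fun _ => hw⟩
    · exact ⟨([], []), fun h => absurd h hx⟩
  choose step hstep using hstep
  let i : List Bool → List Bool := fun l =>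
    l.foldr (fun b x => cond b (step x).2 (step x).1) x₀
  have hmem : ∀ l, i l ∈ X := by
    intro l
    induction l with
    | nil => exact hx₀
    | cons b l ih =>
      have := hGR _ _ (hstep _ ih)
      cases b
      exacts [this.1, this.2.1]
  have hinc : ∀ l, Incomp (i (false :: l)) (i (true :: l)) := fun l =>
    (hGR _ _ (hstep _ (hmem l))).2.2.2.2
  have hpre : ∀ a l, i l <+: i (a :: l) := by
    intro a l
    have := hGR _ _ (hstep _ (hmem l))
    cases a
    exacts [this.2.2.1, this.2.2.2.1]
  refine ⟨i, ?_, rfl, hmem, fun a l => ⟨hpre a l, fun h => ?_⟩, fun a b l hab => ?_⟩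
  · refine RE.listRec (r := fun l y => y = i l)
      (step := fun b x y => ∃ w, G x w ∧ y = cond b w.2 w.1) ?_ ?_ fun b l y => ?_
    · exact RE.of_primrec (Primrec.eq.comp .id (.const _)) W
    · refine RE.ex (p := fun (z : (Bool × List Bool) × List Bool) (w : List Bool × List Bool) =>
        G z.1.2 w ∧ z.2 = cond z.1.1 w.2 w.1) (RE.and (hG.comp (g := fun z : ((Bool × List Bool) ×
          List Bool) × List Bool × List Bool => (z.1.1.2, z.2))
          (Primrec.pair (snd.comp (fst.comp fst)) snd)) (RE.of_primrec ?_ W))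
      exact Primrec.eq.comp (snd.comp fst) (Primrec.cond (fst.comp (fst.comp fst))
        (snd.comp snd) (fst.comp snd))
    · constructor
      · rintro rfl
        exact ⟨i l, rfl, _, hstep _ (hmem l), rfl⟩
      · rintro ⟨_, rfl, w, hw, rfl⟩
        rw [hGf _ _ _ hw (hstep _ (hmem l))]
        rfl
  · cases a
    · exact (hinc l).1 (h ▸ hpre true l)
    · exact (hinc l).2 (h ▸ hpre false l)
  · cases a <;> cases b
    · exact absurd rfl hab
    · exact hinc l
    · exact (hinc l).symm
    · exact absurd rfl hab

/-- An embedding of the infinitely branching tree into the binary tree. -/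
def omegaCode (l : List ℕ) : List Bool :=
  l.foldr (fun a s => false :: (List.replicate a true ++ s)) []

theorem primrec_omegaCode : Primrec omegaCode := by
  refine list_foldr (h := fun _ p => false :: (List.replicate p.1 true ++ p.2)) .id (.const [])
    (list_cons.comp (.const false) (list_append.comp ?_ (snd.comp snd)))
  exact (list_map (list_range.comp (fst.comp snd))
    (g := fun (_ : List ℕ × ℕ × List Bool) (_ : ℕ) => true) (Primrec.const true)).of_eq
    fun x => by simp [List.map_const']

/-- In the binary tree, child `a` of a node is reached by `a` steps `true` and then one step
`false`. Of two children, the one with the smaller number turns away first, so they are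
incomparable. -/
theorem exists_omega_tree {W : Set ℕ} {X : Set (List Bool)} (hX : Perfect X)
    (hre : RE W fun x => x ∈ X) {x₀ : List Bool} (hx₀ : x₀ ∈ X) :
    ∃ B : List ℕ → List Bool, (RE W fun x : List ℕ × List Bool => x.2 = B x.1) ∧
      (∀ l, B l ∈ X) ∧ (∀ l, x₀ <+: B l) ∧ ∀ l m, B l <+: B m ↔ l <:+ m := by
  obtain ⟨i, hi, hi0, hmem, h1, h2⟩ := exists_binary_tree hX hre hx₀
  have hpre := prefix_iff_of_branching h1 h2
  refine ⟨fun l => i (omegaCode l), hi.comp (Primrec.pair (primrec_omegaCode.comp fst) snd),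
    fun l => hmem _, fun l => ?_, ?_⟩
  · rw [← hi0, hpre]
    exact List.nil_suffix
  · refine prefix_iff_of_branching (B := fun l => i (omegaCode l)) (fun a l => ?_) ?_
    · have hl : (omegaCode l) <:+ omegaCode (a :: l) := by
        simp only [omegaCode, List.foldr_cons]
        rw [← List.cons_append]
        exact List.suffix_append _ _
      refine ⟨(hpre _ _).2 hl, fun h => ?_⟩
      have h' : omegaCode (a :: l) <:+ omegaCode l := by
        rw [← hpre, ← h]
      have := h'.length_le
      simp [omegaCode] at this
    · suffices ∀ a d l, Incomp (i (omegaCode (a :: l))) (i (omegaCode ((a + d + 1) :: l))) by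
        intro a b l hab
        rcases lt_or_gt_of_ne hab with h | h
        · obtain ⟨d, rfl⟩ := Nat.exists_eq_add_of_lt h
          exact this a d l
        · obtain ⟨d, rfl⟩ := Nat.exists_eq_add_of_lt h
          exact (this b d l).symm
      intro a d l
      let p := List.replicate a true ++ omegaCode l
      have e1 : omegaCode (a :: l) = false :: p := rfl
      have e2 : omegaCode ((a + d + 1) :: l) = (false :: List.replicate d true) ++ (true :: p) := by
        simp only [omegaCode, List.foldr_cons, p, List.cons_append]
        rw [show a + d + 1 = d + (1 + a) by omega, List.replicate_add, List.replicate_add]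
        simp
      rw [e1, e2]
      refine (h2 false true p (by simp)).mono List.prefix_rfl ((hpre _ _).2 ?_)
      exact List.suffix_append _ _

/-- A perfect set computes a copy of the full binary tree inside it. -/
theorem exists_isoFullTree {W : Set ℕ} {X : Set (List Bool)} (hX : Perfect X)
    (hne : X.Nonempty) (hre : RE W fun x => x ∈ X) :
    ∃ H ⊆ X, IsoFullTree H ∧ Red (codes H) W := by
  obtain ⟨x₀, hx₀⟩ := hne
  obtain ⟨i, hi, hi0, hmem, h1, h2⟩ := exists_binary_tree hX hre hx₀
  have hpre := prefix_iff_of_branching h1 h2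
  have hlen : ∀ l, l.length ≤ (i l).length := by
    intro l
    induction l with
    | nil => simp
    | cons a l ih =>
      have := (h1 a l).length_lt
      simp
      omega
  have hinj : Function.Injective i := by
    intro l m h
    have h1 := (hpre l m).1 (h ▸ List.prefix_rfl)
    have h2 := (hpre m l).1 (h ▸ List.prefix_rfl)
    exact h1.eq_of_length (le_antisymm h1.length_le h2.length_le)
  refine ⟨Set.range i, ?_, ⟨fun l => i l.reverse, ⟨?_, ?_, ?_⟩, fun σ τ => ?_⟩, ?_, ?_⟩
  · rintro _ ⟨l, rfl⟩
    exact hmem l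
  · exact fun l _ => ⟨_, rfl⟩
  · exact fun l _ m _ h => List.reverse_injective (hinj h)
  · rintro _ ⟨l, rfl⟩
    exact ⟨l.reverse, trivial, by simp⟩
  · rw [hpre, List.reverse_suffix]
  · refine (RE.ex (p := fun (n : ℕ) (y : List Bool × List Bool) => n = encode y.2 ∧ y.2 = i y.1)
      ((RE.of_primrec (Primrec.eq.comp fst (Primrec.encode.comp (snd.comp snd))) W).and
      (hi.comp snd))).of_iff fun n => ?_
    simp [codes, eq_comm]
  · have hin : RE W fun z : List Bool × ℕ × ℕ =>
        ∃ y, y = i (bits z.2.1 z.2.2) ∧ y ≠ z.1 :=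
      RE.ex (p := fun (z : List Bool × ℕ × ℕ) y => y = i (bits z.2.1 z.2.2) ∧ y ≠ z.1)
        ((hi.comp (Primrec.pair (primrec_bits.comp (fst.comp (snd.comp fst))
          (snd.comp (snd.comp fst))) snd)).and (RE.of_primrec (PrimrecPred.not
          (Primrec.eq.comp snd (fst.comp fst))) W))
    -- Since `i` does not decrease length, `x` can only be the image of a position of length at most
    -- that of `x`, so nonmembership is a finite check.
    have hnot : RE W fun x : List Bool => ∀ n < x.length + 1, ∀ m < 2 ^ n,
        ∃ y, y = i (bits n m) ∧ y ≠ x := by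
      refine RE.all_lt (p := fun (x : List Bool) n => ∀ m < 2 ^ n,
        ∃ y, y = i (bits n m) ∧ y ≠ x) ?_ (succ.comp list_length)
      refine RE.all_lt (p := fun (x : List Bool × ℕ) m =>
        ∃ y, y = i (bits x.2 m) ∧ y ≠ x.1) ?_ (primrec_two_pow.comp snd)
      exact hin.comp (g := fun x : (List Bool × ℕ) × ℕ => (x.1.1, x.1.2, x.2))
        (Primrec.pair (fst.comp fst) (Primrec.pair (snd.comp fst) snd))
    have hdec : RE W fun z : ℕ × List Bool => encode z.2 = z.1 :=
      RE.of_primrec (Primrec.eq.comp (Primrec.encode.comp snd) fst) W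
    have hout : RE W fun n : ℕ => decode₂ (List Bool) n = none :=
      RE.of_primrec (Primrec.eq.comp Primrec.decode₂ (.const none)) W
    refine (hout.or (RE.ex (p := fun (n : ℕ) (x : List Bool) => encode x = n ∧
        ∀ n < x.length + 1, ∀ m < 2 ^ n, ∃ y, y = i (bits n m) ∧ y ≠ x)
      (hdec.and (hnot.comp snd)))).of_iff fun n => ?_
    constructor
    · intro hn
      rcases h : decode₂ (List Bool) n with _ | x
      · exact Or.inl rfl
      · rw [← Option.mem_def, mem_decode₂] at h
        exact Or.inr ⟨x, h, fun k _ m _ => ⟨_, rfl, fun h' => hn ⟨_, ⟨_, rfl⟩, h' ▸ h⟩⟩⟩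
    · rintro (hn | ⟨x, hx, h⟩) ⟨y, ⟨l, rfl⟩, rfl⟩
      · simp at hn
      obtain rfl := encode_injective hx
      classical
      obtain ⟨m, hm, hm'⟩ := exists_bits {j | l[j]? = some true} l.length
      obtain ⟨y, hy, hne⟩ := h l.length (by have := hlen l; omega) m hm
      refine hne (hy.trans (congrArg i ?_))
      rw [hm']
      refine (eq_res_of_getElem? fun j b hb => ?_).symm
      simp [hb]

end TreeTheorem

namespace TreeTheorem

open Encodable Primrec

/-! ### Mathias forcing with perfect reservoirs -/

/-- All pairs `σ ≺ τ` from `F` have color `i`. -/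
def Hom (f : List Bool → List Bool → Bool) (i : Bool) (F : Set (List Bool)) : Prop :=
  ∀ σ ∈ F, ∀ τ ∈ F, StrictPrefix σ τ → f σ τ = i

theorem Hom.mono {f : List Bool → List Bool → Bool} {i : Bool} {F G : Set (List Bool)}
    (h : Hom f i G) (hFG : F ⊆ G) : Hom f i F :=
  fun σ hσ τ hτ => h σ (hFG hσ) τ (hFG hτ)

@[simp] theorem encode_mem_codes {F : Set (List Bool)} {σ : List Bool} :
    encode σ ∈ codes F ↔ σ ∈ F :=
  encode_injective.mem_set_image

theorem res_codes_congr {F G : Set (List Bool)} {k : ℕ}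
    (h : ∀ σ, encode σ < k → (σ ∈ F ↔ σ ∈ G)) : res (codes F) k = res (codes G) k := by
  refine res_congr fun n hn => ?_
  constructor
  · rintro ⟨σ, hσ, rfl⟩
    exact encode_mem_codes.2 ((h σ hn).1 hσ)
  · rintro ⟨σ, hσ, rfl⟩
    exact encode_mem_codes.2 ((h σ hn).2 hσ)

/-- A finite stem, a reservoir, and an oracle enumerating the reservoir. -/
structure PreCond where
  /-- the stem -/
  F : Finset (List Bool)
  /-- the reservoir -/
  X : Set (List Bool)
  /-- the oracle -/
  W : Set ℕ

/-- Forcing conditions for a homogeneous set of color `i` that avoids the cone above `C`. -/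
structure Cond (f : List Bool → List Bool → Bool) (C Z : Set ℕ) (i : Bool) (p : PreCond) :
    Prop where
  hom : Hom f i p.F
  perfect : Perfect p.X
  nonempty : p.X.Nonempty
  re : RE p.W fun x => x ∈ p.X
  avoid : ¬ Red C p.W
  base : Red Z p.W
  ext : ∀ ρ ∈ p.F, ∃ τ ∈ p.X, ρ <+: τ
  col : ∀ ρ ∈ p.F, ∀ τ ∈ p.X, StrictPrefix ρ τ → f ρ τ = i
  long : ∀ ρ ∈ p.F, ∀ τ ∈ p.X, ρ.length < τ.length

/-- The condition `q` extends the condition `p`. -/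
structure Extends (q p : PreCond) : Prop where
  stem : p.F ⊆ q.F
  new : ∀ σ ∈ q.F, σ ∈ p.F ∨ σ ∈ p.X
  res : q.X ⊆ p.X
  orc : Red p.W q.W

theorem Extends.refl (p : PreCond) : Extends p p :=
  ⟨le_rfl, fun _ h => Or.inl h, le_rfl, Red.refl _⟩

theorem Extends.trans {p q r : PreCond} (h : Extends r q) (h' : Extends q p) : Extends r p where
  stem := h'.stem.trans h.stem
  new σ hσ := by
    rcases h.new σ hσ with h1 | h1
    exacts [h'.new σ h1, Or.inr (h'.res h1)]
  res := h.res.trans h'.res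
  orc := h'.orc.trans h.orc

/-- The condition `p` guarantees that the operator `V` does not compute `C` from the generic. -/
def Meets (f : List Bool → List Bool → Bool) (C : Set ℕ) (i : Bool) (p : PreCond)
    (V : (ℕ × Bool) × List Bool → Prop) : Prop :=
  (∃ n b k, ¬ (b = true ↔ n ∈ C) ∧ V ((n, b), res (codes p.F) k) ∧ ∀ τ ∈ p.X, k ≤ encode τ) ∨
  ∃ n b, (b = true ↔ n ∈ C) ∧ ∀ E : Finset (List Bool), ↑E ⊆ p.X → Hom f i (p.F ∪ E) →
    ∀ k, ¬ V ((n, b), res (codes (p.F ∪ E)) k)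

/-- Stem elements have the right color towards the reservoir. The clause `long` excludes comparisons
in the opposite order, and incomparability excludes the pair `y`, `z` itself. -/
theorem Cond.hom_insert_pair {f : List Bool → List Bool → Bool} {C Z : Set ℕ} {i : Bool}
    {p : PreCond} (hp : Cond f C Z i p) {y z : List Bool} (hy : y ∈ p.X) (hz : z ∈ p.X)
    (hyz : Incomp y z) : Hom f i (p.F ∪ {y, z}) := by
  have key : ∀ σ ∈ p.X, ∀ τ, τ ∈ (p.F : Set (List Bool)) → ¬ StrictPrefix σ τ :=
    fun σ hσ τ hτ h => absurd h.length_lt (not_lt.2 (hp.long τ hτ σ hσ).le)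
  rintro σ (hσ | rfl | rfl) τ (hτ | rfl | rfl) h
  · exact hp.hom σ hσ τ hτ h
  · exact hp.col σ hσ _ hy h
  · exact hp.col σ hσ _ hz h
  · exact absurd h (key _ hy _ hτ)
  · exact absurd rfl h.2
  · exact absurd h.1 hyz.1
  · exact absurd h (key _ hz _ hτ)
  · exact absurd h.1 hyz.2
  · exact absurd rfl h.2

/-- The operator that recognizes two incomparable extensions of `ρ` in its oracle. -/
def splitOp (ρ : List Bool) (x : (ℕ × Bool) × List Bool) : Prop :=
  ∃ y : List Bool × List Bool, x.2[encode y.1]? = some true ∧ x.2[encode y.2]? = some true ∧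
    ρ <+: y.1 ∧ ρ <+: y.2 ∧ Incomp y.1 y.2

theorem re_splitOp (W : Set ℕ) (ρ : List Bool) : RE W (splitOp ρ) := by
  refine RE.ex (p := fun (x : (ℕ × Bool) × List Bool) (y : List Bool × List Bool) =>
    x.2[encode y.1]? = some true ∧ x.2[encode y.2]? = some true ∧
    ρ <+: y.1 ∧ ρ <+: y.2 ∧ Incomp y.1 y.2) (RE.of_primrec ?_ W)
  refine PrimrecPred.and (Primrec.eq.comp (list_getElem?.comp (snd.comp fst)
    (Primrec.encode.comp (fst.comp snd))) (.const _)) (PrimrecPred.and (Primrec.eq.comp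
    (list_getElem?.comp (snd.comp fst) (Primrec.encode.comp (snd.comp snd))) (.const _)) ?_)
  exact PrimrecPred.and (primrecRel_prefix.comp (.const ρ) (fst.comp snd)) (PrimrecPred.and
    (primrecRel_prefix.comp (.const ρ) (snd.comp snd))
    (primrecRel_incomp.comp (fst.comp snd) (snd.comp snd)))

theorem splitOp_iff {ρ : List Bool} {F : Set (List Bool)} {x : ℕ × Bool} {k : ℕ} :
    splitOp ρ (x, res (codes F) k) ↔ ∃ y ∈ F, ∃ z ∈ F, encode y < k ∧ encode z < k ∧ ρ <+: y ∧
      ρ <+: z ∧ Incomp y z := by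
  simp only [splitOp, res_getElem?, true_iff, encode_mem_codes, Prod.exists]
  refine ⟨fun ⟨y, z, h1, h2, h⟩ => ⟨y, h1.2, z, h2.2, h1.1, h2.1, h⟩,
    fun ⟨y, h1, z, h2, h3, h4, h⟩ => ⟨y, z, ⟨h3, h1⟩, ⟨h4, h2⟩, h⟩⟩

/-- A sufficiently generic sequence of conditions yields a perfect homogeneous set that avoids the
cone above `C`. -/
theorem exists_generic {f : List Bool → List Bool → Bool} {C Z : Set ℕ} {i : Bool}
    {p₀ : PreCond} (hp₀ : Cond f C Z i p₀)
    (h : ∀ V, RE Z V → ∀ p, Cond f C Z i p → Extends p p₀ →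
      ∃ q, Cond f C Z i q ∧ Extends q p ∧ Meets f C i q V) :
    ∃ G : Set (List Bool), Perfect G ∧ G.Nonempty ∧ Hom f i G ∧
      ¬ Red C (join (codes G) Z) := by
  classical
  obtain ⟨e, he, hsurj⟩ := exists_enum ((ℕ × Bool) × List Bool) Z
  choose! next h1 h2 h3 using fun (p : PreCond) (hp : Cond f C Z i p ∧ Extends p p₀) (n : ℕ) =>
    h (e n) (he n) p hp.1 hp.2
  let p : ℕ → PreCond := fun n => Nat.rec p₀ (fun n q => next q n) n
  have hp : ∀ n, Cond f C Z i (p n) ∧ Extends (p n) p₀ := by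
    intro n
    induction n with
    | zero => exact ⟨hp₀, .refl _⟩
    | succ n ih => exact ⟨h1 _ ih _, (h2 _ ih _).trans ih.2⟩
  have hstep : ∀ n, Extends (p (n + 1)) (p n) := fun n => h2 _ (hp n) n
  have hmeet : ∀ n, Meets f C i (p (n + 1)) (e n) := fun n => h3 _ (hp n) n
  have hle : ∀ m n, m ≤ n → Extends (p n) (p m) := by
    intro m n hmn
    induction n, hmn using Nat.le_induction with
    | base => exact .refl _
    | succ n _ ih => exact (hstep n).trans ih
  let G : Set (List Bool) := {σ | ∃ n, σ ∈ (p n).F}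
  have hFG : ∀ n, ((p n).F : Set (List Bool)) ⊆ G := fun n σ hσ => ⟨n, hσ⟩
  have hG : ∀ n, ∀ σ ∈ G, σ ∈ (p n).F ∨ σ ∈ (p n).X := by
    rintro n σ ⟨m, hm⟩
    rcases le_total m n with hmn | hmn
    · exact Or.inl ((hle _ _ hmn).stem hm)
    · exact (hle _ _ hmn).new σ hm
  have hhom : Hom f i G := by
    rintro σ ⟨m, hm⟩ τ ⟨n, hn⟩ hστ
    exact (hp (max m n)).1.hom σ ((hle _ _ (le_max_left m n)).stem hm) τ
      ((hle _ _ (le_max_right m n)).stem hn) hστ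
  -- Perfectness of `G` comes from meeting `splitOp ρ`, which ignores its numerical input. That
  -- operator cannot be met by exclusion: a later reservoir contains two incomparable strings above
  -- `ρ` that may be added.
  have hsplit : ∀ ρ, (∀ n, ∃ m ≥ n, ∃ τ ∈ (p m).X, ρ <+: τ) →
      ∃ y ∈ G, ∃ z ∈ G, ρ <+: y ∧ ρ <+: z ∧ Incomp y z := by
    intro ρ hρ
    obtain ⟨n, hn⟩ := hsurj _ (re_splitOp Z ρ)
    have := hmeet n
    rw [hn] at this
    rcases this with ⟨_, _, _, -, hV, -⟩ | ⟨_, _, -, hV⟩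
    · obtain ⟨y, hy, z, hz, -, -, H⟩ := splitOp_iff.1 hV
      exact ⟨y, hFG (n + 1) hy, z, hFG (n + 1) hz, H⟩
    · exfalso
      obtain ⟨m, hm, τ, hτ, hρτ⟩ := hρ (n + 1)
      obtain ⟨y, hy, z, hz, hτy, hτz, hyz⟩ := (hp m).1.perfect τ hτ
      have hext := hle _ _ hm
      -- The stem of the later condition with `y` and `z` is presented as the stem of `p (n + 1)`
      -- plus a finite part of its reservoir, the form excluded by `Meets`.
      have hEq : ((p (n + 1)).F : Set (List Bool)) ∪
          (((p m).F \ (p (n + 1)).F ∪ {y, z} : Finset (List Bool)) : Set (List Bool)) =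
          ((p m).F : Set (List Bool)) ∪ {y, z} := by
        ext σ
        have : σ ∈ (p (n + 1)).F → σ ∈ (p m).F := fun h => hext.stem h
        simp only [Finset.coe_union, Finset.coe_sdiff, Finset.coe_insert, Finset.coe_singleton,
          Set.mem_union, Set.mem_sdiff, Finset.mem_coe]
        tauto
      refine hV ((p m).F \ (p (n + 1)).F ∪ {y, z}) ?_ ?_ (max (encode y) (encode z) + 1) ?_
      · intro σ hσ
        simp only [Finset.coe_union, Finset.coe_sdiff, Finset.coe_insert, Finset.coe_singleton,
          Set.mem_union, Set.mem_sdiff, Finset.mem_coe] at hσ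
        rcases hσ with ⟨hσ, hσ'⟩ | rfl | rfl
        · exact (hext.new σ hσ).resolve_left hσ'
        · exact hext.res hy
        · exact hext.res hz
      · rw [hEq]
        exact (hp m).1.hom_insert_pair hy hz hyz
      · rw [hEq, splitOp_iff]
        exact ⟨y, by simp, z, by simp, by omega, by omega, hρτ.trans hτy, hρτ.trans hτz, hyz⟩
  refine ⟨G, fun ρ ⟨m, hm⟩ => hsplit ρ fun n => ?_, ?_, hhom, fun hred => ?_⟩
  · exact ⟨max m n, le_max_right _ _,
      (hp _).1.ext ρ ((hle _ _ (le_max_left m n)).stem hm)⟩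
  · obtain ⟨y, hy, -⟩ := hsplit [] fun n =>
      ⟨n, le_rfl, (hp n).1.nonempty.imp fun τ hτ => ⟨hτ, List.nil_prefix⟩⟩
    exact ⟨y, hy⟩
  · obtain ⟨V, hV, hVC⟩ := (RE.red_iff.1 hred).exists_operator
    obtain ⟨n, rfl⟩ := hsurj V hV
    rcases hmeet n with ⟨m, b, k, hmb, hk, hX⟩ | ⟨m, b, hmb, hE⟩
    · refine hmb ((hVC (m, b)).2 ⟨k, ?_⟩)
      -- Elements of `G` outside this stem come from the reservoir and have codes at least `k`, so
      -- the wrong computation sees the same oracle.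
      rwa [res_codes_congr (G := ((p (n + 1)).F : Set (List Bool))) fun σ hσ =>
        ⟨fun hσG => (hG (n + 1) σ hσG).resolve_right fun h => absurd (hX σ h) (not_le.2 hσ),
          fun hσF => hFG (n + 1) hσF⟩]
    · obtain ⟨k, hk⟩ := (hVC (m, b)).1 hmb
      -- A computation from `G` uses only elements with code below `k`, hence only a finite
      -- extension of the stem.
      have hfin : {σ : List Bool | σ ∈ G ∧ σ ∉ (p (n + 1)).F ∧ encode σ < k}.Finite :=
        Set.Finite.subset (Set.Finite.preimage encode_injective.injOn (Set.finite_lt_nat k))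
          fun σ hσ => hσ.2.2
      refine hE hfin.toFinset ?_ (hhom.mono ?_) k ?_
      · intro σ hσ
        simp only [Set.Finite.coe_toFinset, Set.mem_ofPred_eq] at hσ
        exact (hG (n + 1) σ hσ.1).resolve_left hσ.2.1
      · intro σ hσ
        rcases hσ with hσ | hσ
        · exact hFG (n + 1) hσ
        · simp only [Set.Finite.coe_toFinset, Set.mem_ofPred_eq] at hσ
          exact hσ.1
      · rwa [res_codes_congr (G := G) fun σ hσ => ?_]
        simp only [Set.mem_union, Set.Finite.coe_toFinset, Set.mem_ofPred_eq, Finset.mem_coe]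
        have := @hFG (n + 1) σ
        simp only [Finset.mem_coe] at this
        tauto

/-- A condition below `p` that meets `V` by a computation with wrong value. -/
theorem Cond.exists_meets_of_computation {f : List Bool → List Bool → Bool} {C Z : Set ℕ}
    {i : Bool} {p : PreCond} (hp : Cond f C Z i p) {W : Set ℕ} (hW : Red p.W W)
    (hC : ¬ Red C W) {E : Finset (List Bool)} {Y : Set (List Bool)} (hY : Perfect Y)
    (hne : Y.Nonempty) (hre : RE W fun x => x ∈ Y) (hYX : Y ⊆ p.X) (hEX : ↑E ⊆ p.X)
    (hF : ∀ σ ∈ p.F, ∃ τ ∈ Y, σ <+: τ) (hE : ∀ σ ∈ E, ∃ τ ∈ Y, σ <+: τ)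
    (hcol : ∀ σ ∈ E, ∀ τ ∈ Y, StrictPrefix σ τ → f σ τ = i) (hhom : Hom f i (p.F ∪ E))
    {V : (ℕ × Bool) × List Bool → Prop} {n : ℕ} {b : Bool} {k : ℕ}
    (hnb : ¬ (b = true ↔ n ∈ C)) (hV : V ((n, b), TreeTheorem.res (codes (p.F ∪ E)) k)) :
    ∃ q, Cond f C Z i q ∧ Extends q p ∧ Meets f C i q V := by
  classical
  have hfin : {σ : List Bool | encode σ < k}.Finite :=
    Set.Finite.preimage encode_injective.injOn (Set.finite_lt_nat k)
  -- Strings longer than `L` are longer than every element of the new stem and have codes at least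
  -- `k`, so one truncation secures both the clause `long` and the use of the computation.
  let L := (p.F ∪ E ∪ hfin.toFinset).sup List.length
  have hL : ∀ σ, σ ∈ p.F ∨ σ ∈ E ∨ encode σ < k → σ.length ≤ L := by
    intro σ hσ
    refine Finset.le_sup (f := List.length) ?_
    simp only [Finset.mem_union, Set.Finite.mem_toFinset, Set.mem_ofPred_eq]
    tauto
  have hlong : ∀ σ, (∃ τ ∈ Y, σ <+: τ) → ∃ τ ∈ Y ∩ {τ | L < τ.length}, σ <+: τ := by
    rintro σ ⟨τ, hτ, hστ⟩
    obtain ⟨τ', hτ', h, hl⟩ := hY.exists_long hτ L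
    exact ⟨τ', ⟨hτ', hl⟩, hστ.trans h⟩
  refine ⟨⟨p.F ∪ E, Y ∩ {τ | L < τ.length}, W⟩, ⟨?_, hY.long L, ?_, hre.long L, hC,
    hp.base.trans hW, ?_, ?_, ?_⟩, ⟨Finset.subset_union_left, ?_, ?_, hW⟩,
    Or.inl ⟨n, b, k, hnb, ?_, ?_⟩⟩
  · simpa using hhom
  · obtain ⟨y, hy⟩ := hne
    obtain ⟨τ, hτ, -⟩ := hlong y ⟨y, hy, List.prefix_rfl⟩
    exact ⟨τ, hτ⟩
  · intro ρ hρ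
    rcases Finset.mem_union.1 hρ with h | h
    exacts [hlong _ (hF ρ h), hlong _ (hE ρ h)]
  · intro ρ hρ τ hτ hρτ
    rcases Finset.mem_union.1 hρ with h | h
    exacts [hp.col ρ h τ (hYX hτ.1) hρτ, hcol ρ h τ hτ.1 hρτ]
  · intro ρ hρ τ hτ
    refine lt_of_le_of_lt (hL ρ ?_) hτ.2
    rcases Finset.mem_union.1 hρ with h | h
    exacts [Or.inl h, Or.inr (Or.inl h)]
  · intro σ hσ
    rcases Finset.mem_union.1 hσ with h | h
    exacts [Or.inl h, Or.inr (hEX h)]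
  · exact fun σ hσ => hYX hσ.1
  · simpa using hV
  · intro τ hτ
    by_contra hlt
    exact absurd (hL τ (Or.inr (Or.inr (not_le.1 hlt)))) (not_le.2 hτ.2)

/-- A condition below `p` that meets `V` by excluding the correct value. -/
theorem Cond.exists_meets_of_divergence {f : List Bool → List Bool → Bool} {C Z : Set ℕ}
    {i : Bool} {p : PreCond} (hp : Cond f C Z i p) {W : Set ℕ} (hW : Red p.W W)
    (hC : ¬ Red C W) {Y : Set (List Bool)} (hY : Perfect Y)
    (hne : Y.Nonempty) (hre : RE W fun x => x ∈ Y) (hYX : Y ⊆ p.X)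
    (hF : ∀ σ ∈ p.F, ∃ τ ∈ Y, σ <+: τ)
    {V : (ℕ × Bool) × List Bool → Prop} {n : ℕ} {b : Bool} (hnb : b = true ↔ n ∈ C)
    (hV : ∀ E : Finset (List Bool), ↑E ⊆ Y → Hom f i (p.F ∪ E) →
      ∀ k, ¬ V ((n, b), TreeTheorem.res (codes (p.F ∪ E)) k)) :
    ∃ q, Cond f C Z i q ∧ Extends q p ∧ Meets f C i q V :=
  ⟨⟨p.F, Y, W⟩, ⟨hp.hom, hY, hne, hre, hC, hp.base.trans hW, hF,
    fun ρ hρ τ hτ => hp.col ρ hρ τ (hYX hτ), fun ρ hρ τ hτ => hp.long ρ hρ τ (hYX hτ)⟩,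
    ⟨le_rfl, fun _ h => Or.inl h, hYX, hW⟩, Or.inr ⟨n, b, hnb, hV⟩⟩

/-- Finitely many strings with extensions in `X` are covered by a finite antichain of `X`. -/
theorem exists_antichain {X : Set (List Bool)} (S : Finset (List Bool))
    (h : ∀ σ ∈ S, ∃ τ ∈ X, σ <+: τ) :
    ∃ A : Finset (List Bool), ↑A ⊆ X ∧ (∀ a ∈ A, ∀ b ∈ A, a ≠ b → Incomp a b) ∧
      ∀ σ ∈ S, ∃ a ∈ A, σ <+: a := by
  classical
  induction S using Finset.induction_on with
  | empty => exact ⟨∅, by simp, by simp, by simp⟩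
  | insert σ S _ ih =>
    obtain ⟨A, hAX, hA, hS⟩ := ih fun τ hτ => h τ (Finset.mem_insert_of_mem hτ)
    by_cases hσ : ∃ a ∈ A, σ <+: a
    · refine ⟨A, hAX, hA, fun τ hτ => ?_⟩
      rcases Finset.mem_insert.1 hτ with rfl | hτ
      exacts [hσ, hS τ hτ]
    · obtain ⟨x, hx, hσx⟩ := h σ (Finset.mem_insert_self _ _)
      have hxa : ∀ a ∈ A, ¬ x <+: a := fun a ha hxa => hσ ⟨a, ha, hσx.trans hxa⟩
      -- `x` replaces the members of `A` below it. No member lies above `x`, for it would already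
      -- cover `σ`.
      refine ⟨insert x (A.filter fun a => ¬ a <+: x), ?_, ?_, ?_⟩
      · intro a ha
        rcases Finset.mem_insert.1 (Finset.mem_coe.1 ha) with rfl | ha
        exacts [hx, hAX (Finset.mem_filter.1 ha).1]
      · intro a ha b hb hab
        rcases Finset.mem_insert.1 ha with rfl | ha <;> rcases Finset.mem_insert.1 hb with rfl | hb
        · exact absurd rfl hab
        · exact ⟨hxa b (Finset.mem_filter.1 hb).1, (Finset.mem_filter.1 hb).2⟩
        · exact ⟨(Finset.mem_filter.1 ha).2, hxa a (Finset.mem_filter.1 ha).1⟩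
        · exact hA a (Finset.mem_filter.1 ha).1 b (Finset.mem_filter.1 hb).1 hab
      · intro τ hτ
        rcases Finset.mem_insert.1 hτ with rfl | hτ
        · exact ⟨x, Finset.mem_insert_self _ _, hσx⟩
        · obtain ⟨a, ha, hτa⟩ := hS τ hτ
          by_cases hax : a <+: x
          · exact ⟨x, Finset.mem_insert_self _ _, hτa.trans hax⟩
          · exact ⟨a, Finset.mem_insert_of_mem (Finset.mem_filter.2 ⟨ha, hax⟩), hτa⟩

end TreeTheorem

namespace TreeTheorem

open Encodable Primrec

/-! ### Colored subtrees of an infinitely branching tree -/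

/-- A stem `F` of color `color` that is to be extended, inside the trees with roots in `R`, by a
computation of the operator `V`. -/
structure Task where
  /-- the color -/
  color : Bool
  /-- the stem -/
  F : Finset (List Bool)
  /-- the operator -/
  V : (ℕ × Bool) × List Bool → Prop
  /-- the roots -/
  R : Finset (List Bool)

/-- A node of a forest: a root and a position in the infinitely branching tree above it. -/
abbrev Node : Type := List Bool × List ℕ

/-- `s` refutes that the set of nodes it codes contains all roots and branches everywhere. -/
def Invalid (Rt : Finset (List Bool)) (s : List Bool) : Prop :=
  (∃ ρ ∈ Rt, s[2 * encode ((ρ, []) : Node)]? = some false) ∨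
  ∃ e : Node, e.1 ∈ Rt ∧ s[2 * encode e]? = some true ∧
    -- Bounding the children makes a violation visible in finitely many bits, so that the valid sets
    -- form a closed class. The bound exceeds by one the number of color patterns on a node and its
    -- predecessors.
    ∀ a < 2 ^ (e.2.length + 1) + 1, ∀ a' < a, s[2 * encode ((e.1, a :: e.2) : Node)]? = some false ∨
      s[2 * encode ((e.1, a' :: e.2) : Node)]? = some false

/-- The colored set of nodes coded by `s` contains an extension for the task `t`. -/
def Hit (f : List Bool → List Bool → Bool) (B : List Bool → List ℕ → List Bool) (t : Task)
    (x : ℕ × Bool) (s : List Bool) : Prop :=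
  ∃ L : List (List Bool), (∀ σ ∈ L, ∃ e : Node, e.1 ∈ t.R ∧ σ = B e.1 e.2 ∧
      s[2 * encode e]? = some true ∧ s[2 * encode e + 1]? = some t.color) ∧
    Hom f t.color {σ | σ ∈ t.F.toList ++ L} ∧
    ∃ k, t.V (x, res (codes {σ | σ ∈ t.F.toList ++ L}) k)

theorem primrecPred_mem_finset {α : Type*} [Primcodable α] (S : Finset α) :
    PrimrecPred fun a => a ∈ S :=
  (primrecPred_exists_mem (p := fun a b => a = b) Primrec.eq (.const S.toList)).of_eq
    fun a => by simp

theorem primrec_bit_query {α : Type*} [Primcodable α] {g : α → List Bool} {h : α → ℕ}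
    (hg : Primrec g) (hh : Primrec h) (b : Bool) : PrimrecPred fun a => (g a)[h a]? = some b :=
  Primrec.eq.comp (list_getElem?.comp hg hh) (.const (some b))

theorem re_invalid (W : Set ℕ) (Rt : Finset (List Bool)) : RE W (Invalid Rt) := by
  refine RE.or (RE.ex_finset Rt (p := fun ρ (s : List Bool) =>
    s[2 * encode ((ρ, []) : Node)]? = some false) fun ρ _ =>
      RE.of_primrec (primrec_bit_query .id (.const _) _) W) ?_
  refine RE.ex (p := fun (s : List Bool) (e : Node) => e.1 ∈ Rt ∧ s[2 * encode e]? = some true ∧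
    ∀ a < 2 ^ (e.2.length + 1) + 1, ∀ a' < a, s[2 * encode ((e.1, a :: e.2) : Node)]? = some false ∨
      s[2 * encode ((e.1, a' :: e.2) : Node)]? = some false) ?_
  refine (RE.of_primrec ((primrecPred_mem_finset Rt).comp (fst.comp snd)) W).and
    ((RE.of_primrec (primrec_bit_query fst (nat_double.comp (Primrec.encode.comp snd)) _) W).and ?_)
  refine RE.all_lt (p := fun (x : List Bool × Node) a => ∀ a' < a,
    x.1[2 * encode ((x.2.1, a :: x.2.2) : Node)]? = some false ∨
      x.1[2 * encode ((x.2.1, a' :: x.2.2) : Node)]? = some false) ?_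
    (succ.comp (primrec_two_pow.comp (succ.comp (list_length.comp (snd.comp snd)))))
  refine RE.all_lt (p := fun (x : (List Bool × Node) × ℕ) a' =>
    x.1.1[2 * encode ((x.1.2.1, x.2 :: x.1.2.2) : Node)]? = some false ∨
      x.1.1[2 * encode ((x.1.2.1, a' :: x.1.2.2) : Node)]? = some false) ?_ snd
  refine RE.of_primrec (PrimrecPred.or ?_ ?_) W
  · exact primrec_bit_query (fst.comp (fst.comp fst)) (nat_double.comp (Primrec.encode.comp
      (Primrec.pair (fst.comp (snd.comp (fst.comp fst))) (list_cons.comp (snd.comp fst)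
        (snd.comp (snd.comp (fst.comp fst))))))) _
  · exact primrec_bit_query (fst.comp (fst.comp fst)) (nat_double.comp (Primrec.encode.comp
      (Primrec.pair (fst.comp (snd.comp (fst.comp fst))) (list_cons.comp snd
        (snd.comp (snd.comp (fst.comp fst))))))) _

theorem REColoring.re_hom {W : Set ℕ} {f : List Bool → List Bool → Bool} (hf : REColoring W f)
    (i : Bool) : RE W fun M : List (List Bool) => Hom f i {σ | σ ∈ M} := by
  have h1 : RE W fun x : (List (List Bool) × List Bool) × List Bool =>
      StrictPrefix x.1.2 x.2 → f x.1.2 x.2 = i := by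
    refine ((RE.of_primrec (PrimrecPred.not (primrecRel_strictPrefix.comp (snd.comp fst) snd))
      W).or (hf.comp (g := fun x : (List (List Bool) × List Bool) × List Bool =>
        ((x.1.2, x.2), i)) (Primrec.pair (Primrec.pair (snd.comp fst) snd) (.const i)))).of_iff
      fun x => ?_
    simp only
    tauto
  exact RE.all_mem (p := fun (M : List (List Bool)) σ => ∀ τ ∈ M, StrictPrefix σ τ → f σ τ = i)
    (RE.all_mem (p := fun (x : List (List Bool) × List Bool) τ =>
      StrictPrefix x.2 τ → f x.2 τ = i) h1 fst) .id

theorem primrec_res_codes : Primrec₂ fun (M : List (List Bool)) (k : ℕ) =>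
    res (codes {σ | σ ∈ M}) k := by
  classical
  have h : PrimrecPred fun z : (List (List Bool) × ℕ) × ℕ => ∃ σ ∈ z.1.1, encode σ = z.2 :=
    primrecPred_exists_mem (p := fun (z : (List (List Bool) × ℕ) × ℕ) σ => encode σ = z.2)
      (Primrec.eq.comp (Primrec.encode.comp snd) (snd.comp fst)) (fst.comp fst)
  have h' := list_map (f := fun x : List (List Bool) × ℕ => List.range x.2)
    (g := fun x n => decide (∃ σ ∈ x.1, encode σ = n)) (list_range.comp snd) h.decide
  refine h'.of_eq fun x => List.map_congr_left fun n _ => ?_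
  simp [codes]

theorem re_hit {W : Set ℕ} {f : List Bool → List Bool → Bool} (hf : REColoring W f)
    {B : List Bool → List ℕ → List Bool} {Rt : Finset (List Bool)}
    (hB : RE W fun x : Node × List Bool => x.1.1 ∈ Rt ∧ x.2 = B x.1.1 x.1.2) {t : Task}
    (hR : t.R ⊆ Rt) (hV : RE W t.V) :
    RE W fun x : (ℕ × Bool) × List Bool => Hit f B t x.1 x.2 := by
  have hM : Primrec fun z : ((ℕ × Bool) × List Bool) × List (List Bool) => t.F.toList ++ z.2 :=
    list_append.comp (.const _) snd
  refine RE.ex (p := fun (x : (ℕ × Bool) × List Bool) (L : List (List Bool)) =>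
    (∀ σ ∈ L, ∃ e : Node, e.1 ∈ t.R ∧ σ = B e.1 e.2 ∧
      x.2[2 * encode e]? = some true ∧ x.2[2 * encode e + 1]? = some t.color) ∧
    Hom f t.color {σ | σ ∈ t.F.toList ++ L} ∧
    ∃ k, t.V (x.1, res (codes {σ | σ ∈ t.F.toList ++ L}) k)) (RE.and ?_ (RE.and ?_ ?_))
  · refine RE.all_mem (p := fun (z : ((ℕ × Bool) × List Bool) × List (List Bool)) σ =>
      ∃ e : Node, e.1 ∈ t.R ∧ σ = B e.1 e.2 ∧ z.1.2[2 * encode e]? = some true ∧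
        z.1.2[2 * encode e + 1]? = some t.color) ?_ snd
    refine RE.ex (p := fun (z : (((ℕ × Bool) × List Bool) × List (List Bool)) × List Bool)
      (e : Node) => e.1 ∈ t.R ∧ z.2 = B e.1 e.2 ∧ z.1.1.2[2 * encode e]? = some true ∧
        z.1.1.2[2 * encode e + 1]? = some t.color) ?_
    refine ((RE.of_primrec ((primrecPred_mem_finset t.R).comp (fst.comp snd)) W).and
      ((hB.comp (Primrec.pair snd (snd.comp fst))).and (RE.of_primrec (PrimrecPred.and
      (primrec_bit_query (snd.comp (fst.comp (fst.comp fst)))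
        (nat_double.comp (Primrec.encode.comp snd)) true)
      (primrec_bit_query (snd.comp (fst.comp (fst.comp fst)))
        (nat_double_succ.comp (Primrec.encode.comp snd)) t.color)) W))).of_iff fun z => ?_
    constructor
    · exact fun ⟨h1, h2⟩ => ⟨h1, ⟨hR h1, h2.1⟩, h2.2⟩
    · exact fun ⟨h1, h2, h3⟩ => ⟨h1, h2.2, h3⟩
  · exact (hf.re_hom t.color).comp hM
  · refine RE.ex (p := fun (z : ((ℕ × Bool) × List Bool) × List (List Bool)) k =>
      t.V (z.1.1, res (codes {σ | σ ∈ t.F.toList ++ z.2}) k)) (hV.comp (Primrec.pair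
        (fst.comp (fst.comp fst)) (primrec_res_codes.comp (hM.comp fst) snd)))

/-- Every finite part of an infinitely branching tree contains a finite branching subtree, with a
reservoir above its leaves, such that the color of a node with respect to the reservoir depends on
the node only. -/
theorem exists_true_subtree {W : Set ℕ} {f : List Bool → List Bool → Bool} (hf : REColoring W f)
    {X : Set (List Bool)} (hX : Perfect X) (hre : RE W fun x => x ∈ X)
    {B : List ℕ → List Bool} (hB : ∀ l m, B l <+: B m ↔ l <:+ m) (hBX : ∀ l, B l ∈ X)
    (N : ℕ) (l : List ℕ) (hl : l.length ≤ N) :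
    ∃ (T : Set (List ℕ)) (c : List ℕ → Bool) (Y : Set (List Bool)), l ∈ T ∧
      (∀ s ∈ T, l <:+ s ∧ s.length ≤ N) ∧
      (∀ s ∈ T, s.length < N → ∃ a < 2 ^ (s.length + 1) + 1, ∃ a' < a, a :: s ∈ T ∧ a' :: s ∈ T) ∧
      Perfect Y ∧ (RE W fun x => x ∈ Y) ∧ (∀ τ ∈ Y, τ ∈ X ∧ B l <+: τ) ∧
      (∀ s ∈ T, ∃ τ ∈ Y, B s <+: τ) ∧
      ∀ s, (s ∈ T ∨ s <:+ l) → ∀ τ ∈ Y, StrictPrefix (B s) τ → f (B s) τ = c s := by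
  classical
  obtain ⟨k, hk⟩ := Nat.exists_eq_add_of_le hl
  induction k generalizing l with
  | zero =>
    -- At the top level, thin until each string on the path up to `B l`, including `B l`, has a
    -- fixed color towards the reservoir.
    obtain ⟨Y, hYX, hY, hYne, hYre, c, hc⟩ := exists_thin hf (hX.cone (B l))
      ⟨B l, hBX l, List.prefix_rfl⟩ (hre.cone (B l)) (l.tails.map B)
    refine ⟨{l}, fun s => c (B s), Y, rfl, ?_, ?_, hY, hYre, hYX, ?_, ?_⟩
    · rintro _ rfl
      exact ⟨List.suffix_rfl, hl⟩
    · rintro _ rfl h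
      omega
    · rintro _ rfl
      obtain ⟨τ, hτ⟩ := hYne
      exact ⟨τ, hτ, (hYX hτ).2⟩
    · rintro s hs τ hτ
      refine hc _ (List.mem_map.2 ⟨s, ?_, rfl⟩) τ hτ
      rw [List.mem_tails]
      rcases hs with rfl | hs
      exacts [List.suffix_rfl, hs]
  | succ k ih =>
    have key := fun a : ℕ => ih (a :: l) (by simp; omega) (by simp; omega)
    choose T c Y h1 h2 h3 h4 h5 h6 h7 h8 using key
    -- Each child's reservoir assigns colors to the `l.length + 1` suffixes of `l`. With one child
    -- more than there are such patterns, two children agree, and their subtrees and reservoirs can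
    -- be joined.
    obtain ⟨a, a', haa, hcol⟩ := Fintype.exists_ne_map_eq_of_card_lt
      (fun (a : Fin (2 ^ (l.length + 1) + 1)) (j : Fin (l.length + 1)) => c a (l.drop j))
      (by simp)
    wlog hlt : a' < a generalizing a a'
    · exact this a' a haa.symm hcol.symm (lt_of_le_of_ne (not_lt.1 hlt) haa)
    have hsuf : ∀ s, s <:+ l → c a s = c a' s := by
      intro s hs
      have := congrFun hcol ⟨l.length - s.length, by omega⟩
      simp only [← List.suffix_iff_eq_drop.1 hs] at this
      exact this
    have hne : ∀ s, (a : ℕ) :: l <:+ s → ¬ (a' : ℕ) :: l <:+ s := by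
      intro s hs hs'
      have := List.suffix_of_suffix_length_le hs hs' (by simp)
      have := this.eq_of_length (by simp)
      simp only [List.cons.injEq, and_true] at this
      exact haa (Fin.ext this)
    have hnsuf : ∀ b, ∀ s ∈ T b, ¬ s <:+ l := by
      intro b s hs hsl
      have := (h2 b s hs).1.length_le
      have := hsl.length_le
      simp at *
      omega
    -- The two reservoirs lie in disjoint cones, so a node of one subtree is not below any string in
    -- the reservoir of the other.
    have hinc : ∀ τ, B ((a : ℕ) :: l) <+: τ → ¬ B ((a' : ℕ) :: l) <+: τ := by
      intro τ h h'
      rcases List.prefix_or_prefix_of_prefix h h' with h | h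
      · exact hne _ ((hB _ _).1 h) List.suffix_rfl
      · exact hne _ List.suffix_rfl ((hB _ _).1 h)
    have hcons : ∀ b : ℕ, l <:+ b :: l := fun b => List.suffix_cons b l
    refine ⟨insert l (T a ∪ T a'), fun s => if s <:+ l then c a s else if s ∈ T a then c a s
      else c a' s, Y a ∪ Y a', Set.mem_insert _ _, ?_, ?_, (h4 a).union (h4 a'),
      (h5 a).or (h5 a'), ?_, ?_, ?_⟩
    · rintro s (rfl | hs | hs)
      · exact ⟨List.suffix_rfl, hl⟩
      · exact ⟨(hcons _).trans (h2 _ s hs).1, (h2 _ s hs).2⟩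
      · exact ⟨(hcons _).trans (h2 _ s hs).1, (h2 _ s hs).2⟩
    · rintro s (rfl | hs | hs) hsN
      · exact ⟨a, a.2, a', hlt, Or.inr (Or.inl (h1 _)), Or.inr (Or.inr (h1 _))⟩
      · obtain ⟨b, hb, b', hb', hs1, hs2⟩ := h3 _ s hs hsN
        exact ⟨b, hb, b', hb', Or.inr (Or.inl hs1), Or.inr (Or.inl hs2)⟩
      · obtain ⟨b, hb, b', hb', hs1, hs2⟩ := h3 _ s hs hsN
        exact ⟨b, hb, b', hb', Or.inr (Or.inr hs1), Or.inr (Or.inr hs2)⟩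
    · rintro τ (hτ | hτ)
      · exact ⟨(h6 _ τ hτ).1, ((hB _ _).2 (hcons _)).trans (h6 _ τ hτ).2⟩
      · exact ⟨(h6 _ τ hτ).1, ((hB _ _).2 (hcons _)).trans (h6 _ τ hτ).2⟩
    · rintro s (rfl | hs | hs)
      · obtain ⟨τ, hτ, h⟩ := h7 a _ (h1 a)
        exact ⟨τ, Or.inl hτ, ((hB _ _).2 (hcons _)).trans h⟩
      · obtain ⟨τ, hτ, h⟩ := h7 _ s hs
        exact ⟨τ, Or.inl hτ, h⟩
      · obtain ⟨τ, hτ, h⟩ := h7 _ s hs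
        exact ⟨τ, Or.inr hτ, h⟩
    · intro s hs τ hτ hsτ
      have hs' : s <:+ l ∨ s ∈ T a ∨ s ∈ T a' := by
        rcases hs with (rfl | hs) | hs
        exacts [Or.inl List.suffix_rfl, Or.inr hs, Or.inl hs]
      rcases hs' with hs | hs | hs
      · simp only [hs, if_true]
        rcases hτ with hτ | hτ
        · exact h8 _ s (Or.inr (hs.trans (hcons _))) τ hτ hsτ
        · rw [hsuf s hs]
          exact h8 _ s (Or.inr (hs.trans (hcons _))) τ hτ hsτ
      · simp only [hnsuf _ s hs, hs, if_true, if_false]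
        rcases hτ with hτ | hτ
        · exact h8 _ s (Or.inl hs) τ hτ hsτ
        · exact absurd (h6 _ τ hτ).2 (hinc τ (((hB _ _).2 (h2 _ s hs).1).trans hsτ.1))
      · have hsa : s ∉ T a := fun h => hne s (h2 _ s h).1 (h2 _ s hs).1
        simp only [hnsuf _ s hs, hsa, if_false]
        rcases hτ with hτ | hτ
        · exact absurd (((hB _ _).2 (h2 _ s hs).1).trans hsτ.1) (hinc τ (h6 _ τ hτ).2)
        · exact h8 _ s (Or.inl hs) τ hτ hsτ

end TreeTheorem

namespace TreeTheorem

open Encodable Primrec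

/-- Infinitely branching trees above the strings in `Rt`. -/
structure Forest (W : Set ℕ) (X : Set (List Bool)) (Rt : Finset (List Bool))
    (B : List Bool → List ℕ → List Bool) : Prop where
  re : RE W fun x : Node × List Bool => x.1.1 ∈ Rt ∧ x.2 = B x.1.1 x.1.2
  mem : ∀ ρ ∈ Rt, ∀ l, B ρ l ∈ X
  above : ∀ ρ ∈ Rt, ∀ l, ρ <+: B ρ l
  prefix_iff : ∀ ρ ∈ Rt, ∀ l m, B ρ l <+: B ρ m ↔ l <:+ m

theorem exists_forest {W : Set ℕ} {X : Set (List Bool)} (hX : Perfect X)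
    (hre : RE W fun x => x ∈ X) (Rt : Finset (List Bool)) (hRt : ↑Rt ⊆ X) :
    ∃ B, Forest W X Rt B := by
  have key := fun ρ (hρ : ρ ∈ Rt) => exists_omega_tree hX hre (hRt hρ)
  choose! B h1 h2 h3 h4 using key
  refine ⟨B, ?_, h2, h3, h4⟩
  refine (RE.ex_finset Rt (p := fun ρ (x : Node × List Bool) => x.1.1 = ρ ∧ x.2 = B ρ x.1.2)
    fun ρ hρ => (RE.of_primrec (Primrec.eq.comp (fst.comp fst) (.const ρ)) W).and
      ((h1 ρ hρ).comp (Primrec.pair (snd.comp fst) snd))).of_iff fun x => ?_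
  simp

/-- If every colored subtree contains an extension with a computation of value `b`, then there is
one that is compatible with a reservoir. -/
theorem Forest.exists_computation {W : Set ℕ} {f : List Bool → List Bool → Bool}
    (hf : REColoring W f) {X : Set (List Bool)} (hX : Perfect X) (hre : RE W fun x => x ∈ X)
    {Rt : Finset (List Bool)} (hanti : ∀ a ∈ Rt, ∀ b ∈ Rt, a ≠ b → Incomp a b)
    {B : List Bool → List ℕ → List Bool} (hB : Forest W X Rt B)
    {ι : Type*} {J : Finset ι} {t : ι → Task} (hR : ∀ j ∈ J, (t j).R ⊆ Rt) {x : ℕ × Bool}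
    (hcov : Covers fun s => Invalid Rt s ∨ ∃ j ∈ J, Hit f B (t j) x s) :
    ∃ j ∈ J, ∃ (E : Finset (List Bool)) (Y : Set (List Bool)), Perfect Y ∧
      (RE W fun x => x ∈ Y) ∧ (∀ τ ∈ Y, τ ∈ X ∧ ∃ ρ ∈ (t j).R, ρ <+: τ) ∧
      (∀ σ ∈ E, σ ∈ X ∧ ∃ ρ ∈ (t j).R, ρ <+: σ) ∧ (∀ ρ ∈ (t j).R, ∃ τ ∈ Y, ρ <+: τ) ∧
      (∀ σ ∈ E, ∃ τ ∈ Y, σ <+: τ) ∧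
      (∀ σ ∈ E, ∀ τ ∈ Y, StrictPrefix σ τ → f σ τ = (t j).color) ∧
      Hom f (t j).color ((t j).F ∪ E) ∧ ∃ k, (t j).V (x, res (codes ((t j).F ∪ E)) k) := by
  classical
  obtain ⟨N, hN⟩ := Covers.exists_bound (U := fun _ s => Invalid Rt s ∨
    ∃ j ∈ J, Hit f B (t j) x s) monotone_const (fun P => by simpa using hcov P)
  have key := fun ρ (hρ : ρ ∈ Rt) => exists_true_subtree hf hX hre
    (hB.prefix_iff ρ hρ) (hB.mem ρ hρ) N [] (by simp)
  choose! T c Y h1 h2 h3 h4 h5 h6 h7 h8 using key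
  -- All nodes above level `N` are added so that branching continues beyond the finite subtree.
  -- Their codes exceed `N`, so they cannot occur in a hit found in at most `N` bits.
  let P : Set ℕ := {m | (∃ e : Node, m = 2 * encode e ∧ (e.2 ∈ T e.1 ∨ N < e.2.length)) ∨
    ∃ e : Node, m = 2 * encode e + 1 ∧ c e.1 e.2 = true}
  have hP0 : ∀ e : Node, 2 * encode e ∈ P ↔ e.2 ∈ T e.1 ∨ N < e.2.length := by
    intro e
    constructor
    · rintro (⟨e', he', h⟩ | ⟨e', he', -⟩)
      · rwa [encode_injective (show encode e = encode e' by omega)]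
      · omega
    · exact fun h => Or.inl ⟨e, rfl, h⟩
  have hP1 : ∀ e : Node, 2 * encode e + 1 ∈ P ↔ c e.1 e.2 = true := by
    intro e
    constructor
    · rintro (⟨e', he', -⟩ | ⟨e', he', h⟩)
      · omega
      · rwa [encode_injective (show encode e = encode e' by omega)]
    · exact fun h => Or.inr ⟨e, rfl, h⟩
  obtain ⟨K, hK, hinv | ⟨j, hj, L, hL, hhom, k, hV⟩⟩ := hN P
  · exfalso
    rcases hinv with ⟨ρ, hρ, h⟩ | ⟨e, he, het, h⟩
    · rw [res_getElem?, hP0] at h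
      exact absurd (h.2.2 (Or.inl (h1 ρ hρ))) (by simp)
    · rw [res_getElem?, hP0] at het
      have hch : ∃ a < 2 ^ (e.2.length + 1) + 1, ∃ a' < a,
          ((a :: e.2) ∈ T e.1 ∨ N < (a :: e.2).length) ∧
            ((a' :: e.2) ∈ T e.1 ∨ N < (a' :: e.2).length) := by
        by_cases hlen : e.2.length < N
        · obtain ⟨a, ha, a', ha', hs⟩ := h3 e.1 he e.2
            ((het.2.1 rfl).resolve_right (by omega)) hlen
          exact ⟨a, ha, a', ha', Or.inl hs.1, Or.inl hs.2⟩
        · refine ⟨1, ?_, 0, by omega, Or.inr ?_, Or.inr ?_⟩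
          · have := Nat.one_le_two_pow (n := e.2.length + 1)
            omega
          · simp; omega
          · simp; omega
      obtain ⟨a, ha, a', ha', hs1, hs2⟩ := hch
      rcases h a ha a' ha' with h | h <;> rw [res_getElem?, hP0] at h
      · exact absurd (h.2.2 hs1) (by simp)
      · exact absurd (h.2.2 hs2) (by simp)
  · have hLe : ∀ σ ∈ L, ∃ e : Node, e.1 ∈ (t j).R ∧ σ = B e.1 e.2 ∧ e.2 ∈ T e.1 ∧
        c e.1 e.2 = (t j).color := by
      intro σ hσ
      obtain ⟨e, he, hσe, hb, hc⟩ := hL σ hσ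
      rw [res_getElem?, hP0] at hb
      rw [res_getElem?, hP1, Bool.coe_iff_coe] at hc
      have hlen : e.2.length ≤ encode e :=
        (length_le_encode e.2).trans (Nat.right_le_pair _ _)
      exact ⟨e, he, hσe, (hb.2.1 rfl).resolve_right (by omega), hc.2.symm⟩
    have hset : {σ | σ ∈ (t j).F.toList ++ L} = ((t j).F : Set (List Bool)) ∪ L.toFinset := by
      ext σ
      simp
    rw [hset] at hhom hV
    refine ⟨j, hj, L.toFinset, ⋃ ρ ∈ (((t j).R : Finset (List Bool)) : Set (List Bool)), Y ρ,
      Perfect.biUnion fun ρ hρ => h4 ρ (hR j hj hρ), ?_, ?_, ?_, ?_, ?_, ?_, hhom, k, hV⟩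
    · exact (RE.ex_finset (t j).R fun ρ hρ => h5 ρ (hR j hj hρ)).of_iff fun τ => by simp
    · intro τ hτ
      simp only [Set.mem_iUnion, Finset.mem_coe] at hτ
      obtain ⟨ρ, hρ, hτ⟩ := hτ
      have := h6 ρ (hR j hj hρ) τ hτ
      exact ⟨this.1, ρ, hρ, (hB.above ρ (hR j hj hρ) []).trans this.2⟩
    · intro σ hσ
      obtain ⟨e, he, rfl, -⟩ := hLe σ (List.mem_toFinset.1 hσ)
      exact ⟨hB.mem _ (hR j hj he) _, _, he, hB.above _ (hR j hj he) _⟩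
    · intro ρ hρ
      obtain ⟨τ, hτ, h⟩ := h7 ρ (hR j hj hρ) [] (h1 ρ (hR j hj hρ))
      exact ⟨τ, Set.mem_biUnion hρ hτ, (hB.above ρ (hR j hj hρ) []).trans h⟩
    · intro σ hσ
      obtain ⟨e, he, rfl, heT, -⟩ := hLe σ (List.mem_toFinset.1 hσ)
      obtain ⟨τ, hτ, h⟩ := h7 e.1 (hR j hj he) e.2 heT
      exact ⟨τ, Set.mem_biUnion he hτ, h⟩
    · intro σ hσ τ hτ hστ
      obtain ⟨e, he, rfl, heT, hc⟩ := hLe σ (List.mem_toFinset.1 hσ)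
      simp only [Set.mem_iUnion, Finset.mem_coe] at hτ
      obtain ⟨ρ, hρ, hτ⟩ := hτ
      -- Roots are pairwise incomparable, so a reservoir element above a node belongs to the tree of
      -- that node.
      have hρe : e.1 = ρ := by
        by_contra hne
        refine ((hanti _ (hR j hj he) _ (hR j hj hρ) hne).mono
          ((hB.above _ (hR j hj he) _).trans hστ.1)
          ((hB.above _ (hR j hj hρ) []).trans (h6 ρ (hR j hj hρ) τ hτ).2)).1 List.prefix_rfl
      rw [← hc]
      exact h8 e.1 (hR j hj he) e.2 (Or.inl heT) τ (hρe ▸ hτ) hστ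

/-- If some colored subtree contains no extension with a computation of value `b`, then there is
one above each root that is monochromatic and preserves cone avoidance. -/
theorem Forest.exists_monochromatic {W C : Set ℕ} (hC : ¬ Red C W)
    {f : List Bool → List Bool → Bool} (hf : REColoring W f) {X : Set (List Bool)}
    {Rt : Finset (List Bool)} {B : List Bool → List ℕ → List Bool} (hB : Forest W X Rt B)
    {ι : Type*} {J : Finset ι} {t : ι → Task} (hR : ∀ j ∈ J, (t j).R ⊆ Rt)
    (hV : ∀ j ∈ J, RE W (t j).V) {x : ℕ × Bool}
    (hcov : ¬ Covers fun s => Invalid Rt s ∨ ∃ j ∈ J, Hit f B (t j) x s) :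
    ∃ (W' : Set ℕ) (c : List Bool → Bool) (Y : List Bool → Set (List Bool)), Red W W' ∧
      ¬ Red C W' ∧ (∀ ρ ∈ Rt, Perfect (Y ρ) ∧ (Y ρ).Nonempty ∧ (RE W' fun x => x ∈ Y ρ) ∧
        ∀ τ ∈ Y ρ, τ ∈ X ∧ ρ <+: τ) ∧
      ∀ j ∈ J, ∀ E : Finset (List Bool),
        (∀ σ ∈ E, ∃ ρ ∈ (t j).R, c ρ = (t j).color ∧ σ ∈ Y ρ) →
        Hom f (t j).color ((t j).F ∪ E) → ∀ k, ¬ (t j).V (x, res (codes ((t j).F ∪ E)) k) := by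
  classical
  have hU : RE W fun s => Invalid Rt s ∨ ∃ j ∈ J, Hit f B (t j) x s :=
    (re_invalid W Rt).or (RE.ex_finset J fun j hj =>
      (re_hit hf hB.re (hR j hj) (hV j hj)).comp (Primrec.pair (.const x) .id))
  obtain ⟨P, hP, hPC⟩ := exists_path_avoiding hC hU hcov
  push Not at hP
  have hPr : Red P (join P W) := red_join_left P W
  have hWr : Red W (join P W) := red_join_right P W
  let S : List Bool → Bool → Set (List Bool) := fun ρ b => {σ | ∃ l : List ℕ, σ = B ρ l ∧
    2 * encode ((ρ, l) : Node) ∈ P ∧ (b = true ↔ 2 * encode ((ρ, l) : Node) + 1 ∈ P)}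
  have hSre : ∀ ρ ∈ Rt, ∀ b, RE (join P W) fun σ => σ ∈ S ρ b := by
    intro ρ hρ b
    have hn : Primrec fun z : List Bool × List ℕ => encode ((ρ, z.2) : Node) :=
      Primrec.encode.comp (Primrec.pair (.const ρ) snd)
    refine RE.ex (p := fun (σ : List Bool) (l : List ℕ) => σ = B ρ l ∧
      2 * encode ((ρ, l) : Node) ∈ P ∧ (b = true ↔ 2 * encode ((ρ, l) : Node) + 1 ∈ P)) ?_
    refine ((((hB.re.trans hWr).comp (g := fun z : List Bool × List ℕ => ((ρ, z.2), z.1))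
      (Primrec.pair (Primrec.pair (.const ρ) snd) fst))).and
      ((hPr.1.comp (nat_double.comp hn)).and ((RE.red_iff.1 hPr).comp
        (Primrec.pair (nat_double_succ.comp hn) (.const b))))).of_iff fun z => ?_
    simp [hρ]
  have hroot : ∀ ρ ∈ Rt, 2 * encode ((ρ, []) : Node) ∈ P := by
    intro ρ hρ
    by_contra h
    refine (hP (2 * encode ((ρ, []) : Node) + 1)).1 (Or.inl ⟨ρ, hρ, ?_⟩)
    rw [res_getElem?]
    exact ⟨by omega, iff_of_false Bool.false_ne_true h⟩
  have hbranch : ∀ ρ ∈ Rt, ∀ l : List ℕ, 2 * encode ((ρ, l) : Node) ∈ P → ∃ a a' : ℕ, a ≠ a' ∧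
      2 * encode ((ρ, a :: l) : Node) ∈ P ∧ 2 * encode ((ρ, a' :: l) : Node) ∈ P := by
    intro ρ hρ l hl
    by_contra! hcon
    let M := 2 ^ (l.length + 1) + 1
    -- Long enough to show the bits of the node and of all admissible children; with fewer than two
    -- children present, this initial segment would be `Invalid`.
    let K := (Finset.range M).sup (fun a => 2 * encode ((ρ, a :: l) : Node) + 1) +
      2 * encode ((ρ, l) : Node) + 1
    have hK : ∀ a < M, 2 * encode ((ρ, a :: l) : Node) < K := by
      intro a ha
      have := Finset.le_sup (f := fun a => 2 * encode ((ρ, a :: l) : Node) + 1)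
        (Finset.mem_range.2 ha)
      simp only [K]
      omega
    refine (hP K).1 (Or.inr ⟨(ρ, l), hρ, ?_, fun a ha a' ha' => ?_⟩)
    · rw [res_getElem?]
      exact ⟨by simp only [K]; omega, iff_of_true rfl hl⟩
    · simp only [res_getElem?]
      by_cases h : 2 * encode ((ρ, a :: l) : Node) ∈ P
      · exact Or.inr ⟨hK a' (ha'.trans ha), iff_of_false Bool.false_ne_true (hcon a a' ha'.ne' h)⟩
      · exact Or.inl ⟨hK a ha, iff_of_false Bool.false_ne_true h⟩
  have hST : ∀ ρ l, 2 * encode ((ρ, l) : Node) ∈ P → B ρ l ∈ S ρ true ∪ S ρ false := by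
    intro ρ l hl
    by_cases h : 2 * encode ((ρ, l) : Node) + 1 ∈ P
    · exact Or.inl ⟨l, rfl, hl, iff_of_true rfl h⟩
    · exact Or.inr ⟨l, rfl, hl, iff_of_false Bool.false_ne_true h⟩
  have hperf : ∀ ρ ∈ Rt, Perfect (S ρ true ∪ S ρ false) := by
    intro ρ hρ σ hσ
    obtain ⟨l, rfl, hl⟩ : ∃ l, σ = B ρ l ∧ 2 * encode ((ρ, l) : Node) ∈ P := by
      rcases hσ with ⟨l, rfl, hl, -⟩ | ⟨l, rfl, hl, -⟩ <;> exact ⟨l, rfl, hl⟩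
    obtain ⟨a, a', haa, ha, ha'⟩ := hbranch ρ hρ l hl
    refine ⟨_, hST ρ _ ha, _, hST ρ _ ha', (hB.prefix_iff ρ hρ _ _).2 (List.suffix_cons _ _),
      (hB.prefix_iff ρ hρ _ _).2 (List.suffix_cons _ _), ?_, ?_⟩
    · rw [hB.prefix_iff ρ hρ]
      intro h
      have := h.eq_of_length (by simp)
      simp_all
    · rw [hB.prefix_iff ρ hρ]
      intro h
      have := h.eq_of_length (by simp)
      simp_all
  have hmono : ∀ ρ, ∃ (b : Bool) (Y : Set (List Bool)), ρ ∈ Rt → Y ⊆ S ρ b ∧ Perfect Y ∧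
      Y.Nonempty ∧ RE (join P W) fun x => x ∈ Y := by
    intro ρ
    by_cases hρ : ρ ∈ Rt
    swap
    · exact ⟨true, ∅, fun h => absurd h hρ⟩
    -- Either color true is dense in the subtree above `ρ`, or some cone of the subtree has only
    -- color false.
    by_cases h : ∀ σ ∈ S ρ true ∪ S ρ false, ∃ τ ∈ S ρ true ∪ S ρ false, σ <+: τ ∧ τ ∈ S ρ true
    · refine ⟨true, (S ρ true ∪ S ρ false) ∩ S ρ true, fun _ => ⟨Set.inter_subset_right,
        (hperf ρ hρ).inter_dense fun σ _ _ τ hτ _ => h τ hτ, ?_, ?_⟩⟩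
      · obtain ⟨τ, hτ, -, hτ'⟩ := h _ (hST ρ _ (hroot ρ hρ))
        exact ⟨τ, hτ, hτ'⟩
      · exact ((hSre ρ hρ true).or (hSre ρ hρ false)).and (hSre ρ hρ true)
    · push Not at h
      obtain ⟨σ, hσ, h⟩ := h
      refine ⟨false, (S ρ true ∪ S ρ false) ∩ {τ | σ <+: τ}, fun _ => ⟨?_, (hperf ρ hρ).cone σ,
        ⟨σ, hσ, List.prefix_rfl⟩, RE.cone ((hSre ρ hρ true).or (hSre ρ hρ false)) σ⟩⟩
      intro τ hτ
      exact hτ.1.resolve_left (h τ hτ.1 hτ.2)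
  choose c Y hY using hmono
  refine ⟨join P W, c, Y, hWr, hPC, fun ρ hρ => ⟨(hY ρ hρ).2.1, (hY ρ hρ).2.2.1, (hY ρ hρ).2.2.2,
    fun τ hτ => ?_⟩, fun j hj E hE hhom k hVk => ?_⟩
  · obtain ⟨l, rfl, -⟩ := (hY ρ hρ).1 hτ
    exact ⟨hB.mem ρ hρ l, hB.above ρ hρ l⟩
  · have hnode : ∀ σ, ∃ e : Node, σ ∈ E → e.1 ∈ (t j).R ∧ σ = B e.1 e.2 ∧ 2 * encode e ∈ P ∧
        ((t j).color = true ↔ 2 * encode e + 1 ∈ P) := by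
      intro σ
      by_cases hσ : σ ∈ E
      · obtain ⟨ρ, hρ, hc, hσY⟩ := hE σ hσ
        obtain ⟨l, rfl, h1, h2⟩ := (hY ρ (hR j hj hρ)).1 hσY
        exact ⟨(ρ, l), fun _ => ⟨hρ, rfl, h1, hc ▸ h2⟩⟩
      · exact ⟨([], []), fun h => absurd h hσ⟩
    choose e he using hnode
    -- The summand `2` brings in the color bit, at the position after the membership bit.
    let K := E.sup (fun σ => 2 * encode (e σ)) + 2
    have hset : {σ | σ ∈ (t j).F.toList ++ E.toList} = ((t j).F : Set (List Bool)) ∪ E := by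
      ext σ
      simp
    refine (hP K).2 j hj ⟨E.toList, fun σ hσ => ?_, by rwa [hset], k, by rwa [hset]⟩
    have hσE : σ ∈ E := by simpa using hσ
    have hle := Finset.le_sup (f := fun σ => 2 * encode (e σ)) hσE
    obtain ⟨h1, h2, h3, h4⟩ := he σ hσE
    refine ⟨e σ, h1, h2, ?_, ?_⟩
    · rw [res_getElem?]
      exact ⟨by simp only [K]; omega, iff_of_true rfl h3⟩
    · rw [res_getElem?]
      exact ⟨by simp only [K]; omega, h4⟩

/-- One of the two previous alternatives holds. -/
theorem Forest.dichotomy {W C : Set ℕ} (hC : ¬ Red C W) {f : List Bool → List Bool → Bool}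
    (hf : REColoring W f) {X : Set (List Bool)} {Rt : Finset (List Bool)}
    {B : List Bool → List ℕ → List Bool} (hB : Forest W X Rt B)
    {ι : Type*} {J : Finset ι} {t : ι → Task} (hR : ∀ j ∈ J, (t j).R ⊆ Rt)
    (hV : ∀ j ∈ J, RE W (t j).V) :
    ∃ n b, (¬ (b = true ↔ n ∈ C) ∧
        Covers fun s => Invalid Rt s ∨ ∃ j ∈ J, Hit f B (t j) (n, b) s) ∨
      ((b = true ↔ n ∈ C) ∧
        ¬ Covers fun s => Invalid Rt s ∨ ∃ j ∈ J, Hit f B (t j) (n, b) s) := by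
  by_contra hcon
  -- If neither alternative ever occurred, this Σ₁ relation would be the graph of `C`.
  have hQ : RE W fun x : ℕ × Bool =>
      Covers fun s => Invalid Rt s ∨ ∃ j ∈ J, Hit f B (t j) x s :=
    RE.covers (U := fun (x : ℕ × Bool) s => Invalid Rt s ∨ ∃ j ∈ J, Hit f B (t j) x s)
      (((re_invalid W Rt).comp snd).or (RE.ex_finset J (p := fun j (y : (ℕ × Bool) × List Bool) =>
        Hit f B (t j) y.1 y.2) fun j hj => re_hit hf hB.re (hR j hj) (hV j hj)))
  refine hC (red_of_re_value hQ fun n b => ⟨fun h => ?_, fun hb => ?_⟩)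
  · by_contra hb
    exact hcon ⟨n, b, Or.inl ⟨hb, h⟩⟩
  · by_contra h
    exact hcon ⟨n, b, Or.inr ⟨hb, h⟩⟩

end TreeTheorem

namespace TreeTheorem

open Encodable Primrec

/-! ### Cone avoidance of the tree theorem for pairs -/

/-- No extension of the condition `p` meets `V`. -/
def Blocked (f : List Bool → List Bool → Bool) (C Z : Set ℕ) (i : Bool) (p : PreCond)
    (V : (ℕ × Bool) × List Bool → Prop) : Prop :=
  ∀ q, Cond f C Z i q → Extends q p → ¬ Meets f C i q V

/-- Conditions found one after another in different cones can thus be brought to the last, strongest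
oracle. -/
theorem Cond.mono {f : List Bool → List Bool → Bool} {C Z : Set ℕ} {i : Bool} {p : PreCond}
    (hp : Cond f C Z i p) {W : Set ℕ} (hW : Red p.W W) (hC : ¬ Red C W) :
    Cond f C Z i ⟨p.F, p.X, W⟩ :=
  { hp with re := hp.re.trans hW, avoid := hC, base := hp.base.trans hW }

theorem Blocked.mono {f : List Bool → List Bool → Bool} {C Z : Set ℕ} {i : Bool} {p : PreCond}
    {V : (ℕ × Bool) × List Bool → Prop} (h : Blocked f C Z i p V) {W : Set ℕ} (hW : Red p.W W) :
    Blocked f C Z i ⟨p.F, p.X, W⟩ V :=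
  fun q hq hqp => h q hq (hqp.trans ⟨le_rfl, fun _ h => Or.inl h, le_rfl, hW⟩)

theorem REColoring.mono {f : List Bool → List Bool → Bool} {Z W : Set ℕ} (hf : REColoring Z f)
    (h : Red Z W) : REColoring W f := RE.trans hf h

/-- Below a blocked condition for color `true`, blocked conditions for color `false` in finitely
many cones can be found with a common oracle. -/
theorem exists_blocked_family {f : List Bool → List Bool → Bool} {C Z W₁ : Set ℕ}
    {X : Set (List Bool)} (hX : Perfect X) (hre : RE W₁ fun x => x ∈ X) (hC : ¬ Red C W₁)
    (hZ : Red Z W₁)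
    (h : ∀ p, Cond f C Z false p → ∃ V q, RE Z V ∧ Cond f C Z false q ∧ Extends q p ∧
      Blocked f C Z false q V) (A : Finset (List Bool)) (hA : ↑A ⊆ X) :
    ∃ W, Red W₁ W ∧ ¬ Red C W ∧ ∀ a ∈ A, ∃ F Y V, RE Z V ∧ Cond f C Z false ⟨F, Y, W⟩ ∧
      Y ⊆ X ∩ {τ | a <+: τ} ∧ Blocked f C Z false ⟨F, Y, W⟩ V := by
  classical
  induction A using Finset.induction_on with
  | empty => exact ⟨W₁, Red.refl _, hC, by simp⟩
  | insert a A _ ih =>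
    obtain ⟨W, hW, hCW, hAW⟩ := ih fun b hb => hA (Finset.mem_coe.2 (Finset.mem_insert_of_mem hb))
    obtain ⟨V, q, hV, hq, hqp, hb⟩ := h ⟨∅, X ∩ {τ | a <+: τ}, W⟩
      ⟨fun _ h => by simp at h, hX.cone a, ⟨a, hA (by simp), List.prefix_rfl⟩,
        (hre.trans hW).cone a, hCW, hZ.trans hW, by simp, by simp, by simp⟩
    refine ⟨q.W, hW.trans hqp.orc, hq.avoid, fun b hb' => ?_⟩
    rcases Finset.mem_insert.1 hb' with rfl | hb'
    · exact ⟨q.F, q.X, V, hV, hq, hqp.res, hb⟩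
    · obtain ⟨F, Y, V', hV', hc, hY, hbl⟩ := hAW b hb'
      exact ⟨F, Y, V', hV', hc.mono hqp.orc hq.avoid, hY, hbl.mono hqp.orc⟩

theorem exists_perfect_homogeneous {f : List Bool → List Bool → Bool} {C Z : Set ℕ}
    (hC : ¬ Red C Z) (hf : REColoring Z f) :
    ∃ (i : Bool) (G : Set (List Bool)), Perfect G ∧ G.Nonempty ∧ Hom f i G ∧
      ¬ Red C (join (codes G) Z) := by
  classical
  by_contra hno
  -- Otherwise every operator could be met below `p`, and a generic set of color `i` would exist.
  have hblock : ∀ i p, Cond f C Z i p → ∃ V q, RE Z V ∧ Cond f C Z i q ∧ Extends q p ∧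
      Blocked f C Z i q V := by
    intro i p hp
    by_contra hcon
    refine hno ⟨i, exists_generic hp fun V hV q hq hqp => ?_⟩
    by_contra hq'
    exact hcon ⟨V, q, hV, hq, hqp, fun r hr hrq hm => hq' ⟨r, hr, hrq, hm⟩⟩
  have huniv : Perfect (Set.univ : Set (List Bool)) := fun x _ =>
    ⟨x ++ [false], trivial, x ++ [true], trivial, List.prefix_append _ _, List.prefix_append _ _,
      by simp [Incomp, List.prefix_append_right_inj]⟩
  obtain ⟨V₁, p, hV₁, hp, -, hpb⟩ := hblock true ⟨∅, Set.univ, Z⟩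
    ⟨fun _ h => by simp at h, huniv, ⟨[], trivial⟩, RE.const Z True, hC, Red.refl Z, by simp,
      by simp, by simp⟩
  -- The empty string is included only to make `A` nonempty; for the same reason `a` is included in
  -- the choice of `R a` below.
  obtain ⟨A, hAX, hA, hAF⟩ := exists_antichain (X := p.X) (insert [] p.F) (by
    intro σ hσ
    rcases Finset.mem_insert.1 hσ with rfl | hσ
    · exact hp.nonempty.imp fun τ hτ => ⟨hτ, List.nil_prefix⟩
    · exact hp.ext σ hσ)
  obtain ⟨W, hpW, hCW, hfam⟩ := exists_blocked_family hp.perfect hp.re hp.avoid hp.base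
    (hblock false) A hAX
  choose! F Y V hV hq hYX hqb using hfam
  have hanti := fun a (ha : a ∈ A) => exists_antichain (X := Y a) (insert a (F a)) (by
    intro σ hσ
    rcases Finset.mem_insert.1 hσ with rfl | hσ
    · exact (hq _ ha).nonempty.imp fun τ hτ => ⟨hτ, (hYX _ ha hτ).2⟩
    · exact (hq a ha).ext σ hσ)
  choose! R hRY hR hRF using hanti
  let X : Set (List Bool) := ⋃ a ∈ (A : Set (List Bool)), Y a
  have hXmem : ∀ τ, τ ∈ X ↔ ∃ a ∈ A, τ ∈ Y a := fun τ => by simp [X]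
  have hXp : X ⊆ p.X := fun τ hτ => by
    obtain ⟨a, ha, h⟩ := (hXmem τ).1 hτ
    exact (hYX a ha h).1
  have hX : Perfect X := Perfect.biUnion fun a ha => (hq a ha).perfect
  have hXre : RE W fun x => x ∈ X :=
    (RE.ex_finset A fun a ha => (hq a ha).re).of_iff hXmem
  let Rt := A.biUnion R
  have hRtmem : ∀ ρ, ρ ∈ Rt ↔ ∃ a ∈ A, ρ ∈ R a := fun ρ => Finset.mem_biUnion
  have hRa : ∀ a ∈ A, ∀ ρ ∈ R a, a <+: ρ := fun a ha ρ hρ => (hYX a ha (hRY a ha hρ)).2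
  have hRtX : ↑Rt ⊆ X := fun ρ hρ => by
    obtain ⟨a, ha, h⟩ := (hRtmem ρ).1 hρ
    exact (hXmem ρ).2 ⟨a, ha, hRY a ha h⟩
  have hRtanti : ∀ a ∈ Rt, ∀ b ∈ Rt, a ≠ b → Incomp a b := by
    intro ρ hρ ρ' hρ' hne
    obtain ⟨a, ha, h⟩ := (hRtmem ρ).1 hρ
    obtain ⟨b, hb, h'⟩ := (hRtmem ρ').1 hρ'
    by_cases hab : a = b
    · subst hab
      exact hR a ha ρ h ρ' h' hne
    · exact (hA a ha b hb hab).mono (hRa a ha ρ h) (hRa b hb ρ' h')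
  -- elements of the reservoir above a root in `R a` belong to `Y a`
  have hloc : ∀ a ∈ A, ∀ τ ∈ X, (∃ ρ ∈ R a, ρ <+: τ) → τ ∈ Y a := by
    rintro a ha τ hτ ⟨ρ, hρ, hρτ⟩
    obtain ⟨b, hb, h⟩ := (hXmem τ).1 hτ
    by_cases hab : a = b
    · rwa [hab]
    · exact absurd List.prefix_rfl ((hA a ha b hb hab).mono ((hRa a ha ρ hρ).trans hρτ)
        (hYX b hb h).2).1
  obtain ⟨B, hB⟩ := exists_forest hX hXre Rt hRtX
  -- One task of color true for `p`, ranging over all roots, and one task of color false for each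
  -- `a`, confined to the roots above `a`.
  let t : Option (List Bool) → Task := fun j => match j with
    | none => ⟨true, p.F, V₁, Rt⟩
    | some a => ⟨false, F a, V a, R a⟩
  let J : Finset (Option (List Bool)) := Finset.insertNone A
  have htR : ∀ j ∈ J, (t j).R ⊆ Rt := by
    rintro (_ | a) hj
    · exact le_rfl
    · exact fun ρ hρ => (hRtmem ρ).2 ⟨a, Finset.some_mem_insertNone.1 hj, hρ⟩
  have hZW : Red Z W := hp.base.trans hpW
  have htV : ∀ j ∈ J, RE W (t j).V := by
    rintro (_ | a) hj
    · exact hV₁.trans hZW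
    · exact (hV a (Finset.some_mem_insertNone.1 hj)).trans hZW
  have hfW := hf.mono hZW
  -- every element of the stem of `p` has a root above it
  have hstem : ∀ σ ∈ p.F, ∃ a ∈ A, σ <+: a := fun σ hσ => hAF σ (Finset.mem_insert_of_mem hσ)
  have hstem' : ∀ a ∈ A, ∀ σ ∈ F a, ∃ ρ ∈ R a, σ <+: ρ := fun a ha σ hσ =>
    hRF a ha σ (Finset.mem_insert_of_mem hσ)
  have hRne : ∀ a ∈ A, ∃ ρ ∈ R a, a <+: ρ := fun a ha => hRF a ha a (Finset.mem_insert_self _ _)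
  obtain ⟨a₀, ha₀, -⟩ := hAF [] (Finset.mem_insert_self _ _)
  obtain ⟨n, b, ⟨hnb, hcov⟩ | ⟨hnb, hcov⟩⟩ := hB.dichotomy hCW hfW htR htV
  · obtain ⟨j, hj, E, Y', hY', hY're, hY'mem, hEmem, hRext, hEext, hcol, hhom, k, hk⟩ :=
      hB.exists_computation hfW hX hXre hRtanti htR hcov
    rcases j with _ | a
    · obtain ⟨ρ₀, hρ₀, -⟩ := hRne a₀ ha₀
      obtain ⟨q, hq1, hq2, hq3⟩ := hp.exists_meets_of_computation hpW hCW hY'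
        ((hRext ρ₀ ((hRtmem _).2 ⟨a₀, ha₀, hρ₀⟩)).imp fun _ h => h.1) hY're
        (fun τ hτ => hXp (hY'mem τ hτ).1) (fun σ hσ => hXp (hEmem σ hσ).1) (by
          intro σ hσ
          obtain ⟨a, ha, hσa⟩ := hstem σ hσ
          obtain ⟨ρ, hρ, haρ⟩ := hRne a ha
          obtain ⟨τ, hτ, hρτ⟩ := hRext ρ ((hRtmem _).2 ⟨a, ha, hρ⟩)
          exact ⟨τ, hτ, hσa.trans (haρ.trans hρτ)⟩) hEext hcol hhom hnb hk
      exact hpb q hq1 hq2 hq3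
    · have ha : a ∈ A := Finset.some_mem_insertNone.1 hj
      obtain ⟨ρ₀, hρ₀, -⟩ := hRne a ha
      obtain ⟨q, hq1, hq2, hq3⟩ := (hq a ha).exists_meets_of_computation (Red.refl W) hCW hY'
        ((hRext ρ₀ hρ₀).imp fun _ h => h.1) hY're
        (fun τ hτ => hloc a ha τ (hY'mem τ hτ).1 (hY'mem τ hτ).2)
        (fun σ hσ => hloc a ha σ (hEmem σ hσ).1 (hEmem σ hσ).2) (by
          intro σ hσ
          obtain ⟨ρ, hρ, hσρ⟩ := hstem' a ha σ hσ
          obtain ⟨τ, hτ, hρτ⟩ := hRext ρ hρ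
          exact ⟨τ, hτ, hσρ.trans hρτ⟩) hEext hcol hhom hnb hk
      exact hqb a ha q hq1 hq2 hq3
  · obtain ⟨W', c, Y', hWW', hCW', hY', hE⟩ := hB.exists_monochromatic hCW hfW htR htV hcov
    -- A reservoir for `p` must reach above every stem element, for which one true root above each
    -- `a` suffices. A reservoir for the condition at `a` must cover all of `R a`, which is exactly
    -- what the negation provides in color false.
    by_cases hc : ∀ a ∈ A, ∃ ρ ∈ R a, c ρ = true
    · let S := Rt.filter fun ρ => c ρ = true
      have hSRt : ∀ ρ ∈ (S : Set (List Bool)), ρ ∈ Rt := fun ρ hρ => (Finset.mem_filter.1 hρ).1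
      have hmem : ∀ τ, τ ∈ (⋃ ρ ∈ (S : Set (List Bool)), Y' ρ) ↔ ∃ ρ ∈ S, τ ∈ Y' ρ :=
        fun τ => by simp
      have hex : ∀ a ∈ A, ∃ τ ∈ ⋃ ρ ∈ (S : Set (List Bool)), Y' ρ, a <+: τ := by
        intro a ha
        obtain ⟨ρ, hρ, hcρ⟩ := hc a ha
        have hρRt := (hRtmem _).2 ⟨a, ha, hρ⟩
        obtain ⟨τ, hτ⟩ := (hY' ρ hρRt).2.1
        exact ⟨τ, (hmem τ).2 ⟨ρ, Finset.mem_filter.2 ⟨hρRt, hcρ⟩, hτ⟩,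
          (hRa a ha ρ hρ).trans ((hY' ρ hρRt).2.2.2 τ hτ).2⟩
      obtain ⟨q, hq1, hq2, hq3⟩ := hp.exists_meets_of_divergence (hpW.trans hWW') hCW'
        (Perfect.biUnion fun ρ hρ => (hY' ρ (hSRt ρ hρ)).1) ((hex a₀ ha₀).imp fun _ h => h.1)
        ((RE.ex_finset S fun ρ hρ => (hY' ρ (hSRt ρ hρ)).2.2.1).of_iff hmem) (by
          intro τ hτ
          obtain ⟨ρ, hρ, h⟩ := (hmem τ).1 hτ
          exact hXp ((hY' ρ (hSRt ρ hρ)).2.2.2 τ h).1) (by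
          intro σ hσ
          obtain ⟨a, ha, hσa⟩ := hstem σ hσ
          obtain ⟨τ, hτ, h⟩ := hex a ha
          exact ⟨τ, hτ, hσa.trans h⟩) hnb (by
          intro E hEY
          refine hE none (Finset.none_mem_insertNone) E fun σ hσ => ?_
          obtain ⟨ρ, hρ, h⟩ := (hmem σ).1 (hEY hσ)
          exact ⟨ρ, hSRt ρ hρ, (Finset.mem_filter.1 hρ).2, h⟩)
      exact hpb q hq1 hq2 hq3
    · push Not at hc
      obtain ⟨a, ha, hc⟩ := hc
      have hRRt : ∀ ρ ∈ ((R a : Finset (List Bool)) : Set (List Bool)), ρ ∈ Rt :=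
        fun ρ hρ => (hRtmem ρ).2 ⟨a, ha, hρ⟩
      have hmem : ∀ τ, τ ∈ (⋃ ρ ∈ ((R a : Finset (List Bool)) : Set (List Bool)), Y' ρ) ↔
        ∃ ρ ∈ R a, τ ∈ Y' ρ := fun τ => by simp
      have hex : ∀ ρ ∈ R a, ∃ τ ∈ ⋃ ρ ∈ ((R a : Finset (List Bool)) : Set (List Bool)), Y' ρ,
          ρ <+: τ := by
        intro ρ hρ
        obtain ⟨τ, hτ⟩ := (hY' ρ (hRRt ρ hρ)).2.1
        exact ⟨τ, (hmem τ).2 ⟨ρ, hρ, hτ⟩, ((hY' ρ (hRRt ρ hρ)).2.2.2 τ hτ).2⟩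
      obtain ⟨ρ₀, hρ₀, -⟩ := hRne a ha
      obtain ⟨q, hq1, hq2, hq3⟩ := (hq a ha).exists_meets_of_divergence hWW' hCW'
        (Perfect.biUnion fun ρ hρ => (hY' ρ (hRRt ρ hρ)).1) ((hex ρ₀ hρ₀).imp fun _ h => h.1)
        ((RE.ex_finset (R a) fun ρ hρ => (hY' ρ (hRRt ρ hρ)).2.2.1).of_iff hmem) (by
          intro τ hτ
          obtain ⟨ρ, hρ, h⟩ := (hmem τ).1 hτ
          have := (hY' ρ (hRRt ρ hρ)).2.2.2 τ h
          exact hloc a ha τ this.1 ⟨ρ, hρ, this.2⟩) (by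
          intro σ hσ
          obtain ⟨ρ, hρ, hσρ⟩ := hstem' a ha σ hσ
          obtain ⟨τ, hτ, h⟩ := hex ρ hρ
          exact ⟨τ, hτ, hσρ.trans h⟩) hnb (by
          intro E hEY
          refine hE (some a) (Finset.some_mem_insertNone.2 ha) E fun σ hσ => ?_
          obtain ⟨ρ, hρ, h⟩ := (hmem σ).1 (hEY hσ)
          exact ⟨ρ, hρ, Bool.eq_false_iff.2 (hc ρ hρ), h⟩)
      exact hqb a ha q hq1 hq2 hq3

/-- The tree is found inside a perfect homogeneous `G` and is computable from `G ⊕ Z`, so both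
homogeneity and avoidance are inherited. -/
theorem exists_homogeneous_tree {f : List Bool → List Bool → Bool} {C Z : Set ℕ}
    (hC : ¬ Red C Z) (hf : REColoring Z f) :
    ∃ (i : Bool) (H : Set (List Bool)), IsoFullTree H ∧ Hom f i H ∧
      ¬ Red C (join (codes H) Z) := by
  obtain ⟨i, G, hG, hne, hhom, hGC⟩ := exists_perfect_homogeneous hC hf
  obtain ⟨H, hHG, hH, hred⟩ := exists_isoFullTree (W := join (codes G) Z) hG hne
    (((red_join_left _ _).1.comp Primrec.encode).of_iff fun σ => encode_mem_codes.symm)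
  exact ⟨i, H, hH, hhom.mono hHG, fun h =>
    hGC (h.trans (hred.join (red_join_right _ _)))⟩

theorem Coloring.ComputableFrom.re {f : Coloring} {Z : Set ℕ} (hf : f.ComputableFrom Z) :
    RE Z fun x : (List Bool × List Bool) × Bool =>
      ∃ h : StrictPrefix x.1.1 x.1.2, f ⟨x.1, h⟩ = x.2 := by
  refine ((re_graph_of_recursiveIn hf).comp
    (g := fun x : (List Bool × List Bool) × Bool => (encode x.1, encode x.2))
    (Primrec.pair (Primrec.encode.comp fst) (Primrec.encode.comp snd))).of_iff fun x => ?_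
  simp only [encodek, Part.coe_some, Part.bind_some, Part.mem_map_iff]
  constructor
  · rintro ⟨h, hx⟩
    exact ⟨x.2, ⟨h, hx⟩, rfl⟩
  · rintro ⟨b, ⟨h, hx⟩, hb⟩
    exact ⟨h, hx.trans (encode_injective hb)⟩

theorem coneAvoidance {Z C : Set ℕ} (hC : ¬ SetReducible C Z) {f : Coloring}
    (hf : f.ComputableFrom Z) :
    ∃ H : Set (List Bool), IsoFullTree H ∧ f.Homogeneous H ∧
      ¬ SetReducible C (join (codes H) Z) := by
  classical
  rw [setReducible_iff_red] at hC
  obtain ⟨i, H, hH, hhom, hHC⟩ := exists_homogeneous_tree (C := C) (Z := Z)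
    -- The value off comparable pairs is arbitrary; `REColoring` and `Hom` only look at proper
    -- initial segments.
    (f := fun σ τ => if h : StrictPrefix σ τ then f ⟨(σ, τ), h⟩ else false) hC
    (hf.re.of_iff fun x => by
      constructor
      · rintro ⟨h, hx⟩
        exact ⟨h, by simpa [h] using hx⟩
      · rintro ⟨h, hx⟩
        exact ⟨h, by simpa [h] using hx⟩)
  refine ⟨H, hH, ⟨i, fun σ hσ τ hτ h => ?_⟩, fun h => hHC h.red⟩
  simpa [h] using hhom σ hσ τ hτ h

end TreeTheorem

/-! ### Satisfaction in ω-models and soundness of the calculus -/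

namespace TreeTheorem

/-- The value of a term in the standard model. -/
def Term.eval (ρ : ℕ → ℕ) : Term → ℕ
  | .var n => ρ n
  | .zero => 0
  | .one => 1
  | .add s t => s.eval ρ + t.eval ρ
  | .mul s t => s.eval ρ * t.eval ρ

/-- The environment in which variable `0` has value `a` and the other variables are shifted. -/
def push {α : Type*} (a : α) (ρ : ℕ → α) : ℕ → α
  | 0 => a
  | n + 1 => ρ n

@[simp] theorem push_zero {α : Type*} (a : α) (ρ : ℕ → α) : push a ρ 0 = a := rfl

@[simp] theorem push_succ {α : Type*} (a : α) (ρ : ℕ → α) (n : ℕ) : push a ρ (n + 1) = ρ n := rfl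

@[simp] theorem push_one {α : Type*} (a : α) (ρ : ℕ → α) : push a ρ 1 = ρ 0 := rfl

@[simp] theorem push_two {α : Type*} (a : α) (ρ : ℕ → α) : push a ρ 2 = ρ 1 := rfl

@[simp] theorem push_three {α : Type*} (a : α) (ρ : ℕ → α) : push a ρ 3 = ρ 2 := rfl

/-- Satisfaction in the `ω`-model with second-order part `M`. -/
def Formula.Sat (M : Set (Set ℕ)) : Formula → (ℕ → ℕ) → (ℕ → Set ℕ) → Prop
  | .eq s t, ρ, _ => s.eval ρ = t.eval ρ
  | .lt s t, ρ, _ => s.eval ρ < t.eval ρ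
  | .mem t X, ρ, S => t.eval ρ ∈ S X
  | .bot, _, _ => False
  | .imp φ ψ, ρ, S => φ.Sat M ρ S → ψ.Sat M ρ S
  | .allN φ, ρ, S => ∀ n, φ.Sat M (push n ρ) S
  | .allS φ, ρ, S => ∀ X ∈ M, φ.Sat M ρ (push X S)

namespace Term

variable (ρ : ℕ → ℕ)

@[simp] theorem eval_var (n : ℕ) : (var n).eval ρ = ρ n := rfl

@[simp] theorem eval_zero : zero.eval ρ = 0 := rfl

@[simp] theorem eval_one : one.eval ρ = 1 := rfl

@[simp] theorem eval_add (s t : Term) : (add s t).eval ρ = s.eval ρ + t.eval ρ := rfl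

@[simp] theorem eval_mul (s t : Term) : (mul s t).eval ρ = s.eval ρ * t.eval ρ := rfl

@[simp] theorem eval_two : two.eval ρ = 2 := rfl

theorem eval_subst (σ : ℕ → Term) (t : Term) :
    (t.subst σ).eval ρ = t.eval fun n => (σ n).eval ρ := by
  induction t with
  | var n => rfl
  | zero => rfl
  | one => rfl
  | add s t hs ht => simp [subst, hs, ht]
  | mul s t hs ht => simp [subst, hs, ht]

@[simp] theorem eval_up (a : ℕ) (t : Term) : t.up.eval (push a ρ) = t.eval ρ := by
  simp [up, eval_subst]

theorem eval_liftSubst (a : ℕ) (σ : ℕ → Term) :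
    (fun n => (liftSubst σ n).eval (push a ρ)) = push a fun n => (σ n).eval ρ := by
  funext n
  cases n <;> simp [liftSubst]

end Term

namespace Formula

variable {M : Set (Set ℕ)} {ρ : ℕ → ℕ} {S : ℕ → Set ℕ} {φ ψ : Formula}

@[simp] theorem sat_eq {s t : Term} : (eq s t).Sat M ρ S ↔ s.eval ρ = t.eval ρ := Iff.rfl

@[simp] theorem sat_lt {s t : Term} : (lt s t).Sat M ρ S ↔ s.eval ρ < t.eval ρ := Iff.rfl

@[simp] theorem sat_mem {t : Term} {X : ℕ} : (mem t X).Sat M ρ S ↔ t.eval ρ ∈ S X := Iff.rfl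

@[simp] theorem sat_bot : bot.Sat M ρ S ↔ False := Iff.rfl

@[simp] theorem sat_imp : (imp φ ψ).Sat M ρ S ↔ (φ.Sat M ρ S → ψ.Sat M ρ S) := Iff.rfl

@[simp] theorem sat_allN : (allN φ).Sat M ρ S ↔ ∀ n, φ.Sat M (push n ρ) S := Iff.rfl

@[simp] theorem sat_allS : (allS φ).Sat M ρ S ↔ ∀ X ∈ M, φ.Sat M ρ (push X S) := Iff.rfl

@[simp] theorem sat_neg : φ.neg.Sat M ρ S ↔ ¬ φ.Sat M ρ S := Iff.rfl

@[simp] theorem sat_and : (φ.and ψ).Sat M ρ S ↔ φ.Sat M ρ S ∧ ψ.Sat M ρ S := by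
  simp [Formula.and]

@[simp] theorem sat_or : (φ.or ψ).Sat M ρ S ↔ φ.Sat M ρ S ∨ ψ.Sat M ρ S := by
  simp [Formula.or, or_iff_not_imp_left]

@[simp] theorem sat_iff : (φ.iff ψ).Sat M ρ S ↔ (φ.Sat M ρ S ↔ ψ.Sat M ρ S) := by
  simp [Formula.iff, iff_iff_implies_and_implies]

@[simp] theorem sat_exN : (exN φ).Sat M ρ S ↔ ∃ n, φ.Sat M (push n ρ) S := by
  simp [exN]

@[simp] theorem sat_exS : (exS φ).Sat M ρ S ↔ ∃ X ∈ M, φ.Sat M ρ (push X S) := by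
  simp [exS]

@[simp] theorem sat_ballN {t : Term} :
    (ballN t φ).Sat M ρ S ↔ ∀ n < t.eval ρ, φ.Sat M (push n ρ) S := by
  simp [ballN]

@[simp] theorem sat_bexN {t : Term} :
    (bexN t φ).Sat M ρ S ↔ ∃ n < t.eval ρ, φ.Sat M (push n ρ) S := by
  simp [bexN]

theorem sat_subst (φ : Formula) (σ : ℕ → Term) (r : ℕ → ℕ) (ρ : ℕ → ℕ) (S : ℕ → Set ℕ) :
    (φ.subst σ r).Sat M ρ S ↔ φ.Sat M (fun n => (σ n).eval ρ) fun n => S (r n) := by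
  induction φ generalizing σ r ρ S with
  | eq s t => simp [subst, Term.eval_subst]
  | lt s t => simp [subst, Term.eval_subst]
  | mem t X => simp [subst, Term.eval_subst]
  | bot => simp [subst]
  | imp φ ψ hφ hψ => simp [subst, hφ, hψ]
  | allN φ h => simp [subst, h, Term.eval_liftSubst]
  | allS φ h =>
    have (X : Set ℕ) : (fun n => push X S (liftRen r n)) = push X fun n => S (r n) := by
      funext n
      cases n <;> rfl
    simp [subst, h, this]

@[simp] theorem sat_instN {t : Term} : (φ.instN t).Sat M ρ S ↔ φ.Sat M (push (t.eval ρ) ρ) S := by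
  rw [instN, sat_subst]
  exact iff_of_eq (congrArg (φ.Sat M · S) (funext fun n => by cases n <;> rfl))

@[simp] theorem sat_instS {X : ℕ} : (φ.instS X).Sat M ρ S ↔ φ.Sat M ρ (push (S X) S) := by
  rw [instS, sat_subst]
  exact iff_of_eq (congrArg (φ.Sat M ρ) (funext fun n => by cases n <;> rfl))

@[simp] theorem sat_succN {n : ℕ} : φ.succN.Sat M (push n ρ) S ↔ φ.Sat M (push (n + 1) ρ) S := by
  rw [succN, sat_subst]
  exact iff_of_eq (congrArg (φ.Sat M · S) (funext fun n => by cases n <;> rfl))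

@[simp] theorem sat_upN {n : ℕ} : φ.upN.Sat M (push n ρ) S ↔ φ.Sat M ρ S := by
  rw [upN, sat_subst]
  rfl

@[simp] theorem sat_upS {X : Set ℕ} : φ.upS.Sat M ρ (push X S) ↔ φ.Sat M ρ S := by
  rw [upS, sat_subst]
  rfl

end Formula

/-- Soundness for `ω`-models. -/
theorem Provable.sat {T : Formula → Prop} {M : Set (Set ℕ)}
    (hT : ∀ φ, T φ → ∀ ρ S, (∀ n, S n ∈ M) → φ.Sat M ρ S) {φ : Formula} (h : Provable T φ)
    (ρ : ℕ → ℕ) (S : ℕ → Set ℕ) (hS : ∀ n, S n ∈ M) : φ.Sat M ρ S := by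
  induction h generalizing ρ S with
  | ax h => exact hT _ h ρ S hS
  | mp _ _ h1 h2 => exact h1 ρ S hS (h2 ρ S hS)
  | genN _ h => exact fun n => h _ S hS
  | genS _ h => exact fun X hX => h ρ _ fun n => by cases n <;> simp [hX, hS]
  | weaken φ ψ => exact fun h _ => h
  | distrib φ ψ χ => exact fun h h' h'' => h h'' (h' h'')
  | dne φ => exact fun h => not_not.1 h
  | elimN φ t => exact fun h => Formula.sat_instN.2 (h _)
  | elimS φ X => exact fun h => Formula.sat_instS.2 (h _ (hS X))
  | distribN φ ψ => exact fun h h' n => h n (Formula.sat_upN.2 h')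
  | distribS φ ψ => exact fun h h' X hX => h X hX (Formula.sat_upS.2 h')
  | eqRefl t => exact rfl
  | eqSubst φ s t =>
    intro h h'
    rw [Formula.sat_instN] at h' ⊢
    rwa [← Formula.sat_eq.1 h]

end TreeTheorem

/-! ### Turing ideals as ω-models of RCA₀ -/

namespace TreeTheorem

open Encodable Primrec

/-- A nonempty collection of sets closed under joins and downward under reducibility. -/
structure IsTuringIdeal (M : Set (Set ℕ)) : Prop where
  nonempty : M.Nonempty
  red : ∀ {A B}, Red A B → B ∈ M → A ∈ M
  join : ∀ {A B}, A ∈ M → B ∈ M → join A B ∈ M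

namespace Formula

theorem primrec_eval {α : Type} [Primcodable α] {g : α → ℕ → ℕ} (hg : ∀ i, Primrec fun a => g a i)
    (t : Term) : Primrec fun a => t.eval (g a) := by
  induction t with
  | var n => exact hg n
  | zero => exact .const 0
  | one => exact .const 1
  | add s t hs ht => exact nat_add.comp hs ht
  | mul s t hs ht => exact nat_mul.comp hs ht

theorem primrec_push {α : Type} [Primcodable α] {g : α → ℕ → ℕ} (hg : ∀ i, Primrec fun a => g a i)
    (i : ℕ) : Primrec fun x : α × ℕ => push x.2 (g x.1) i := by
  cases i with
  | zero => exact snd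
  | succ n => exact (hg n).comp fst

/-- Bounded formulas with parameters from an ideal are decidable in an element of the ideal. -/
theorem IsBounded.exists_re {M : Set (Set ℕ)} (hM : IsTuringIdeal M) {θ : Formula}
    (hθ : θ.IsBounded) {S : ℕ → Set ℕ} (hS : ∀ n, S n ∈ M) :
    ∃ W ∈ M, ∀ V, Red W V → ∀ {α : Type} [Primcodable α] (g : α → ℕ → ℕ),
      (∀ i, Primrec fun a => g a i) →
        (RE V fun a => θ.Sat M (g a) S) ∧ RE V fun a => ¬ θ.Sat M (g a) S := by
  -- Allowing every `V` above `W` lets the two sides of an implication meet over a join; allowing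
  -- every primitive recursive environment `g` lets a bounded quantifier add a variable.
  induction hθ with
  | eq s t =>
    obtain ⟨W, hW⟩ := hM.nonempty
    refine ⟨W, hW, fun V _ α _ g hg => ?_⟩
    have := Primrec.eq.comp (primrec_eval hg s) (primrec_eval hg t)
    exact ⟨RE.of_primrec this V, RE.of_primrec this.not V⟩
  | lt s t =>
    obtain ⟨W, hW⟩ := hM.nonempty
    refine ⟨W, hW, fun V _ α _ g hg => ?_⟩
    have := nat_lt.comp (primrec_eval hg s) (primrec_eval hg t)
    exact ⟨RE.of_primrec this V, RE.of_primrec this.not V⟩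
  | mem t X =>
    exact ⟨S X, hS X, fun V hV α _ g hg =>
      ⟨hV.1.comp (primrec_eval hg t), hV.2.comp (primrec_eval hg t)⟩⟩
  | bot =>
    obtain ⟨W, hW⟩ := hM.nonempty
    exact ⟨W, hW, fun V _ α _ g hg => ⟨RE.const V False, RE.const V (¬ False)⟩⟩
  | @imp φ ψ _ _ hφ hψ =>
    obtain ⟨W, hW, h⟩ := hφ
    obtain ⟨W', hW', h'⟩ := hψ
    refine ⟨_, hM.join hW hW', fun V hV α _ g hg => ?_⟩
    have h1 := h V ((red_join_left W W').trans hV) g hg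
    have h2 := h' V ((red_join_right W W').trans hV) g hg
    exact ⟨(h1.2.or h2.1).of_iff fun a => by rw [sat_imp]; tauto,
      (h1.1.and h2.2).of_iff fun a => by rw [sat_imp]; tauto⟩
  | @ballN t φ _ hφ =>
    obtain ⟨W, hW, h⟩ := hφ
    refine ⟨W, hW, fun V hV α _ g hg => ?_⟩
    have h1 := h V hV (fun x : α × ℕ => push x.2 (g x.1)) (primrec_push hg)
    have ht := primrec_eval hg t
    refine ⟨(RE.all_lt (p := fun a n => φ.Sat M (push n (g a)) S) h1.1 ht).of_iff
      fun a => sat_ballN, (RE.ex (p := fun a n => n < t.eval (g a) ∧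
        ¬ φ.Sat M (push n (g a)) S) ((RE.of_primrec (nat_lt.comp snd (ht.comp fst)) V).and
          h1.2)).of_iff fun a => ?_⟩
    simp

/-- Membership is enumerated by the Σ₁ formula and nonmembership by the negation of the Π₁ formula,
both over the join of two members of the ideal. -/
theorem sat_comprehension {M : Set (Set ℕ)} (hM : IsTuringIdeal M) {φ ψ : Formula}
    (hφ : φ.IsSigma01) (hψ : ψ.IsPi01) (ρ : ℕ → ℕ) {S : ℕ → Set ℕ} (hS : ∀ n, S n ∈ M) :
    (imp (allN (iff φ ψ)) (comprehensionFor φ)).Sat M ρ S := by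
  obtain ⟨θ, hθ, rfl⟩ := hφ
  obtain ⟨η, hη, rfl⟩ := hψ
  intro h
  obtain ⟨W, hW, h1⟩ := hθ.exists_re hM hS
  obtain ⟨W', hW', h2⟩ := hη.exists_re hM hS
  have hg := primrec_push (primrec_push (α := Unit) (g := fun _ => ρ) fun i => .const _)
  have h1 := (h1 _ (red_join_left W W') _ hg).1
  have h2 := (h2 _ (red_join_right W W') _ hg).2
  have hi : Primrec fun x : ℕ × ℕ => (((), x.1), x.2) := ((Primrec.const ()).pair fst).pair snd
  simp only [comprehensionFor, sat_exS, sat_allN, sat_iff, sat_mem, sat_upS, Term.eval_var,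
    push_zero] at h ⊢
  refine ⟨{n | (exN θ).Sat M (push n ρ) S}, hM.red ⟨?_, ?_⟩ (hM.join hW hW'), fun n => Iff.rfl⟩
  · exact (RE.ex (p := fun n k => θ.Sat M (push k (push n ρ)) S) (h1.comp hi)).of_iff
      fun n => sat_exN
  · refine (RE.ex (p := fun n k => ¬ η.Sat M (push k (push n ρ)) S) (h2.comp hi)).of_iff
      fun n => ?_
    rw [Set.mem_ofPred, h n, ← not_forall]

end Formula

open Formula

theorem BasicAxiom.sat {M : Set (Set ℕ)} {φ : Formula} (h : BasicAxiom φ) (ρ : ℕ → ℕ)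
    (S : ℕ → Set ℕ) : φ.Sat M ρ S := by
  cases h <;> simp
  · ring
  · ring
  · omega

/-- Numbers are standard in an ω-model, so induction holds for all formulas. -/
theorem sat_inductionFor {M : Set (Set ℕ)} (φ : Formula) (ρ : ℕ → ℕ) (S : ℕ → Set ℕ) :
    (inductionFor φ).Sat M ρ S := by
  simp only [inductionFor, sat_imp, sat_and, sat_allN, sat_instN, sat_succN]
  exact fun ⟨h0, hs⟩ n => Nat.rec h0 hs n

theorem RCA0.sat {M : Set (Set ℕ)} (hM : IsTuringIdeal M) {φ : Formula} (h : RCA0 φ) (ρ : ℕ → ℕ)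
    (S : ℕ → Set ℕ) (hS : ∀ n, S n ∈ M) : φ.Sat M ρ S := by
  cases h with
  | basic h => exact h.sat ρ S
  | induction _ => exact sat_inductionFor _ ρ S
  | comprehension h h' => exact sat_comprehension hM h h' ρ hS

end TreeTheorem

/-! ### Strings coded by numbers and the meaning of TT²₂ in an ω-model -/

namespace TreeTheorem

open Encodable Primrec Formula

/-- The number with binary expansion `1 b₀ b₁ … bₖ₋₁`. -/
def num (σ : List Bool) : ℕ := σ.foldl (fun n b => 2 * n + b.toNat) 1

@[simp] theorem num_nil : num [] = 1 := rfl

@[simp] theorem num_concat (σ : List Bool) (b : Bool) : num (σ ++ [b]) = 2 * num σ + b.toNat := by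
  simp [num]

theorem num_pos (σ : List Bool) : 0 < num σ := by
  induction σ using List.reverseRecOn with
  | nil => simp
  | append_singleton σ b ih => rw [num_concat]; omega

theorem num_injective : Function.Injective num := by
  intro σ
  induction σ using List.reverseRecOn with
  | nil =>
    intro τ h
    rcases τ.eq_nil_or_concat with rfl | ⟨τ, b, rfl⟩
    · rfl
    · have := num_pos τ
      simp only [List.concat_eq_append, num_concat, num_nil] at h
      omega
  | append_singleton σ b ih =>
    intro τ h
    rcases τ.eq_nil_or_concat with rfl | ⟨τ, c, rfl⟩
    · have := num_pos σ
      simp only [num_concat, num_nil] at h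
      omega
    · simp only [List.concat_eq_append, num_concat] at h
      have hb : b = c := by cases b <;> cases c <;> simp at h ⊢ <;> omega
      subst hb
      rw [ih (a₂ := τ) (by omega), List.concat_eq_append]

theorem exists_num {n : ℕ} (hn : 0 < n) : ∃ σ, num σ = n := by
  induction n using Nat.strong_induction_on with
  | _ n ih =>
    rcases Nat.lt_or_ge n 2 with h | h
    · exact ⟨[], by simp; omega⟩
    · obtain ⟨σ, hσ⟩ := ih (n / 2) (by omega) (by omega)
      refine ⟨σ ++ [decide (n % 2 = 1)], ?_⟩
      rw [num_concat, hσ]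
      rcases Nat.mod_two_eq_zero_or_one n with h' | h' <;> simp [h'] <;> omega

theorem num_append (σ τ : List Bool) :
    ∃ r < 2 ^ τ.length, num (σ ++ τ) = num σ * 2 ^ τ.length + r := by
  induction τ using List.reverseRecOn with
  | nil => exact ⟨0, by simp⟩
  | append_singleton τ b ih =>
    obtain ⟨r, hr, h⟩ := ih
    refine ⟨2 * r + b.toNat, ?_, ?_⟩
    · have := b.toNat_lt
      rw [List.length_append, List.length_singleton, pow_succ]
      omega
    · rw [← List.append_assoc, num_concat, h, List.length_append, List.length_singleton, pow_succ]
      ring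

theorem exists_append_of_lt (σ : List Bool) (k : ℕ) {r : ℕ} (hr : r < 2 ^ k) :
    ∃ τ, num (σ ++ τ) = num σ * 2 ^ k + r := by
  induction k generalizing r with
  | zero => exact ⟨[], by simp at hr; simp [hr]⟩
  | succ k ih =>
    rw [pow_succ] at hr
    obtain ⟨τ, hτ⟩ := ih (r := r / 2) (by omega)
    refine ⟨τ ++ [decide (r % 2 = 1)], ?_⟩
    rw [← List.append_assoc, num_concat, hτ, pow_succ, ← mul_assoc]
    rcases Nat.mod_two_eq_zero_or_one r with h' | h' <;> simp [h'] <;> omega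

theorem primrec_num : Primrec num :=
  list_foldl (h := fun (_ : List Bool) (p : ℕ × Bool) => 2 * p.1 + p.2.toNat) .id (.const 1)
    (nat_add.comp (nat_double.comp (fst.comp snd)) ((dom_finite Bool.toNat).comp (snd.comp snd)))

theorem red_image_num (H : Set (List Bool)) : Red (num '' H) (codes H) := by
  have h0 : PrimrecPred fun x : ℕ × List Bool => num x.2 = x.1 :=
    Primrec.eq.comp (primrec_num.comp snd) fst
  have hc (σ : List Bool) : encode σ ∈ codes H ↔ σ ∈ H := encode_mem_codes
  constructor
  · refine (RE.ex (p := fun (n : ℕ) (σ : List Bool) => num σ = n ∧ encode σ ∈ codes H)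
      ((RE.of_primrec h0 _).and ((RE.mem _).comp (Primrec.encode.comp snd)))).of_iff fun n => ?_
    simp [hc, Set.mem_image, and_comm]
  -- Zero codes no string, and every positive number codes exactly one.
  · refine ((RE.of_primrec (Primrec.eq.comp .id (.const 0)) _).or
      (RE.ex (p := fun (n : ℕ) (σ : List Bool) => num σ = n ∧ encode σ ∉ codes H)
      ((RE.of_primrec h0 _).and ((RE.not_mem _).comp (Primrec.encode.comp snd))))).of_iff
        fun n => ?_
    simp only [hc, id]
    rcases Nat.eq_zero_or_pos n with rfl | hn
    · simp [(num_pos _).ne']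
    · obtain ⟨σ, rfl⟩ := exists_num hn
      simp [(num_pos _).ne', num_injective.eq_iff]

/-- The pairing function of second-order arithmetic. -/
def sqPair (s t : ℕ) : ℕ := (s + t) * (s + t) + s

/-- The code lies between the square of `s + t` and the next square, so it determines `s + t` and
then `s`. -/
theorem sqPair_inj {s t s' t' : ℕ} : sqPair s t = sqPair s' t' ↔ s = s' ∧ t = t' := by
  refine ⟨fun h => ?_, fun ⟨h, h'⟩ => by rw [h, h']⟩
  unfold sqPair at h
  rcases lt_trichotomy (s + t) (s' + t') with h' | h' | h'
  · nlinarith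
  · rw [h'] at h; omega
  · nlinarith

theorem primrec_sqPair : Primrec₂ sqPair :=
  nat_add.comp (nat_mul.comp nat_add nat_add) fst

section Satisfaction

variable {M : Set (Set ℕ)} {ρ : ℕ → ℕ} {S : ℕ → Set ℕ}

@[simp] theorem eval_pair (s t : Term) :
    (Term.pair s t).eval ρ = sqPair (s.eval ρ) (t.eval ρ) := rfl

theorem sat_isPowTwo {t : Term} : (isPowTwo t).Sat M ρ S ↔ ∃ k, t.eval ρ = 2 ^ k := by
  simp only [isPowTwo, sat_and, sat_neg, sat_eq, sat_ballN, sat_imp, sat_or, sat_bexN,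
    Term.eval_add, Term.eval_one, Term.eval_zero, Term.eval_mul, Term.eval_up, Term.eval_var,
    push_zero, push_one, push_two]
  constructor
  · rintro ⟨h0, h⟩
    -- A nonzero number that is not a power of two has an odd prime divisor, which the formula
    -- forbids.
    rcases Nat.eq_two_pow_or_exists_odd_prime_and_dvd (t.eval ρ) with h1 | ⟨p, hp, ⟨q, hq⟩, ho⟩
    · exact h1
    · have hp0 := hp.pos
      have hq0 : 0 < q := Nat.pos_of_ne_zero fun h' => h0 (by rw [hq, h', mul_zero])
      rcases h p (by rw [hq]; nlinarith) q (by rw [hq]; nlinarith) hq.symm with h1 | ⟨c, _, h1⟩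
      · exact absurd h1 hp.ne_one
      · exact absurd ⟨c, h1⟩ (Nat.not_even_iff_odd.2 ho)
  · rintro ⟨k, hk⟩
    refine ⟨by rw [hk]; positivity, fun a _ b _ hab => ?_⟩
    rw [hk] at hab
    obtain ⟨j, _, rfl⟩ := (Nat.dvd_prime_pow Nat.prime_two).1 ⟨b, hab.symm⟩
    cases j with
    | zero => exact Or.inl rfl
    | succ j => exact Or.inr ⟨2 ^ j, by rw [pow_succ]; omega, by rw [pow_succ]; omega⟩

theorem sat_isPrefix {s t : Term} : (isPrefix s t).Sat M ρ S ↔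
    ∃ σ τ, s.eval ρ = num σ ∧ t.eval ρ = num τ ∧ σ <+: τ := by
  simp only [isPrefix, sat_and, sat_neg, sat_eq, sat_bexN, sat_isPowTwo, Term.eval_add,
    Term.eval_one, Term.eval_zero, Term.eval_mul, Term.eval_up, Term.eval_var, push_zero, push_one]
  constructor
  · rintro ⟨h0, p, -, ⟨k, rfl⟩, r, hr, h⟩
    obtain ⟨σ, hσ⟩ := exists_num (Nat.pos_of_ne_zero h0)
    obtain ⟨τ, hτ⟩ := exists_append_of_lt σ k hr
    exact ⟨σ, σ ++ τ, hσ.symm, by rw [h, hτ, hσ], List.prefix_append _ _⟩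
  · rintro ⟨σ, _, hs, ht, τ, rfl⟩
    obtain ⟨r, hr, h⟩ := num_append σ τ
    have := num_pos σ
    rw [hs, ht]
    refine ⟨this.ne', 2 ^ τ.length, ?_, ⟨_, rfl⟩, r, hr, h⟩
    rw [h]
    nlinarith [Nat.two_pow_pos τ.length]

/-- The relation `≺` between codes of strings. -/
def NumPrefix (a b : ℕ) : Prop := ∃ σ τ, a = num σ ∧ b = num τ ∧ StrictPrefix σ τ

@[simp] theorem numPrefix_num {σ τ : List Bool} :
    NumPrefix (num σ) (num τ) ↔ StrictPrefix σ τ := by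
  constructor
  · rintro ⟨σ', τ', h, h', hp⟩
    rwa [num_injective h, num_injective h']
  · exact fun h => ⟨σ, τ, rfl, rfl, h⟩

@[simp] theorem sat_isStrictPrefix {s t : Term} :
    (isStrictPrefix s t).Sat M ρ S ↔ NumPrefix (s.eval ρ) (t.eval ρ) := by
  rw [isStrictPrefix, sat_and, sat_isPrefix, sat_neg, sat_eq]
  constructor
  · rintro ⟨⟨σ, τ, hs, ht, h⟩, hne⟩
    exact ⟨σ, τ, hs, ht, h, fun h' => hne (by rw [hs, ht, h'])⟩
  · rintro ⟨σ, τ, hs, ht, h⟩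
    exact ⟨⟨σ, τ, hs, ht, h.1⟩, fun h' => h.2 (num_injective (by rw [← hs, ← ht, h']))⟩

@[simp] theorem sat_isRoot {t : Term} {X : ℕ} : (isRoot t X).Sat M ρ S ↔
    t.eval ρ ∈ S X ∧ ∀ n ∈ S X, ¬ NumPrefix n (t.eval ρ) := by
  simp [isRoot]

@[simp] theorem sat_isSuccessor {s t : Term} {X : ℕ} : (isSuccessor s t X).Sat M ρ S ↔
    t.eval ρ ∈ S X ∧ NumPrefix (s.eval ρ) (t.eval ρ) ∧
      ∀ n ∈ S X, ¬ (NumPrefix (s.eval ρ) n ∧ NumPrefix n (t.eval ρ)) := by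
  simp [isSuccessor]

/-- The root is the image of the empty string, and the two immediate successors of `i σ` are the
images of `σ` extended by one bit. Only this direction is needed, since solutions are constructed
outside the model. -/
theorem sat_isFullTree {X : ℕ} {H : Set (List Bool)} (hX : S X = num '' H)
    (hH : IsoFullTree H) : (isFullTree X).Sat M ρ S := by
  obtain ⟨i, hi, hpre⟩ := hH
  have hsub (σ) : num (i σ) ∈ S X := by
    rw [hX]
    exact Set.mem_image_of_mem _ (hi.mapsTo (Set.mem_univ σ))
  have hex (n : ℕ) (h : n ∈ S X) : ∃ σ, n = num (i σ) := by
    rw [hX] at h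
    obtain ⟨τ, hτ, rfl⟩ := h
    obtain ⟨σ, -, rfl⟩ := hi.surjOn hτ
    exact ⟨σ, rfl⟩
  have hinj : Function.Injective fun σ => num (i σ) := fun σ τ h =>
    hi.injOn (Set.mem_univ _) (Set.mem_univ _) (num_injective h)
  have hall {p : ℕ → Prop} : (∀ n ∈ S X, p n) ↔ ∀ σ, p (num (i σ)) := by
    refine ⟨fun h σ => h _ (hsub σ), fun h n hn => ?_⟩
    obtain ⟨σ, rfl⟩ := hex n hn
    exact h σ
  have hp (σ τ : List Bool) : NumPrefix (num (i σ)) (num (i τ)) ↔ StrictPrefix σ τ := by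
    rw [numPrefix_num, StrictPrefix, StrictPrefix, ← hpre, Ne, Ne,
      hi.injOn.eq_iff (Set.mem_univ _) (Set.mem_univ _)]
  have hsucc (σ : List Bool) (b : Bool) (τ : List Bool) :
      ¬ (StrictPrefix σ τ ∧ StrictPrefix τ (σ ++ [b])) := by
    rintro ⟨h1, h2⟩
    have := h1.length_lt
    have := h2.length_lt
    simp at this
    omega
  simp only [isFullTree, sat_and, sat_allN, sat_imp, sat_mem, sat_neg, sat_eq, sat_exN, sat_isRoot,
    sat_isSuccessor, sat_or, Term.eval_var, Term.eval_zero, push_zero, push_one, push_two,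
    push_three, and_imp, hall, hp]
  refine ⟨fun σ => (num_pos _).ne', ⟨num (i []), ⟨hsub _, fun σ => ?_⟩, fun σ h => ?_⟩,
    fun σ => ⟨num (i (σ ++ [false])), num (i (σ ++ [true])), ?_, ⟨hsub _, ?_, ?_⟩,
      ⟨hsub _, ?_, ?_⟩, fun τ h h' => ?_⟩⟩
  · rw [hp]
    exact fun h => by simpa using h.length_lt
  · by_contra hne
    exact h [] ⟨List.nil_prefix, fun h' => hne (by rw [h'])⟩
  · intro h
    simpa using hinj h
  · rw [hp]
    exact ⟨List.prefix_append _ _, by simp⟩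
  · intro τ
    rw [hp]
    exact hsucc σ _ τ
  · rw [hp]
    exact ⟨List.prefix_append _ _, by simp⟩
  · intro τ
    rw [hp]
    exact hsucc σ _ τ
  · obtain ⟨⟨l, rfl⟩, hne⟩ := h
    cases l with
    | nil => simp at hne
    | cons b l =>
      have hl : l = [] := by
        by_contra hl
        refine h' (σ ++ [b]) ⟨⟨List.prefix_append _ _, by simp⟩, ⟨l, by simp⟩, by simpa using hl⟩
      subst hl
      cases b
      · exact Or.inl rfl
      · exact Or.inr rfl

end Satisfaction

theorem sat_TT22 {M : Set (Set ℕ)} (hM : IsTuringIdeal M)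
    (h : ∀ W ∈ M, ∀ f, REColoring W f → ∃ i H, IsoFullTree H ∧ Hom f i H ∧ codes H ∈ M)
    (ρ : ℕ → ℕ) (S : ℕ → Set ℕ) : TT22.Sat M ρ S := by
  classical
  intro F hF hcol
  simp only [isColoring, sat_and, sat_allN, sat_imp, sat_mem, sat_exN, sat_isStrictPrefix,
    sat_lt, sat_eq, Term.eval_var, Term.eval_two, eval_pair, push_zero, push_one, push_two,
    push_three] at hcol
  obtain ⟨h1, h2⟩ := hcol
  -- Color true is read off from the presence of the code with color `1`. On comparable pairs its
  -- absence means color `0`, because `F` assigns some color below two.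
  let f : List Bool → List Bool → Bool := fun σ τ =>
    decide (sqPair (sqPair (num σ) (num τ)) 1 ∈ F)
  have hf : REColoring F f := by
    have hpr : Primrec fun x : (List Bool × List Bool) × Bool =>
        sqPair (sqPair (num x.1.1) (num x.1.2)) 1 :=
      primrec_sqPair.comp (primrec_sqPair.comp (primrec_num.comp (fst.comp fst))
        (primrec_num.comp (snd.comp fst))) (.const 1)
    refine ((RE.of_primrec (primrecRel_strictPrefix.comp (fst.comp fst) (snd.comp fst)) F).and
      (((RE.of_primrec (Primrec.eq.comp snd (.const true)) F).and ((RE.mem F).comp hpr)).or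
      ((RE.of_primrec (Primrec.eq.comp snd (.const false)) F).and
        ((RE.not_mem F).comp hpr)))).of_iff fun x => ?_
    obtain ⟨x, b⟩ := x
    cases b <;> simp [f]
  have hval (σ τ : List Bool) (hστ : StrictPrefix σ τ) :
      sqPair (sqPair (num σ) (num τ)) (f σ τ).toNat ∈ F := by
    obtain ⟨c, hc, -⟩ := h2 (num σ) (num τ) (numPrefix_num.2 hστ)
    by_cases hc1 : sqPair (sqPair (num σ) (num τ)) 1 ∈ F
    · simp [f, hc1]
    · obtain ⟨a, b, d, -, hd, he⟩ := h1 _ hc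
      have hcd := (sqPair_inj.1 he).2
      have : c ≠ 1 := by
        rintro rfl
        exact hc1 hc
      have : c = 0 := by omega
      subst this
      simpa [f, hc1] using hc
  obtain ⟨i, H, hH, hhom, hHM⟩ := h F hF f hf
  refine sat_exS.2 ⟨num '' H, hM.red (red_image_num H) hHM, sat_and.2 ⟨sat_isFullTree rfl hH, ?_⟩⟩
  simp only [isHomogeneous, sat_and, sat_allN, sat_imp, sat_mem, sat_exN, sat_isStrictPrefix,
    sat_lt, Term.eval_var, Term.eval_two, eval_pair, push_zero, push_one, push_two]
  refine ⟨i.toNat, i.toNat_lt, ?_⟩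
  rintro _ _ ⟨⟨σ, hσ, rfl⟩, ⟨τ, hτ, rfl⟩, hστ⟩
  rw [numPrefix_num] at hστ
  have := hval σ τ hστ
  rwa [hhom σ hσ τ hτ hστ] at this

end TreeTheorem

/-! ### An ideal closed under TT²₂ outside a cone, and unprovability of ACA₀ -/

namespace TreeTheorem

open Encodable Primrec Formula

/-- Colorings with the same graph `p` agree on comparable pairs, so one solution serves all of them;
if `p` is no such graph, nothing needs to be added. -/
theorem exists_closure_step {C W : Set ℕ} (hC : ¬ Red C W)
    (p : (List Bool × List Bool) × Bool → Prop) (hp : RE W p) :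
    ∃ W', ¬ Red C W' ∧ Red W W' ∧
      ∀ f : List Bool → List Bool → Bool,
        (p = fun x => StrictPrefix x.1.1 x.1.2 ∧ f x.1.1 x.1.2 = x.2) →
          ∃ i H, IsoFullTree H ∧ Hom f i H ∧ Red (codes H) W' := by
  by_cases h : ∃ f : List Bool → List Bool → Bool,
      p = fun x => StrictPrefix x.1.1 x.1.2 ∧ f x.1.1 x.1.2 = x.2
  · obtain ⟨f, rfl⟩ := h
    obtain ⟨i, H, hH, hhom, hCH⟩ := exists_homogeneous_tree hC hp
    refine ⟨_, hCH, red_join_right _ _, fun g hg => ⟨i, H, hH, fun σ hσ τ hτ hστ => ?_,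
      red_join_left _ _⟩⟩
    exact ((congrFun hg ((σ, τ), i)).mp ⟨hστ, hhom σ hσ τ hτ hστ⟩).2
  · exact ⟨W, hC, Red.refl W, fun f hf => absurd ⟨f, hf⟩ h⟩

/-- There is a Turing ideal containing `Z`, omitting `C`, and closed under solutions of `TT²₂`. -/
theorem exists_ideal {C Z : Set ℕ} (hC : ¬ Red C Z) :
    ∃ M : Set (Set ℕ), IsTuringIdeal M ∧ Z ∈ M ∧ C ∉ M ∧ ∀ W ∈ M, ∀ f, REColoring W f →
      ∃ i H, IsoFullTree H ∧ Hom f i H ∧ codes H ∈ M := by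
  have hnext (W : Set ℕ) (p : (List Bool × List Bool) × Bool → Prop) : ∃ W', ¬ Red C W → RE W p →
      (¬ Red C W' ∧ Red W W' ∧ ∀ f : List Bool → List Bool → Bool,
        (p = fun x => StrictPrefix x.1.1 x.1.2 ∧ f x.1.1 x.1.2 = x.2) →
          ∃ i H, IsoFullTree H ∧ Hom f i H ∧ Red (codes H) W') := by
    by_cases h : ¬ Red C W ∧ RE W p
    · obtain ⟨W', hW'⟩ := exists_closure_step h.1 p h.2
      exact ⟨W', fun _ _ => hW'⟩
    · exact ⟨W, fun h1 h2 => absurd ⟨h1, h2⟩ h⟩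
  choose next hnext using hnext
  choose enum henum hsurj using exists_enum ((List Bool × List Bool) × Bool)
  -- A stage carries the current oracle and a table enumerating the relations enumerable in each
  -- oracle so far. Stage `m` treats relation `m.unpair.2` of oracle `m.unpair.1`; since
  -- `m.unpair.1` is at most `m`, that oracle is already available.
  let st : ℕ → Set ℕ × (ℕ → ℕ → (List Bool × List Bool) × Bool → Prop) := fun m =>
    Nat.rec (Z, fun _ => enum Z) (fun m s =>
      let W := next s.1 (s.2 m.unpair.1 m.unpair.2)
      (W, Function.update s.2 (m + 1) (enum W))) m
  let Y : ℕ → Set ℕ := fun m => (st m).1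
  have hst (m : ℕ) : ∀ a ≤ m, (st m).2 a = enum (Y a) := by
    induction m with
    | zero =>
      intro a ha
      obtain rfl : a = 0 := by omega
      rfl
    | succ m ih =>
      intro a ha
      rcases ha.lt_or_eq with h | rfl
      · exact (Function.update_of_ne h.ne _ _).trans (ih a (by omega))
      · exact Function.update_self _ _ _
  have hY (m : ℕ) : Y (m + 1) = next (Y m) (enum (Y m.unpair.1) m.unpair.2) := by
    rw [← hst m _ (Nat.unpair_left_le m)]
  have hinv (m : ℕ) : ¬ Red C (Y m) ∧ ∀ a ≤ m, Red (Y a) (Y m) := by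
    induction m with
    | zero =>
      refine ⟨hC, fun a ha => ?_⟩
      obtain rfl : a = 0 := by omega
      exact Red.refl _
    | succ m ih =>
      have h := hnext (Y m) (enum (Y m.unpair.1) m.unpair.2) ih.1
        ((henum _ _).trans (ih.2 _ (Nat.unpair_left_le m)))
      rw [← hY m] at h
      refine ⟨h.1, fun a ha => ?_⟩
      rcases ha.lt_or_eq with h' | rfl
      · exact (ih.2 a (by omega)).trans h.2.1
      · exact Red.refl _
  have hmono {a b : ℕ} (h : a ≤ b) : Red (Y a) (Y b) := (hinv b).2 a h
  refine ⟨{X | ∃ m, Red X (Y m)}, ⟨⟨Z, 0, Red.refl Z⟩, fun h ⟨m, hm⟩ => ⟨m, h.trans hm⟩, ?_⟩,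
    ⟨0, Red.refl Z⟩, fun ⟨m, hm⟩ => (hinv m).1 hm, ?_⟩
  · rintro A B ⟨a, ha⟩ ⟨b, hb⟩
    exact ⟨max a b, (ha.trans (hmono (le_max_left _ _))).join (hb.trans (hmono (le_max_right _ _)))⟩
  · rintro W ⟨a, ha⟩ f hf
    obtain ⟨b, hb⟩ := hsurj (Y a) _ (hf.mono ha)
    have hm : (Nat.pair a b).unpair = (a, b) := Nat.unpair_pair a b
    have h := hnext (Y (Nat.pair a b)) (enum (Y a) b) (hinv _).1
      ((henum _ _).trans (hmono (Nat.left_le_pair a b)))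
    obtain ⟨i, H, h1, h2, h3⟩ := h.2.2 f hb
    refine ⟨i, H, h1, h2, Nat.pair a b + 1, ?_⟩
    rwa [hY, hm]

/-- A decidable set whose projection is the halting problem. -/
def haltingGraph : Set ℕ :=
  {x | ∃ n ≤ x, ∃ m ≤ x, sqPair n m = x ∧
    (Nat.Partrec.Code.evaln m (Denumerable.ofNat Nat.Partrec.Code n) 0).isSome}

theorem sqPair_mem_haltingGraph {n m : ℕ} : sqPair n m ∈ haltingGraph ↔
    (Nat.Partrec.Code.evaln m (Denumerable.ofNat Nat.Partrec.Code n) 0).isSome := by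
  constructor
  · rintro ⟨n', -, m', -, h, h'⟩
    obtain ⟨rfl, rfl⟩ := sqPair_inj.1 h
    exact h'
  · refine fun h => ⟨n, ?_, m, ?_, rfl, h⟩ <;> unfold sqPair <;> nlinarith

theorem primrecPred_haltingGraph : PrimrecPred fun x => x ∈ haltingGraph := by
  have hev : PrimrecPred fun y : (ℕ × ℕ) × ℕ =>
      (Nat.Partrec.Code.evaln y.2 (Denumerable.ofNat Nat.Partrec.Code y.1.2) 0).isSome = true :=
    Primrec.eq.comp (option_isSome.comp (Nat.Partrec.Code.primrec_evaln.comp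
      ((snd.pair ((Primrec.ofNat _).comp (snd.comp fst))).pair (.const 0)))) (.const true)
  have h1 : PrimrecRel fun (y : ℕ × ℕ) (m : ℕ) => sqPair y.2 m = y.1 ∧
      (Nat.Partrec.Code.evaln m (Denumerable.ofNat Nat.Partrec.Code y.2) 0).isSome = true :=
    (Primrec.eq.comp (primrec_sqPair.comp (snd.comp fst) snd) (fst.comp fst)).and hev
  have h2 : PrimrecRel fun x n : ℕ => ∃ m ∈ List.range (x + 1), sqPair n m = x ∧
      (Nat.Partrec.Code.evaln m (Denumerable.ofNat Nat.Partrec.Code n) 0).isSome = true :=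
    primrecPred_exists_mem h1 (list_range.comp (succ.comp fst))
  refine (primrecPred_exists_mem h2 (list_range.comp succ)).of_eq fun x => ?_
  simp [haltingGraph]

/-- The halting graph is primitive recursive and gives no help as an oracle, so a reduction would
make nonhalting recursively enumerable. -/
theorem not_red_halting : ¬ Red {n | ∃ m, sqPair n m ∈ haltingGraph} haltingGraph := by
  classical
  intro h
  have h0 : Red haltingGraph ∅ :=
    ⟨RE.of_primrec primrecPred_haltingGraph _, RE.of_primrec primrecPred_haltingGraph.not _⟩
  obtain ⟨R, ⟨dR, hR⟩, hRE⟩ := (h.trans h0).2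
  have hres (k : ℕ) : res ∅ k = (List.range k).map fun _ => false := by simp [res]
  have hcomp : Computable₂ fun (c : Nat.Partrec.Code) (k : ℕ) =>
      decide (R (encode c) (res ∅ k)) := by
    refine (Primrec.to_comp ?_)
    refine ((hR.comp ((Primrec.encode.comp fst).pair (list_map (list_range.comp snd)
      (Primrec₂.const false)))).of_eq fun x => ?_)
    simp [hres]
  refine ComputablePred.halting_problem_not_re 0 ((Partrec.rfind hcomp.partrec₂).dom_re.of_eq
    fun c => ?_)
  have hc := hRE (encode c)
  simp only [Set.mem_ofPred, sqPair_mem_haltingGraph, Denumerable.ofNat_encode] at hc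
  rw [Nat.rfind_dom]
  have hdom : (c.eval 0).Dom ↔ ∃ m, (c.evaln m 0).isSome := by
    rw [Part.dom_iff_mem]
    simp only [Nat.Partrec.Code.evaln_complete, Option.isSome_iff_exists, Option.mem_def]
    exact exists_comm
  rw [hdom, hc]
  simp

/-- Take the ideal that contains the halting graph and omits its projection. By soundness the
comprehension instance for the projection of a set would hold in it and put the omitted set back. -/
theorem not_provable_ACA0 :
    ¬ ∀ φ, ACA0 φ → Provable RCA0 (imp TT22 φ) := by
  intro h
  obtain ⟨M, hM, hZ, hC, hTT⟩ := exists_ideal not_red_halting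
  have hφ := h _ (ACA0.comprehension
    (φ := exN (mem (Term.pair (.var 1) (.var 0)) 0)) (by simp [exN, neg, IsArithmetical]))
  have hsat := hφ.sat (M := M) (fun φ h => h.sat hM) (fun _ => 0) (fun _ => haltingGraph)
    (fun _ => hZ) (sat_TT22 hM hTT _ _)
  simp only [comprehensionFor, sat_exS, sat_allN, sat_iff, sat_mem, sat_upS, sat_exN, eval_pair,
    Term.eval_var, push_zero, push_one] at hsat
  obtain ⟨X, hX, hXC⟩ := hsat
  exact hC ((Set.ext hXC : X = {n | ∃ m, sqPair n m ∈ haltingGraph}) ▸ hX)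

end TreeTheorem

/-- `TT²₂` admits cone avoidance, and `RCA₀` does not prove `TT²₂ → ACA₀`. -/
theorem mainTheorem1 :
    (∀ Z C : Set ℕ, ¬ TreeTheorem.SetReducible C Z →
      ∀ f : TreeTheorem.Coloring, f.ComputableFrom Z →
        ∃ H : Set (List Bool), TreeTheorem.IsoFullTree H ∧ f.Homogeneous H ∧
          ¬ TreeTheorem.SetReducible C (TreeTheorem.join (TreeTheorem.codes H) Z)) ∧
    ¬ ∀ φ : TreeTheorem.Formula, TreeTheorem.ACA0 φ →
      TreeTheorem.Provable TreeTheorem.RCA0 (TreeTheorem.Formula.imp TreeTheorem.TT22 φ) := by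
  exact ⟨fun Z C hC f hf => TreeTheorem.coneAvoidance hC hf, TreeTheorem.not_provable_ACA0⟩
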